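/- \textbf{Theorem.} Let $\omega$ be the exponent of matrix multiplication over $\mathbb{Q}$, i.e. the infimum of all real $\tau$ such that two $n\times n$ matrices can be multiplied by bilinear algorithms with $O(n^{\tau})$ multiplications, and assume $\omega=2$. Let $1\le\alpha<2$ and $p\in(0,1)$. A dominating set of a graph $G$ is a set $S$ of vertices such that every vertex of $G$ lies in $S$ or is adjacent to a vertex of $S$. There is a randomized algorithm (a program of a word RAM with words of $O(\log n)$ bits, unit-cost arithmetic and unit-cost uniformly random words) that, for every constant $C$, has the following properties on all graphs $G$ with $n$ vertices and at most $C n^{\alpha}$ edges, given by $n$ and a list of the edges in arbitrary order: \begin{enumerate} \item for all outcomes of the random words it halts within $\tilde O(n^{1+\alpha/2})$ steps, that is, within $O(n^{1+\alpha/2}\log^{k} n)$ steps for some $k$, where $k$ and the implied constant may depend on $\alpha$, $p$ and $C$, but not on $G$; \item if $G$ has a dominating set of size $2$, it answers ``yes'' for all outcomes of the random words (no false negatives); \item if $G$ has no dominating set of size $2$, it answers ``no'' with probability at least $p$. \end{enumerate} -/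

import Mathlib

/-! Exponent of matrix multiplication. -/

/-- There is a bilinear algorithm over `K` with `r` multiplications for the product of two `n × n`
matrices: the `t`-th product multiplies a linear form `a t` in the entries of `X` by a linear form
`b t` in the entries of `Y`, and `X * Y` is a fixed linear combination of the `r` products.
Equivalently, the tensor of `n × n` matrix multiplication has rank at most `r`. -/
def HasBilinearMatMul (K : Type*) [Field K] (n r : ℕ) : Prop :=
  ∃ a b c : Fin r → Matrix (Fin n) (Fin n) K, ∀ X Y : Matrix (Fin n) (Fin n) K,
    X * Y = ∑ t, ((∑ i, ∑ j, a t i j * X i j) * (∑ i, ∑ j, b t i j * Y i j)) • c t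

/-- The exponent `ω` of matrix multiplication over `K`: the infimum of all real `τ` for which
`n × n` matrices can be multiplied by bilinear algorithms with `O(n ^ τ)` multiplications. -/
noncomputable def matMulExponent (K : Type*) [Field K] : ℝ :=
  sInf {τ : ℝ | ∃ C : ℝ, ∀ n : ℕ, 1 ≤ n → ∃ r : ℕ, (r : ℝ) ≤ C * (n : ℝ) ^ τ ∧
    HasBilinearMatMul K n r}

/-! Dominating sets. -/

/-- `G` has a dominating set of size `k`: a set `S` of `k` vertices such that every vertex lies
in `S` or is adjacent to a vertex of `S`. -/
def HasDominatingSet {V : Type*} (G : SimpleGraph V) (k : ℕ) : Prop :=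
  ∃ S : Finset V, S.card = k ∧ ∀ v, v ∈ S ∨ ∃ u ∈ S, G.Adj u v

/-- `L` lists every edge of `G` exactly once, in any order and in any orientation. -/
def IsEdgeList {V : Type*} (G : SimpleGraph V) (L : List (V × V)) : Prop :=
  (L.map fun e => s(e.1, e.2)).Nodup ∧ ∀ u v, s(u, v) ∈ (L.map fun e => s(e.1, e.2)) ↔ G.Adj u v

/-! The randomized word RAM. -/

namespace WordRAM

/-- Arithmetic operations on words. -/
inductive Op where
  | add | sub | mul | div | mod

/-- Instructions. `d`, `a`, `b` are indices of registers and `l` is a position in the program. -/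
inductive Instr where
  | const (d k : ℕ)           -- put the constant `k` into register `d`
  | op (f : Op) (d a b : ℕ)   -- apply `f` to registers `a`, `b`, result into register `d`
  | load (d a : ℕ)            -- copy into register `d` the memory cell addressed by register `a`
  | store (a b : ℕ)           -- copy register `b` into the memory cell addressed by register `a`
  | rand (d : ℕ)              -- put a fresh uniformly random word into register `d`
  | jmp (l : ℕ)               -- jump to `l`
  | jlt (a b l : ℕ)           -- jump to `l` if register `a` is smaller than register `b`
  | jeq (a b l : ℕ)           -- jump to `l` if registers `a` and `b` are equal
  | halt (answer : Bool)      -- stop with the given answer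

/-- A program is a finite list of instructions; it does not depend on the input, on its size or
on the word size, and it refers to finitely many registers only. -/
abbrev Program := List Instr

/-- A configuration of a machine with words of `w` bits (and thus `2 ^ w` memory cells). -/
structure Config (w : ℕ) where
  pc : ℕ                        -- position of the next instruction
  reg : ℕ → BitVec w            -- registers
  mem : BitVec w → BitVec w     -- memory
  used : ℕ                      -- number of random words consumed so far

/-- Operations are modulo `2 ^ w`; `div` and `mod` are those of unsigned numbers. -/
def Op.eval {w : ℕ} : Op → BitVec w → BitVec w → BitVec w
  | .add, x, y => x + y
  | .sub, x, y => x - y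
  | .mul, x, y => x * y
  | .div, x, y => x / y
  | .mod, x, y => x % y

/-- Write the word `x` into register `d` and go on to the next instruction. -/
def Config.setReg {w : ℕ} (c : Config w) (d : ℕ) (x : BitVec w) : Config w :=
  { c with pc := c.pc + 1, reg := Function.update c.reg d x }

/-- Go to position `l` of the program. -/
def Config.goto {w : ℕ} (c : Config w) (l : ℕ) : Config w :=
  { c with pc := l }

/-- The effect of one instruction, when `ρ` is the sequence of random words supplied to the
machine. (`halt` has no successor; it is treated in `run`.) -/
def exec {w : ℕ} (ρ : ℕ → BitVec w) (c : Config w) : Instr → Config w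
  | .const d k => c.setReg d (BitVec.ofNat w k)
  | .op f d a b => c.setReg d (f.eval (c.reg a) (c.reg b))
  | .load d a => c.setReg d (c.mem (c.reg a))
  | .store a b => { c with pc := c.pc + 1, mem := Function.update c.mem (c.reg a) (c.reg b) }
  | .rand d => { c.setReg d (ρ c.used) with used := c.used + 1 }
  | .jmp l => c.goto l
  | .jlt a b l => c.goto (if (c.reg a).toNat < (c.reg b).toNat then l else c.pc + 1)
  | .jeq a b l => c.goto (if c.reg a = c.reg b then l else c.pc + 1)
  | .halt _ => c

/-- `run P ρ t c = some b` means that `P`, started in `c` with random words `ρ`, halts within `t`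
steps with the answer `b`. Every instruction is one step. Leaving the program is not halting. -/
def run {w : ℕ} (P : Program) (ρ : ℕ → BitVec w) : ℕ → Config w → Option Bool
  | 0, _ => none
  | t + 1, c =>
    match P[c.pc]? with
    | none => none
    | some (.halt b) => some b
    | some i => run P ρ t (exec ρ c i)

/-- The initial configuration on a list of numbers: the list is stored in memory from cell `0` on,
and all other cells and all registers are `0`. -/
def init (w : ℕ) (input : List ℕ) : Config w where
  pc := 0
  reg := fun _ => 0
  mem := fun a => BitVec.ofNat w (input.getD a.toNat 0)
  used := 0

/-- The probability that `P`, on the given input and with words of `w` bits, halts within `t` steps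
with the answer `b`: the proportion of such outcomes among all sequences of `t` random words.
(Within `t` steps the machine reads at most `t` random words.) -/
noncomputable def prob (P : Program) (w : ℕ) (input : List ℕ) (t : ℕ) (b : Bool) : ℝ :=
  ({ρ : Fin t → BitVec w |
      run P (fun i => if h : i < t then ρ ⟨i, h⟩ else 0) t (init w input) = some b}.ncard : ℝ) /
    ((2 : ℝ) ^ w) ^ t

end WordRAM

/-- The input given to the machine for a graph on `Fin n` with edge list `L`: the number of
vertices, the number of edges, and the two ends of each edge. -/
def graphInput {n : ℕ} (L : List (Fin n × Fin n)) : List ℕ :=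
  n :: L.length :: L.flatMap fun e => [e.1.val, e.2.val]

/-- Words of `O(log n)` bits. -/
def wordSize (κ n : ℕ) : ℕ := κ * Nat.clog 2 (n + 2)

/-- `f = Õ(g)`: `f` is `O(g · logᵏ)` for some `k`. -/
def IsSoftO (f g : ℕ → ℝ) : Prop :=
  ∃ k : ℕ, f =O[Filter.atTop] fun n => g n * Real.log n ^ k

/-! Let `M = 2 m + n` count the arcs: both orientations of every edge, and a loop at every vertex,
so that out-degrees are sizes of closed neighbourhoods. In a dominating pair one vertex `u` is
heavy, that is, `N[u]` has at least `n / 2` elements; there are `h ≤ 2 M / n` heavy vertices. The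
partner `v` is sought level by level, among the `c` vertices with degree in `[D, 2 D)`, where `D = 2
^ lev`; here `c D ≤ M`.

The pair dominates iff `N[v]` contains every vertex outside `N[u]`. This is tested by `K = 2 ⌈log₂
n⌉ + c'` random hash functions into `4 D` buckets, with `c'` depending on `p` only: every bucket of
a vertex outside `N[u]` has to be hit by `N[v]`. A dominating pair always passes (`exists_found`).
If some vertex is dominated by neither, one hash function hides it with probability at most `2 D / 4
D = 1 / 2`, so a wrong pair passes with probability at most `2 ^ -K ≤ n ^ -2 * 2 ^ -c'`. A union
bound over the pairs gives the error `2 ^ -c'` (`card_collision_le`, `card_found_le`).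

All tests of a level form one product of 0-1 matrices, of sizes `h × 4 D K` (buckets of the vertices
outside `N[u]`) and `4 D K × c` (buckets missed by `N[v]`); a pair passes iff its entry is zero
(`Inst.pass_iff`). The product is cut into blocks of size `b = N ^ k`, the least power of `N` that
is at least `h`. A fixed bilinear algorithm for `N × N` matrices with `r ≤ N ^ (2 + ε)` products, `ε
= 1 - α / 2`, exists since `ω = 2`; its Kronecker power multiplies two blocks with `r ^ k ≤ b ^ (2 +
ε)` products. Its linear maps are applied digit by digit, which is Yates's algorithm (`runs_yates`,
`yIter_eq`, `sum_ker_mul`).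

The cost of a level is about `(D K + b) (c + b) b ^ ε` up to logarithms. Since `c D ≤ M`, `b n =
O(M)` and `b = O(n)`, this is `O(K M n ^ ε)`, and `M = O(n ^ α)` gives `n ^ (α + 1 - α / 2)`
(`Inst.Valid.pairs_le`, `exists_cost`, `le_timeBound`).

The rational coefficients are multiplied by a common denominator, and the arithmetic is modulo `2 ^
w`. This computes `D₀ ^ k` times the product of the matrices, which is polynomial in `n`, so words
of `O(log n)` bits suffice for an exact zero test (`Inst.dvd_prodSum_iff`, `exists_exponent`).

The algorithm is written in a small structured language that is compiled to the machine. `Runs` is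
its Hoare logic with time bounds, and `run_eq` states the outcome: for fixed random words the answer
is whether some level contains a pair that passes. -/

namespace WordRAM

open Function

/-! ## Runs of the machine -/

/-- From the configuration `c` the machine reaches `c'` in exactly `t` steps. -/
def Reach {w : ℕ} (P : Program) (ρ : ℕ → BitVec w) (c : Config w) (t : ℕ) (c' : Config w) : Prop :=
  ∀ f, run P ρ (f + t) c = run P ρ f c'

/-- The list `l` of instructions stands in `P` from position `pos` on. -/
def CodeAt (P : Program) (pos : ℕ) (l : List Instr) : Prop :=
  ∀ i, i < l.length → P[pos + i]? = l[i]?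

/-- Instructions that neither jump nor halt. -/
def Instr.straight : Instr → Bool
  | .jmp _ | .jlt _ _ _ | .jeq _ _ _ | .halt _ => false
  | _ => true

section

variable {w : ℕ} {P : Program} {ρ : ℕ → BitVec w} {c c' c'' : Config w}

theorem Reach.refl (c : Config w) : Reach P ρ c 0 c := fun _ => rfl

theorem Reach.trans {s t : ℕ} (h : Reach P ρ c s c') (h' : Reach P ρ c' t c'') :
    Reach P ρ c (s + t) c'' := fun f => by
  rw [← h' f, ← h (f + t)]; congr 1; ring

theorem Reach.step {i : Instr} (h : P[c.pc]? = some i) (hi : ∀ b, i ≠ .halt b) :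
    Reach P ρ c 1 (exec ρ c i) := fun f => by
  rw [run, h]
  cases i <;> first | rfl | exact absurd rfl (hi _)

/-- Extra fuel does not change an answer, so runs of varying length can all be stated with the same
bound on the number of steps. -/
theorem run_add_of_eq_some (P : Program) (ρ : ℕ → BitVec w) (b : Bool) (s : ℕ) :
    ∀ (t : ℕ) (c : Config w), run P ρ t c = some b → run P ρ (t + s) c = some b
  | 0, c, h => by simp [run] at h
  | t + 1, c, h => by
    rw [show t + 1 + s = (t + s) + 1 by ring]
    rw [run] at h ⊢
    cases hi : P[c.pc]? with
    | none => simp [hi] at h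
    | some i =>
      rw [hi] at h
      cases i <;> first
        | exact h
        | exact run_add_of_eq_some P ρ b s t _ h

theorem CodeAt.append_left {pos : ℕ} {l l' : List Instr} (h : CodeAt P pos (l ++ l')) :
    CodeAt P pos l := fun i hi => by
  rw [h i (by simp; omega), List.getElem?_append_left hi]

theorem CodeAt.append_right {pos : ℕ} {l l' : List Instr} (h : CodeAt P pos (l ++ l')) :
    CodeAt P (pos + l.length) l' := fun i hi => by
  rw [add_assoc, h _ (by simp; omega), List.getElem?_append_right (by omega)]
  congr 1; omega

theorem CodeAt.head {pos : ℕ} {i : Instr} {l : List Instr} (h : CodeAt P pos (i :: l)) :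
    P[pos]? = some i := by
  simpa using h 0 (by simp)

theorem CodeAt.tail {pos : ℕ} {i : Instr} {l : List Instr} (h : CodeAt P pos (i :: l)) :
    CodeAt P (pos + 1) l := (show CodeAt P pos ([i] ++ l) from h).append_right

theorem exec_straight_pc {i : Instr} (hi : i.straight) (c : Config w) :
    (exec ρ c i).pc = c.pc + 1 := by
  cases i <;> first | rfl | cases hi

/-- Jump-free code is executed by folding `exec` over the list, so that its effect can be computed
by `simp`. -/
theorem reach_straight (l : List Instr) (hl : l.all Instr.straight) (pos : ℕ) (c : Config w)
    (hc : CodeAt P pos l) (hpc : c.pc = pos) :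
    Reach P ρ c l.length (l.foldl (exec ρ) c) ∧ (l.foldl (exec ρ) c).pc = pos + l.length := by
  induction l generalizing pos c with
  | nil => exact ⟨Reach.refl c, hpc⟩
  | cons i l ih =>
    rw [List.all_cons, Bool.and_eq_true] at hl
    have hi := hl.1
    obtain ⟨h1, h2⟩ := ih hl.2 (pos + 1) (exec ρ c i) hc.tail
      (by rw [exec_straight_pc hi, hpc])
    refine ⟨?_, by rw [List.foldl_cons, h2, List.length_cons]; ring⟩
    rw [List.length_cons, add_comm, List.foldl_cons]
    refine Reach.trans (Reach.step (by rw [hpc]; exact hc.head) ?_) h1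
    rintro b rfl
    cases hi

end

/-! ## A structured language

Expressions and statements over immutable named variables and arrays of natural numbers. The
values are unbounded; the machine holds them modulo `2 ^ w`. The entry `0` of the array `0` is
the number of random words used so far. -/

/-- The number of arrays, including the virtual array `0`. -/
def numArrays : ℕ := 32

/-- Contents of the arrays. -/
abbrev State := ℕ → ℕ → ℕ

/-- Values of the variables in scope. -/
abbrev Env := ℕ → Option ℕ

inductive Expr where
  | const (k : ℕ)
  | var (x : ℕ)
  | add (a b : Expr)
  | mul (a b : Expr)
  | div (a b : Expr)
  | mod (a b : Expr)
  | read (A : ℕ) (e : Expr)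
  | inp (e : Expr)
  | negOne

/-- Parameters of an execution: arrays have `lim` cells and start at the address `base`, below
which the input `inp` is stored; `ρ` are the random words. -/
structure Machine (w : ℕ) where
  base : ℕ
  lim : ℕ
  inp : ℕ → ℕ
  ρ : ℕ → BitVec w
  fits : base + lim * numArrays ≤ 2 ^ w

/-- Registers for intermediate results. -/
def tmpReg (r : ℕ) : ℕ := 2 * r + 1

/-- Register of a variable. -/
def varReg (x : ℕ) : ℕ := 4 * x + 2

/-- Register of the bound of the loop over a variable. -/
def bndReg (x : ℕ) : ℕ := 4 * x + 4

/-- Turn the index in temporary register `r` into the address of that cell of the array `A`. -/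
def addrCode (A r : ℕ) : List Instr :=
  [.const (tmpReg (r + 1)) numArrays, .op .mul (tmpReg r) (tmpReg r) (tmpReg (r + 1)),
    .const (tmpReg (r + 1)) A, .op .add (tmpReg r) (tmpReg r) (tmpReg (r + 1)),
    .op .add (tmpReg r) 0 (tmpReg r)]

namespace Expr

/-- Evaluate into temporary register `r`, leaving those below it unchanged. -/
def code : Expr → ℕ → List Instr
  | const k, r => [.const (tmpReg r) k]
  | var x, r => [.const (tmpReg r) 0, .op .add (tmpReg r) (varReg x) (tmpReg r)]
  | add a b, r => a.code r ++ b.code (r + 1) ++ [.op .add (tmpReg r) (tmpReg r) (tmpReg (r + 1))]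
  | mul a b, r => a.code r ++ b.code (r + 1) ++ [.op .mul (tmpReg r) (tmpReg r) (tmpReg (r + 1))]
  | div a b, r => a.code r ++ b.code (r + 1) ++ [.op .div (tmpReg r) (tmpReg r) (tmpReg (r + 1))]
  | mod a b, r => a.code r ++ b.code (r + 1) ++ [.op .mod (tmpReg r) (tmpReg r) (tmpReg (r + 1))]
  | read A e, r => e.code r ++ addrCode A r ++ [.load (tmpReg r) (tmpReg r)]
  | inp e, r => e.code r ++ [.load (tmpReg r) (tmpReg r)]
  | negOne, r => [.const (tmpReg r) 0, .const (tmpReg (r + 1)) 1,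
      .op .sub (tmpReg r) (tmpReg r) (tmpReg (r + 1))]

def len : Expr → ℕ
  | const _ => 1
  | var _ => 2
  | add a b | mul a b | div a b | mod a b => a.len + b.len + 1
  | read _ e => e.len + 6
  | inp e => e.len + 1
  | negOne => 3

variable {w : ℕ} (M : Machine w) (env : Env) (σ : State)

def eval : Expr → ℕ
  | const k => k
  | var x => (env x).getD 0
  | add a b => a.eval + b.eval
  | mul a b => a.eval * b.eval
  | div a b => a.eval / b.eval
  | mod a b => a.eval % b.eval
  | read A e => σ A e.eval
  | inp e => M.inp e.eval
  | negOne => 2 ^ w - 1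

/-- The machine computes the value: variables are in scope, array accesses within bounds, and
divisions are applied to words. -/
def ok : Expr → Prop
  | const _ | negOne => True
  | var x => (env x).isSome
  | add a b | mul a b => a.ok ∧ b.ok
  | div a b | mod a b => a.ok ∧ b.ok ∧ a.eval M env σ < 2 ^ w ∧ b.eval M env σ < 2 ^ w
  | read A e => e.ok ∧ 0 < A ∧ A < numArrays ∧ e.eval M env σ < M.lim
  | inp e => e.ok ∧ e.eval M env σ < M.base

end Expr

/-- The configuration `c` represents the variables `env` and the arrays `σ`. -/
structure Machine.Rep {w : ℕ} (M : Machine w) (env : Env) (σ : State) (c : Config w) : Prop where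
  base : c.reg 0 = BitVec.ofNat w M.base
  vars : ∀ x k, env x = some k → c.reg (varReg x) = BitVec.ofNat w k
  inp : ∀ i < M.base, c.mem (BitVec.ofNat w i) = BitVec.ofNat w (M.inp i)
  arr : ∀ A i, 0 < A → A < numArrays → i < M.lim →
    c.mem (BitVec.ofNat w (M.base + (i * numArrays + A))) = BitVec.ofNat w (σ A i)
  used : c.used = σ 0 0

section

variable {w : ℕ} {M : Machine w} {env : Env} {σ : State}

theorem Expr.length_code (e : Expr) : ∀ r, (e.code r).length = e.len := by
  induction e <;> intro r <;> simp [Expr.code, Expr.len, addrCode, *]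
  all_goals ring

theorem Expr.straight_code (e : Expr) : ∀ r, (e.code r).all Instr.straight := by
  induction e <;> intro r <;>
    simp only [Expr.code, addrCode, List.all_append, List.all_cons, List.all_nil, *] <;> rfl

theorem Machine.Rep.congr {c c' : Config w} (h : M.Rep env σ c) (h0 : c'.reg 0 = c.reg 0)
    (hv : ∀ x, c'.reg (varReg x) = c.reg (varReg x)) (hm : c'.mem = c.mem)
    (hu : c'.used = c.used) : M.Rep env σ c' where
  base := h0.trans h.base
  vars x k hx := (hv x).trans (h.vars x k hx)
  inp := hm ▸ h.inp
  arr := hm ▸ h.arr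
  used := hu.trans h.used

/-- The registers written by the code of an expression. -/
def Expr.Keeps (r : ℕ) (c c' : Config w) : Prop :=
  c'.mem = c.mem ∧ c'.used = c.used ∧ ∀ x, (∀ s, r ≤ s → x ≠ tmpReg s) → c'.reg x = c.reg x

theorem Expr.Keeps.rep {r : ℕ} {c c' : Config w} (h : Keeps r c c') (hc : M.Rep env σ c) :
    M.Rep env σ c' :=
  hc.congr (h.2.2 0 (by simp [tmpReg])) (fun x => h.2.2 _ (by intro s _; simp [tmpReg, varReg]; omega))
    h.1 h.2.1

theorem Expr.Keeps.tmp {r s : ℕ} {c c' : Config w} (h : Keeps r c c') (hs : s < r) :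
    c'.reg (tmpReg s) = c.reg (tmpReg s) :=
  h.2.2 _ (by intro u hu; simp only [tmpReg]; omega)

theorem foldl_addrCode {ρ : ℕ → BitVec w} {c : Config w} (hc : c.reg 0 = BitVec.ofNat w M.base)
    (A r i : ℕ) (hi : c.reg (tmpReg r) = BitVec.ofNat w i) :
    Expr.Keeps r c ((addrCode A r).foldl (exec ρ) c) ∧
    ((addrCode A r).foldl (exec ρ) c).reg (tmpReg r) =
      BitVec.ofNat w (M.base + (i * numArrays + A)) := by
  have h1 : tmpReg r ≠ tmpReg (r + 1) := by simp [tmpReg]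
  have h2 : 0 ≠ tmpReg r := by simp [tmpReg]
  have h3 : 0 ≠ tmpReg (r + 1) := by simp [tmpReg]
  refine ⟨⟨rfl, rfl, fun x hx => ?_⟩, ?_⟩
  · simp [addrCode, exec, Config.setReg, update_of_ne (hx r le_rfl),
      update_of_ne (hx (r + 1) (by omega))]
  · simp [addrCode, exec, Config.setReg, Op.eval, h1, h2, h3, hi, hc, BitVec.ofNat_add,
      BitVec.ofNat_mul]

/-- A binary operation keeps its left value in register `r` while the right one is computed from `r
+ 1` on; hence the induction for all `r`. Sums and products commute with reduction modulo `2 ^ w`;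
quotients and remainders do not, and need the bounds in `ok`. -/
theorem Expr.eval_code {ρ : ℕ → BitVec w} (e : Expr) : ∀ (r : ℕ) (c : Config w),
    M.Rep env σ c → e.ok M env σ → Keeps r c ((e.code r).foldl (exec ρ) c) ∧
      ((e.code r).foldl (exec ρ) c).reg (tmpReg r) = BitVec.ofNat w (e.eval M env σ) := by
  have bin : ∀ (f : Op) (a b : Expr) (r : ℕ) (c : Config w) (v : ℕ),
      (∀ (r : ℕ) (c : Config w), M.Rep env σ c → a.ok M env σ →
        Keeps r c ((a.code r).foldl (exec ρ) c) ∧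
        ((a.code r).foldl (exec ρ) c).reg (tmpReg r) = BitVec.ofNat w (a.eval M env σ)) →
      (∀ (r : ℕ) (c : Config w), M.Rep env σ c → b.ok M env σ →
        Keeps r c ((b.code r).foldl (exec ρ) c) ∧
        ((b.code r).foldl (exec ρ) c).reg (tmpReg r) = BitVec.ofNat w (b.eval M env σ)) →
      M.Rep env σ c → a.ok M env σ → b.ok M env σ →
      f.eval (BitVec.ofNat w (a.eval M env σ)) (BitVec.ofNat w (b.eval M env σ)) =
        BitVec.ofNat w v →
      Keeps r c ((a.code r ++ b.code (r + 1) ++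
        [Instr.op f (tmpReg r) (tmpReg r) (tmpReg (r + 1))]).foldl (exec ρ) c) ∧
      ((a.code r ++ b.code (r + 1) ++
        [Instr.op f (tmpReg r) (tmpReg r) (tmpReg (r + 1))]).foldl (exec ρ) c).reg (tmpReg r) =
          BitVec.ofNat w v := by
    intro f a b r c v iha ihb hc ha hb hf
    obtain ⟨k1, e1⟩ := iha r c hc ha
    obtain ⟨k2, e2⟩ := ihb (r + 1) _ (k1.rep hc) hb
    rw [← k2.tmp (Nat.lt_succ_self r)] at e1
    rw [List.foldl_append, List.foldl_append]
    refine ⟨⟨k2.1.trans k1.1, k2.2.1.trans k1.2.1, fun x hx => ?_⟩, ?_⟩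
    · simp only [List.foldl_cons, List.foldl_nil, exec, Config.setReg]
      rw [update_of_ne (hx r le_rfl), k2.2.2 x (fun s hs => hx s (by omega)), k1.2.2 x hx]
    · simp only [List.foldl_cons, List.foldl_nil, exec, Config.setReg, update_self]
      rw [e1, e2, hf]
  induction e with
  | const k =>
    intro r c _ _
    refine ⟨⟨rfl, rfl, fun x hx => ?_⟩, ?_⟩
    · simp [code, exec, Config.setReg, update_of_ne (hx r le_rfl)]
    · simp [code, exec, Config.setReg, eval]
  | var y =>
    intro r c hc hy
    obtain ⟨k, hk⟩ := Option.isSome_iff_exists.1 hy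
    have h1 : varReg y ≠ tmpReg r := by simp [tmpReg, varReg]; omega
    refine ⟨⟨rfl, rfl, fun x hx => ?_⟩, ?_⟩
    · simp [code, exec, Config.setReg, update_of_ne (hx r le_rfl)]
    · simp [code, exec, Config.setReg, eval, Op.eval, h1, hc.vars y k hk, hk]
  | add a b iha ihb =>
    exact fun r c hc h => bin .add a b r c _ iha ihb hc h.1 h.2 (BitVec.ofNat_add _ _).symm
  | mul a b iha ihb =>
    exact fun r c hc h => bin .mul a b r c _ iha ihb hc h.1 h.2 (BitVec.ofNat_mul _ _).symm
  | div a b iha ihb =>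
    refine fun r c hc h => bin .div a b r c _ iha ihb hc h.1 h.2.1 ?_
    apply BitVec.eq_of_toNat_eq
    simp only [Op.eval, BitVec.toNat_udiv, BitVec.toNat_ofNat, Nat.mod_eq_of_lt h.2.2.1,
      Nat.mod_eq_of_lt h.2.2.2, eval]
    rw [Nat.mod_eq_of_lt ((Nat.div_le_self _ _).trans_lt h.2.2.1)]
  | mod a b iha ihb =>
    refine fun r c hc h => bin .mod a b r c _ iha ihb hc h.1 h.2.1 ?_
    apply BitVec.eq_of_toNat_eq
    simp only [Op.eval, BitVec.toNat_umod, BitVec.toNat_ofNat, Nat.mod_eq_of_lt h.2.2.1,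
      Nat.mod_eq_of_lt h.2.2.2, eval]
    rw [Nat.mod_eq_of_lt ((Nat.mod_le _ _).trans_lt h.2.2.1)]
  | read A e ih =>
    intro r c hc h
    obtain ⟨k1, e1⟩ := ih r c hc h.1
    obtain ⟨k2, e2⟩ := foldl_addrCode (ρ := ρ) (k1.rep hc).base A r _ e1
    have := ((k2.rep (k1.rep hc)).arr A _ h.2.1 h.2.2.1 h.2.2.2)
    rw [code, List.foldl_append, List.foldl_append]
    refine ⟨⟨k2.1.trans k1.1, k2.2.1.trans k1.2.1, fun x hx => ?_⟩, ?_⟩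
    · simp only [List.foldl_cons, List.foldl_nil, exec, Config.setReg]
      rw [update_of_ne (hx r le_rfl), k2.2.2 x hx, k1.2.2 x hx]
    · simp only [List.foldl_cons, List.foldl_nil, exec, Config.setReg, update_self]
      rw [e2, this, eval]
  | inp e ih =>
    intro r c hc h
    obtain ⟨k1, e1⟩ := ih r c hc h.1
    rw [code, List.foldl_append]
    refine ⟨⟨k1.1, k1.2.1, fun x hx => ?_⟩, ?_⟩
    · simp only [List.foldl_cons, List.foldl_nil, exec, Config.setReg]
      rw [update_of_ne (hx r le_rfl), k1.2.2 x hx]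
    · simp only [List.foldl_cons, List.foldl_nil, exec, Config.setReg, update_self]
      rw [e1, (k1.rep hc).inp _ h.2, eval]
  | negOne =>
    intro r c _ _
    have h1 : tmpReg r ≠ tmpReg (r + 1) := by simp [tmpReg]
    refine ⟨⟨rfl, rfl, fun x hx => ?_⟩, ?_⟩
    · simp [code, exec, Config.setReg, update_of_ne (hx r le_rfl),
        update_of_ne (hx (r + 1) (by omega))]
    · simp only [code, List.foldl_cons, List.foldl_nil, exec, Config.setReg, update_self, Op.eval,
        eval, update_of_ne h1]
      apply BitVec.eq_of_toNat_eq
      have := Nat.one_le_two_pow (n := w)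
      rw [BitVec.toNat_sub]
      simp only [BitVec.toNat_ofNat, Nat.zero_mod]
      -- With words of `0` bits the constant `1` wraps around to `0`.
      rcases Nat.eq_zero_or_pos w with rfl | hw
      · simp
      · rw [Nat.mod_eq_of_lt (Nat.one_lt_two_pow hw.ne'), add_zero]

/-- Evaluation of an expression, as a run of the machine. -/
theorem Expr.reach_code {P : Program} {ρ : ℕ → BitVec w} (e : Expr) (r pos : ℕ) {c : Config w}
    (hP : CodeAt P pos (e.code r)) (hpc : c.pc = pos) (hc : M.Rep env σ c) (he : e.ok M env σ) :
    ∃ c', Reach P ρ c e.len c' ∧ c'.pc = pos + e.len ∧ Keeps r c c' ∧ M.Rep env σ c' ∧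
      c'.reg (tmpReg r) = BitVec.ofNat w (e.eval M env σ) := by
  obtain ⟨h1, h2⟩ := reach_straight (ρ := ρ) _ (e.straight_code r) pos c hP hpc
  obtain ⟨h3, h4⟩ := e.eval_code (ρ := ρ) r c hc he
  rw [e.length_code] at h1 h2
  exact ⟨_, h1, h2, h3, h3.rep hc, h4⟩

end

end WordRAM

/-! ### Statements, their code, and a logic of runs with time bounds -/

namespace WordRAM

open Function

/-- Only `bind` and `loop` set variables, and the bound of a loop is evaluated once, on entry. All
other data live in arrays. Time bounds can therefore be read off the syntax and the values of the
loop bounds. -/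
inductive Stmt where
  | skip
  | write (A : ℕ) (i e : Expr)
  | rand (A : ℕ) (i : Expr)
  | seq (s t : Stmt)
  | bind (x : ℕ) (e : Expr) (s : Stmt)
  | loop (x : ℕ) (e : Expr) (s : Stmt)
  | ifLt (a b : Expr) (s : Stmt)
  | ifZero (a : Expr) (s : Stmt)

namespace Stmt

/-- Length of the code. -/
def len : Stmt → ℕ
  | skip => 0
  | write _ i e => i.len + e.len + 6
  | rand _ i => i.len + 7
  | seq s t => s.len + t.len
  | bind _ e s => e.len + 2 + s.len
  | loop _ e s => e.len + 8 + s.len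
  | ifLt a b s => a.len + b.len + 2 + s.len
  | ifZero a s => a.len + 3 + s.len

/-- The code of a statement that is placed at position `p`. -/
def code : Stmt → ℕ → List Instr
  | skip, _ => []
  | write A i e, _ => i.code 0 ++ addrCode A 0 ++ e.code 1 ++ [.store (tmpReg 0) (tmpReg 1)]
  | rand A i, _ => i.code 0 ++ addrCode A 0 ++ [.rand (tmpReg 1), .store (tmpReg 0) (tmpReg 1)]
  | seq s t, p => s.code p ++ t.code (p + s.len)
  | bind x e s, p => e.code 0 ++
      [.const (tmpReg 1) 0, .op .add (varReg x) (tmpReg 0) (tmpReg 1)] ++ s.code (p + e.len + 2)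
  | loop x e s, p => e.code 0 ++
      ([.const (tmpReg 1) 0, .op .add (bndReg x) (tmpReg 0) (tmpReg 1), .const (varReg x) 0] ++
      ([.jlt (varReg x) (bndReg x) (p + e.len + 5), .jmp (p + e.len + 8 + s.len)] ++
      (s.code (p + e.len + 5) ++
      [.const (tmpReg 0) 1, .op .add (varReg x) (varReg x) (tmpReg 0), .jmp (p + e.len + 3)])))
  | ifLt a b s, p => a.code 0 ++ (b.code 1 ++
      ([.jlt (tmpReg 0) (tmpReg 1) (p + a.len + b.len + 2), .jmp (p + a.len + b.len + 2 + s.len)] ++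
      s.code (p + a.len + b.len + 2)))
  | ifZero a s, p => a.code 0 ++ ([.const (tmpReg 1) 0,
      .jeq (tmpReg 0) (tmpReg 1) (p + a.len + 3), .jmp (p + a.len + 3 + s.len)] ++
      s.code (p + a.len + 3))

theorem length_code (s : Stmt) : ∀ p, (s.code p).length = s.len := by
  induction s <;> intro p <;> simp [code, len, Expr.length_code, addrCode, *] <;> ring

end Stmt

/-- Started with the variables `env` and the arrays `σ`, the statement `s` takes at most `t` steps
and leaves arrays that satisfy `Q`. -/
def Runs {w : ℕ} (M : Machine w) (s : Stmt) (env : Env) (σ : State) (t : ℕ) (Q : State → Prop) :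
    Prop :=
  ∀ (P : Program) (pos : ℕ) (c : Config w), CodeAt P pos (s.code pos) → c.pc = pos →
    M.Rep env σ c → ∃ (c' : Config w) (t' : ℕ) (σ' : State), t' ≤ t ∧ Reach P M.ρ c t' c' ∧
      c'.pc = pos + s.len ∧ M.Rep env σ' c' ∧
      (∀ x, env x ≠ none → c'.reg (bndReg x) = c.reg (bndReg x)) ∧ Q σ'

/-- Replace the contents of the array `A`. -/
def State.set (σ : State) (A : ℕ) (f : ℕ → ℕ) : State := update σ A f

/-- Bind a variable. -/
def Env.bind (env : Env) (x k : ℕ) : Env := update env x (some k)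

@[simp] theorem State.set_self (σ : State) (A : ℕ) (f : ℕ → ℕ) : σ.set A f A = f :=
  update_self _ _ _

@[simp] theorem State.set_of_ne (σ : State) {A B : ℕ} (f : ℕ → ℕ) (h : B ≠ A) :
    σ.set A f B = σ B := update_of_ne h _ _

@[simp] theorem Env.bind_self (env : Env) (x k : ℕ) : env.bind x k x = some k :=
  update_self _ _ _

@[simp] theorem Env.bind_of_ne (env : Env) {x y : ℕ} (k : ℕ) (h : y ≠ x) :
    env.bind x k y = env y := update_of_ne h _ _

section

variable {w : ℕ} {M : Machine w} {env : Env} {σ : State} {t t' : ℕ} {Q R : State → Prop}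

theorem Expr.Keeps.bnd {r : ℕ} {c c' : Config w} (h : Keeps r c c') (x : ℕ) :
    c'.reg (bndReg x) = c.reg (bndReg x) :=
  h.2.2 _ (by intro s _; simp [tmpReg, bndReg]; omega)

theorem Runs.mono {s : Stmt} (h : Runs M s env σ t Q) (ht : t ≤ t') (hQ : ∀ σ', Q σ' → R σ') :
    Runs M s env σ t' R := fun P pos c h1 h2 h3 => by
  obtain ⟨c', u, σ', a, b, d, e, f, g⟩ := h P pos c h1 h2 h3
  exact ⟨c', u, σ', a.trans ht, b, d, e, f, hQ _ g⟩

theorem Runs.skip (h : Q σ) : Runs M .skip env σ 0 Q := fun _ _ c _ h2 h3 =>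
  ⟨c, 0, σ, le_rfl, Reach.refl c, h2, h3, fun _ _ => rfl, h⟩

theorem Runs.seq {s s' : Stmt} (h : Runs M s env σ t Q)
    (h' : ∀ σ', Q σ' → Runs M s' env σ' t' R) : Runs M (.seq s s') env σ (t + t') R :=
  fun P pos c h1 h2 h3 => by
    obtain ⟨c', u, σ', a, b, d, e, f, g⟩ := h P pos c h1.append_left h2 h3
    have h4 := h1.append_right
    rw [Stmt.length_code] at h4
    obtain ⟨c'', u', σ'', a', b', d', e', f', g'⟩ := h' σ' g P _ c' h4 d e
    exact ⟨c'', u + u', σ'', add_le_add a a', b.trans b', by rw [d', Stmt.len]; ring, e',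
      fun x hx => (f' x hx).trans (f x hx), g'⟩

theorem addr_lt {A i : ℕ} (hA : A < numArrays) (hi : i < M.lim) :
    M.base + (i * numArrays + A) < 2 ^ w := by
  refine lt_of_lt_of_le ?_ M.fits
  have : (i + 1) * numArrays ≤ M.lim * numArrays := Nat.mul_le_mul_right _ hi
  linarith

/-- The arrays are interleaved: an address determines the array as a remainder modulo `numArrays`
and the index as a quotient, and `fits` excludes wrapping around. -/
theorem addr_inj {A B i j : ℕ} (hA : A < numArrays) (hi : i < M.lim) (hB : B < numArrays)
    (hj : j < M.lim) (h : BitVec.ofNat w (M.base + (i * numArrays + A)) =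
      BitVec.ofNat w (M.base + (j * numArrays + B))) : A = B ∧ i = j := by
  have h' := congrArg BitVec.toNat h
  rw [BitVec.toNat_ofNat, BitVec.toNat_ofNat, Nat.mod_eq_of_lt (addr_lt hA hi),
    Nat.mod_eq_of_lt (addr_lt hB hj)] at h'
  simp only [numArrays] at *
  omega

/-- Storing a value into a cell of an array. -/
theorem Machine.Rep.store {c c' : Config w} (hc : M.Rep env σ c) {A i v : ℕ} (h0 : 0 < A)
    (hA : A < numArrays) (hi : i < M.lim) (hr : c'.reg 0 = c.reg 0)
    (hv : ∀ x, c'.reg (varReg x) = c.reg (varReg x)) (hu : c'.used = c.used)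
    (hm : c'.mem = update c.mem (BitVec.ofNat w (M.base + (i * numArrays + A)))
      (BitVec.ofNat w v)) :
    M.Rep env (State.set σ A (update (σ A) i v)) c' where
  base := hr.trans hc.base
  vars x k hx := (hv x).trans (hc.vars x k hx)
  inp j hj := by
    rw [hm, update_of_ne, hc.inp j hj]
    intro h
    have h' := congrArg BitVec.toNat h
    have := addr_lt hA hi
    rw [BitVec.toNat_ofNat, BitVec.toNat_ofNat, Nat.mod_eq_of_lt this,
      Nat.mod_eq_of_lt (by omega)] at h'
    omega
  arr B j hB0 hB hj := by
    rw [hm]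
    by_cases h : A = B ∧ i = j
    · obtain ⟨rfl, rfl⟩ := h
      simp
    · rw [update_of_ne (fun h' => h ((addr_inj hB hj hA hi h').imp Eq.symm Eq.symm)),
        hc.arr B j hB0 hB hj]
      by_cases hAB : A = B
      · subst hAB
        rw [State.set_self, update_of_ne (by rintro rfl; exact h ⟨rfl, rfl⟩)]
      · rw [State.set_of_ne _ _ (Ne.symm hAB)]
  used := by rw [hu, hc.used, State.set_of_ne _ _ h0.ne]

theorem Runs.write {A : ℕ} {i e : Expr} (hA : 0 < A ∧ A < numArrays) (hi : i.ok M env σ)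
    (he : e.ok M env σ) (hl : i.eval M env σ < M.lim)
    (h : Q (State.set σ A (update (σ A) (i.eval M env σ) (e.eval M env σ)))) :
    Runs M (.write A i e) env σ (i.len + e.len + 6) Q := fun P pos c h1 h2 h3 => by
  rw [Stmt.code] at h1
  obtain ⟨h4, h5⟩ := reach_straight (ρ := M.ρ) _ (by
    simp only [List.all_append, Expr.straight_code]; rfl) pos c h1 h2
  have hlen : (Expr.code i 0 ++ addrCode A 0 ++ e.code 1 ++
      [Instr.store (tmpReg 0) (tmpReg 1)]).length = i.len + e.len + 6 := by
    simp [Expr.length_code, addrCode]; ring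
  rw [hlen] at h4 h5
  refine ⟨_, _, _, le_rfl, h4, h5, ?_, ?_, h⟩
  all_goals
    obtain ⟨k1, e1⟩ := i.eval_code (ρ := M.ρ) 0 c h3 hi
    obtain ⟨k2, e2⟩ := foldl_addrCode (ρ := M.ρ) (k1.rep h3).base A 0 _ e1
    obtain ⟨k3, e3⟩ := e.eval_code (ρ := M.ρ) 1 _ (k2.rep (k1.rep h3)) he
    rw [← k3.tmp one_pos] at e2
    rw [List.foldl_append, List.foldl_append, List.foldl_append]
  · refine (k3.rep (k2.rep (k1.rep h3))).store hA.1 hA.2 hl ?_ ?_ ?_ ?_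
    · rfl
    · intro x; rfl
    · rfl
    · simp only [List.foldl_cons, List.foldl_nil, exec, e2, e3]
  · intro x _
    exact (k3.bnd x).trans ((k2.bnd x).trans (k1.bnd x))

theorem Runs.rand {A : ℕ} {i : Expr} (hA : 0 < A ∧ A < numArrays) (hi : i.ok M env σ)
    (hl : i.eval M env σ < M.lim)
    (h : Q (State.set (State.set σ A (update (σ A) (i.eval M env σ) (M.ρ (σ 0 0)).toNat)) 0
      (update (σ 0) 0 (σ 0 0 + 1)))) :
    Runs M (.rand A i) env σ (i.len + 7) Q := fun P pos c h1 h2 h3 => by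
  rw [Stmt.code] at h1
  obtain ⟨h4, h5⟩ := reach_straight (ρ := M.ρ) _ (by
    simp only [List.all_append, Expr.straight_code]; rfl) pos c h1 h2
  have hlen : (Expr.code i 0 ++ addrCode A 0 ++
      [Instr.rand (tmpReg 1), Instr.store (tmpReg 0) (tmpReg 1)]).length = i.len + 7 := by
    simp [Expr.length_code, addrCode]
  rw [hlen] at h4 h5
  refine ⟨_, _, _, le_rfl, h4, h5, ?_, ?_, h⟩
  all_goals
    obtain ⟨k1, e1⟩ := i.eval_code (ρ := M.ρ) 0 c h3 hi
    obtain ⟨k2, e2⟩ := foldl_addrCode (ρ := M.ρ) (k1.rep h3).base A 0 _ e1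
    have h0 := k2.rep (k1.rep h3)
    rw [List.foldl_append, List.foldl_append]
    generalize (List.foldl (exec M.ρ) (List.foldl (exec M.ρ) c (i.code 0)) (addrCode A 0)) = d
      at *
    -- The rule for stores is applied with the old counter of random words; the increment, which is
    -- a change of the virtual array `0`, is added afterwards.
    have hd : M.Rep env (State.set σ A (update (σ A) (i.eval M env σ) (M.ρ (σ 0 0)).toNat))
        { exec M.ρ (exec M.ρ d (.rand (tmpReg 1))) (.store (tmpReg 0) (tmpReg 1)) with
          used := d.used } := by
      refine h0.store hA.1 hA.2 hl ?_ ?_ ?_ ?_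
      · simp [exec, Config.setReg, tmpReg]
      · intro x
        have : varReg x ≠ tmpReg 1 := by simp only [tmpReg, varReg]; omega
        simp [exec, Config.setReg, this]
      · rfl
      · have : tmpReg 0 ≠ tmpReg 1 := by simp [tmpReg]
        simp [exec, Config.setReg, e2, this, h0.used]
  · refine ⟨hd.base, hd.vars, hd.inp, fun B j hB0 hB hj => ?_, ?_⟩
    · rw [State.set_of_ne _ _ hB0.ne']
      exact hd.arr B j hB0 hB hj
    · simp [exec, Config.setReg, h0.used]
  · intro x _
    have : bndReg x ≠ tmpReg 1 := by simp only [tmpReg, bndReg]; omega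
    simp only [List.foldl_cons, List.foldl_nil, exec, Config.setReg, update_of_ne this]
    exact ((k2.bnd x).trans (k1.bnd x))

theorem Machine.Rep.bindVar {c c' : Config w} (hc : M.Rep env σ c) {x k : ℕ}
    (h0 : c'.reg 0 = c.reg 0)
    (hv : ∀ y, y ≠ x → c'.reg (varReg y) = c.reg (varReg y))
    (hx : c'.reg (varReg x) = BitVec.ofNat w k)
    (hm : c'.mem = c.mem) (hu : c'.used = c.used) : M.Rep (env.bind x k) σ c' where
  base := h0.trans hc.base
  vars y l hy := by
    by_cases h : y = x
    · subst h
      rw [Env.bind_self] at hy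
      cases hy
      exact hx
    · rw [Env.bind_of_ne _ _ h] at hy
      exact (hv y h).trans (hc.vars y l hy)
  inp := hm ▸ hc.inp
  arr := hm ▸ hc.arr
  used := hu.trans hc.used

theorem Machine.Rep.unbind {c : Config w} {x k : ℕ} (hx : env x = none)
    (h : M.Rep (env.bind x k) σ c) : M.Rep env σ c where
  base := h.base
  vars y l hy := h.vars y l (by
    rw [Env.bind_of_ne]
    · exact hy
    · rintro rfl; simp [hx] at hy)
  inp := h.inp
  arr := h.arr
  used := h.used

theorem varReg_inj {x y : ℕ} (h : y ≠ x) : varReg y ≠ varReg x := by simp only [varReg]; omega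

/-- Freshness of `x` allows the binding to be forgotten afterwards: no variable of the outer scope
lives in its register. -/
theorem Runs.bind {x : ℕ} {e : Expr} {s : Stmt} (hx : env x = none) (he : e.ok M env σ)
    (h : Runs M s (env.bind x (e.eval M env σ)) σ t Q) :
    Runs M (.bind x e s) env σ (e.len + 2 + t) Q := fun P pos c h1 h2 h3 => by
  rw [Stmt.code] at h1
  have hs := h1.append_right
  obtain ⟨h4, h5⟩ := reach_straight (ρ := M.ρ) _ (by
    simp only [List.all_append, Expr.straight_code]; rfl) pos c h1.append_left h2
  have hlen : (Expr.code e 0 ++ [Instr.const (tmpReg 1) 0,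
      Instr.op .add (varReg x) (tmpReg 0) (tmpReg 1)]).length = e.len + 2 := by
    simp [Expr.length_code]
  rw [hlen] at h4 h5 hs
  rw [← add_assoc] at hs
  obtain ⟨k1, e1⟩ := e.eval_code (ρ := M.ρ) 0 c h3 he
  rw [List.foldl_append] at h4 h5
  generalize (List.foldl (exec M.ρ) c (e.code 0)) = d at *
  have hb : ∀ y, bndReg y ≠ varReg x := fun y => by simp only [bndReg, varReg]; omega
  have hb' : ∀ y, bndReg y ≠ tmpReg 1 := fun y => by simp only [bndReg, tmpReg]; omega
  have hv' : ∀ y, varReg y ≠ tmpReg 1 := fun y => by simp only [varReg, tmpReg]; omega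
  rw [← add_assoc] at h5
  have t01 : tmpReg 0 ≠ tmpReg 1 := by simp [tmpReg]
  have hrep : M.Rep (env.bind x (e.eval M env σ)) σ (List.foldl (exec M.ρ) d
      [.const (tmpReg 1) 0, .op .add (varReg x) (tmpReg 0) (tmpReg 1)]) := by
    refine (k1.rep h3).bindVar ?_ (fun y hy => ?_) ?_ rfl rfl
    · simp [exec, Config.setReg, tmpReg, varReg]
    · simp [exec, Config.setReg, varReg_inj hy, hv' y]
    · simp [exec, Config.setReg, Op.eval, e1, t01]
  obtain ⟨c', u, σ', a, b, d', e', f, g⟩ := h P _ _ hs h5 hrep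
  refine ⟨c', _, σ', ?_, h4.trans b, by rw [d', Stmt.len]; ring, e'.unbind hx, fun y hy => ?_, g⟩
  · omega
  · rw [f y (by rw [Env.bind_of_ne]; exacts [hy, by rintro rfl; exact hy hx])]
    simp only [List.foldl_cons, List.foldl_nil, exec, Config.setReg, update_of_ne (hb y),
      update_of_ne (hb' y)]
    exact k1.bnd y

theorem exec_jlt {a b l : ℕ} {ρ : ℕ → BitVec w} {c : Config w} {x y : ℕ}
    (ha : c.reg a = BitVec.ofNat w x) (hb : c.reg b = BitVec.ofNat w y) (hx : x < 2 ^ w)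
    (hy : y < 2 ^ w) : exec ρ c (.jlt a b l) = c.goto (if x < y then l else c.pc + 1) := by
  rw [exec, ha, hb, BitVec.toNat_ofNat, BitVec.toNat_ofNat, Nat.mod_eq_of_lt hx,
    Nat.mod_eq_of_lt hy]

theorem Machine.Rep.goto {c : Config w} (h : M.Rep env σ c) (l : ℕ) : M.Rep env σ (c.goto l) :=
  ⟨h.base, h.vars, h.inp, h.arr, h.used⟩

theorem Runs.ifLt {a b : Expr} {s : Stmt} (ha : a.ok M env σ) (hb : b.ok M env σ)
    (ha' : a.eval M env σ < 2 ^ w) (hb' : b.eval M env σ < 2 ^ w)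
    (h : a.eval M env σ < b.eval M env σ → Runs M s env σ t Q)
    (h' : ¬ a.eval M env σ < b.eval M env σ → Q σ) :
    Runs M (.ifLt a b s) env σ (a.len + b.len + 2 + t) Q := fun P pos c h1 h2 h3 => by
  rw [Stmt.code] at h1
  obtain ⟨c1, r1, p1, k1, q1, e1⟩ := a.reach_code 0 pos (ρ := M.ρ) h1.append_left h2 h3 ha
  have h4 := h1.append_right
  rw [Expr.length_code] at h4
  obtain ⟨c2, r2, p2, k2, q2, e2⟩ := b.reach_code 1 _ (ρ := M.ρ) h4.append_left p1 q1 hb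
  have h5 := h4.append_right
  rw [Expr.length_code] at h5
  have h6 := h5.append_right
  rw [← k2.tmp one_pos] at e1
  have hbnd : ∀ y, c2.reg (bndReg y) = c.reg (bndReg y) := fun y => (k2.bnd y).trans (k1.bnd y)
  have r3 : Reach P M.ρ c2 1 _ := Reach.step (by rw [p2]; exact h5.append_left.head) (by simp)
  rw [exec_jlt e1 e2 ha' hb'] at r3
  by_cases hlt : a.eval M env σ < b.eval M env σ
  · rw [if_pos hlt] at r3
    obtain ⟨c', u, σ', a', b', d', e', f, g⟩ := h hlt P (pos + a.len + b.len + 2) _ h6 rfl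
      (q2.goto (pos + a.len + b.len + 2))
    refine ⟨c', _, σ', ?_, ((r1.trans r2).trans r3).trans b', by rw [d', Stmt.len]; ring, e',
      fun x hx => (f x hx).trans (hbnd x), g⟩
    omega
  · rw [if_neg hlt] at r3
    have r4 : Reach P M.ρ (c2.goto (c2.pc + 1)) 1 _ := Reach.step (by
      have := h5.append_left.tail.head
      rw [Config.goto, p2]; exact this) (by simp)
    refine ⟨_, _, σ, ?_, ((r1.trans r2).trans r3).trans r4, ?_, (q2.goto _).goto _,
      fun x _ => hbnd x, h' hlt⟩
    · omega
    · simp only [exec, Config.goto, Stmt.len]; ring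

/-- Values are unbounded in the language but the machine sees residues, so a test for zero is a test
for divisibility by `2 ^ w`. -/
theorem Runs.ifZero {a : Expr} {s : Stmt} (ha : a.ok M env σ)
    (h : 2 ^ w ∣ a.eval M env σ → Runs M s env σ t Q)
    (h' : ¬ 2 ^ w ∣ a.eval M env σ → Q σ) :
    Runs M (.ifZero a s) env σ (a.len + 3 + t) Q := fun P pos c h1 h2 h3 => by
  rw [Stmt.code] at h1
  obtain ⟨c1, r1, p1, k1, q1, e1⟩ := a.reach_code 0 pos (ρ := M.ρ) h1.append_left h2 h3 ha
  have h4 := h1.append_right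
  rw [Expr.length_code] at h4
  have h6 := h4.append_right
  have r2 : Reach P M.ρ c1 1 _ := Reach.step (by rw [p1]; exact h4.append_left.head) (by simp)
  have hv' : ∀ y, varReg y ≠ tmpReg 1 := fun y => by simp only [varReg, tmpReg]; omega
  have hb' : ∀ y, bndReg y ≠ tmpReg 1 := fun y => by simp only [bndReg, tmpReg]; omega
  have q2 : M.Rep env σ (exec M.ρ c1 (.const (tmpReg 1) 0)) := q1.congr
    (by simp [exec, Config.setReg, tmpReg]) (fun x => by simp [exec, Config.setReg, hv' x]) rfl rfl
  have hbnd : ∀ y, (exec M.ρ c1 (.const (tmpReg 1) 0)).reg (bndReg y) = c.reg (bndReg y) :=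
    fun y => by simpa [exec, Config.setReg, hb' y] using k1.bnd y
  have p2 : (exec M.ρ c1 (.const (tmpReg 1) 0)).pc = pos + a.len + 1 := by rw [← p1]; rfl
  have r3 : Reach P M.ρ (exec M.ρ c1 (.const (tmpReg 1) 0)) 1 _ :=
    Reach.step (by rw [p2]; exact h4.append_left.tail.head) (by simp)
  have t1 : (exec M.ρ c1 (.const (tmpReg 1) 0)).reg (tmpReg 1) = BitVec.ofNat w 0 := by
    simp [exec, Config.setReg]
  have t0 : (exec M.ρ c1 (.const (tmpReg 1) 0)).reg (tmpReg 0) =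
      BitVec.ofNat w (a.eval M env σ) := by
    have : tmpReg 0 ≠ tmpReg 1 := by simp [tmpReg]
    simpa [exec, Config.setReg, this] using e1
  have hiff : BitVec.ofNat w (a.eval M env σ) = BitVec.ofNat w 0 ↔ 2 ^ w ∣ a.eval M env σ := by
    rw [← BitVec.toNat_inj, BitVec.toNat_ofNat, BitVec.toNat_ofNat, Nat.zero_mod,
      Nat.dvd_iff_mod_eq_zero]
  generalize exec M.ρ c1 (.const (tmpReg 1) 0) = c2 at *
  rw [exec, t0, t1] at r3
  by_cases hz : 2 ^ w ∣ a.eval M env σ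
  · rw [if_pos (hiff.2 hz)] at r3
    obtain ⟨c', u, σ', a', b', d', e', f, g⟩ := h hz P (pos + a.len + 3) _
      (by simpa using h6) rfl (q2.goto (pos + a.len + 3))
    refine ⟨c', _, σ', ?_, ((r1.trans r2).trans r3).trans b', by rw [d', Stmt.len]; ring, e',
      fun x hx => (f x hx).trans (hbnd x), g⟩
    omega
  · rw [if_neg (fun hh => hz (hiff.1 hh))] at r3
    have r4 : Reach P M.ρ (c2.goto (c2.pc + 1)) 1 _ := Reach.step (by
      have := h4.append_left.tail.tail.head
      rw [Config.goto, p2]; exact this) (by simp)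
    refine ⟨_, _, σ, ?_, ((r1.trans r2).trans r3).trans r4, ?_, (q2.goto _).goto _,
      fun x _ => hbnd x, h' hz⟩
    · omega
    · simp only [exec, Config.goto, Stmt.len]; ring

/-- The invariant is carried along the configurations at the loop head. A round costs `4` steps
besides the body: comparison, two for the increment, jump back. The `5` are three steps of
initialisation and two for leaving. The body keeps the bound register since `x` is in its scope. -/
theorem Runs.loop {x : ℕ} {e : Expr} {s : Stmt} (I : ℕ → State → Prop) (hx : env x = none)
    (he : e.ok M env σ) (hN : e.eval M env σ < 2 ^ w) (h0 : I 0 σ)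
    (h : ∀ k < e.eval M env σ, ∀ σ', I k σ' → Runs M s (env.bind x k) σ' t (I (k + 1))) :
    Runs M (.loop x e s) env σ (e.eval M env σ * (t + 4) + (e.len + 5))
      (I (e.eval M env σ)) := fun P pos c h1 h2 h3 => by
  rw [Stmt.code] at h1
  generalize hNe : e.eval M env σ = N at *
  obtain ⟨c1, r1, p1, k1, q1, e1⟩ := e.reach_code 0 pos (ρ := M.ρ) h1.append_left h2 h3 he
  rw [hNe] at e1
  have h4 := h1.append_right
  rw [Expr.length_code] at h4
  obtain ⟨r2, p2⟩ := reach_straight (ρ := M.ρ) _ rfl _ c1 h4.append_left p1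
  have h5 := h4.append_right
  have h6 := h5.append_right
  have h7 := h6.append_right
  rw [Stmt.length_code] at h7
  simp only [List.length_cons, List.length_nil] at r2 p2 h5 h6 h7
  have hv' : ∀ y r, varReg y ≠ tmpReg r := fun y r => by simp only [varReg, tmpReg]; omega
  have hb' : ∀ y r, bndReg y ≠ tmpReg r := fun y r => by simp only [bndReg, tmpReg]; omega
  have hvb : ∀ y z, varReg y ≠ bndReg z := fun y z => by simp only [bndReg, varReg]; omega
  have hbb : ∀ y, y ≠ x → bndReg y ≠ bndReg x := fun y hy => by simp only [bndReg]; omega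
  have t01 : tmpReg 0 ≠ tmpReg 1 := by simp [tmpReg]
  have hb2 : (List.foldl (exec M.ρ) c1 [.const (tmpReg 1) 0,
      .op .add (bndReg x) (tmpReg 0) (tmpReg 1), .const (varReg x) 0]).reg (bndReg x) =
      BitVec.ofNat w N := by
    simp [exec, Config.setReg, Op.eval, e1, t01, (hvb x x).symm]
  have q2 : M.Rep (env.bind x 0) σ (List.foldl (exec M.ρ) c1 [.const (tmpReg 1) 0,
      .op .add (bndReg x) (tmpReg 0) (tmpReg 1), .const (varReg x) 0]) := by
    refine q1.bindVar ?_ (fun y hy => ?_) ?_ rfl rfl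
    · simp [exec, Config.setReg, tmpReg, varReg, bndReg]
    · simp [exec, Config.setReg, hv', hvb, varReg_inj hy]
    · simp [exec, Config.setReg]
  have hbnd : ∀ y, y ≠ x → (List.foldl (exec M.ρ) c1 [.const (tmpReg 1) 0,
      .op .add (bndReg x) (tmpReg 0) (tmpReg 1), .const (varReg x) 0]).reg (bndReg y) =
      c.reg (bndReg y) := fun y hy => by
    simpa [exec, Config.setReg, hb', (hvb _ _).symm, hbb y hy] using k1.bnd y
  generalize List.foldl (exec M.ρ) c1 _ = c2 at *
  -- the configurations at the head of the loop
  have key : ∀ k ≤ N, ∃ (d : Config w) (u : ℕ) (σ' : State), u ≤ k * (t + 4) ∧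
      Reach P M.ρ c2 u d ∧ d.pc = pos + e.len + 3 ∧ M.Rep (env.bind x k) σ' d ∧
      d.reg (bndReg x) = BitVec.ofNat w N ∧
      (∀ y, y ≠ x → env y ≠ none → d.reg (bndReg y) = c.reg (bndReg y)) ∧ I k σ' := by
    intro k hk
    induction k with
    | zero =>
      exact ⟨c2, 0, σ, by simp, Reach.refl _, p2, q2, hb2, fun y hy _ => hbnd y hy, h0⟩
    | succ k ih =>
      obtain ⟨d, u, σ', hu, hr, hp, hrep, hbx, hby, hI⟩ := ih (by omega)
      have s1 : Reach P M.ρ d 1 _ := Reach.step (by rw [hp]; exact h5.append_left.head) (by simp)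
      rw [exec_jlt (hrep.vars x k (by simp)) hbx (by omega) hN, if_pos (by omega)] at s1
      obtain ⟨d', u', σ'', a', b', pc', rep', f, g⟩ := h k hk σ' hI P (pos + e.len + 5) _
        (by simpa [add_assoc] using h6.append_left) rfl (hrep.goto (pos + e.len + 5))
      have s2 : Reach P M.ρ d' 1 _ := Reach.step (i := .const (tmpReg 0) 1) (by
        rw [pc', show pos + e.len + 5 + s.len = pos + e.len + 3 + 2 + s.len by ring]
        exact h7.head) (by simp)
      have s3 : Reach P M.ρ (exec M.ρ d' (.const (tmpReg 0) 1)) 1 _ :=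
        Reach.step (i := .op .add (varReg x) (varReg x) (tmpReg 0)) (by
          rw [exec, Config.setReg, pc',
            show pos + e.len + 5 + s.len = pos + e.len + 3 + 2 + s.len by ring]
          exact h7.tail.head) (by simp)
      have s4 : Reach P M.ρ (exec M.ρ (exec M.ρ d' (.const (tmpReg 0) 1))
          (.op .add (varReg x) (varReg x) (tmpReg 0))) 1 _ :=
        Reach.step (i := .jmp (pos + e.len + 3)) (by
          simp only [exec, Config.setReg, pc']
          rw [show pos + e.len + 5 + s.len = pos + e.len + 3 + 2 + s.len by ring]
          exact h7.tail.tail.head) (by simp)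
      refine ⟨_, _, σ'', ?_, ((((hr.trans s1).trans b').trans s2).trans s3).trans s4, rfl, ?_, ?_,
        fun y hy hy' => ?_, g⟩
      · have : (k + 1) * (t + 4) = k * (t + 4) + (t + 4) := by ring
        omega
      · refine (rep'.unbind (k := k) hx).bindVar (x := x) (k := k + 1) ?_ (fun y hy => ?_) ?_ rfl rfl
        · simp [exec, Config.setReg, tmpReg, varReg, Config.goto]
        · simp [exec, Config.setReg, hv', varReg_inj hy, Config.goto]
        · simp [exec, Config.setReg, hv', Config.goto, Op.eval, rep'.vars x k, BitVec.ofNat_add]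
      · have := f x (by simp)
        simpa [exec, Config.setReg, hb', (hvb _ _).symm, Config.goto, hbx] using this
      · have := f y (by rw [Env.bind_of_ne _ _ hy]; exact hy')
        rw [← hby y hy hy']
        simpa [exec, Config.setReg, hb', (hvb _ _).symm, Config.goto] using this
  obtain ⟨d, u, σ', hu, hr, hp, hrep, hbx, hby, hI⟩ := key N le_rfl
  have s1 : Reach P M.ρ d 1 _ := Reach.step (by rw [hp]; exact h5.append_left.head) (by simp)
  rw [exec_jlt (hrep.vars x N (by simp)) hbx hN hN, if_neg (lt_irrefl _)] at s1
  have s2 : Reach P M.ρ (d.goto (d.pc + 1)) 1 _ := Reach.step (by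
    have := h5.append_left.tail.head
    rw [Config.goto, hp]; exact this) (by simp)
  refine ⟨_, _, σ', ?_, (((r1.trans r2).trans hr).trans s1).trans s2, ?_,
    ((hrep.unbind hx).goto _).goto _, fun y hy => ?_, hI⟩
  · omega
  · simp only [exec, Config.goto, Stmt.len]; ring
  · exact hby y (by rintro rfl; exact hy hx) hy

end

end WordRAM

/-! ### From a statement to a program -/

namespace WordRAM

open Function

/-- The program that runs `s` and answers whether the entry `0` of the array `flag` is non-zero.
The input has length `2 + 2 * m`, where `m` is its entry `1`. -/
def program (s : Stmt) (flag : ℕ) : Program :=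
  [.const 1 1, .load 1 1, .op .add 1 1 1, .const 3 2, .op .add 0 1 3] ++ (s.code 5 ++
    ((Expr.read flag (.const 0)).code 0 ++ [.const (tmpReg 1) 0,
      .jeq (tmpReg 0) (tmpReg 1) (s.len + 15), .halt true, .halt false]))

/-- The prologue computes the length of the input from its entry `1` and makes it the base address
of the arrays. The `15` extra steps are `5` for the prologue, `7` for reading the flag and `3` for
the answer. -/
theorem run_program {w : ℕ} {M : Machine w} {s : Stmt} {flag t : ℕ} {Q : State → Prop}
    {l : List ℕ} (hl : l.length = 2 + 2 * l.getD 1 0) (hb : M.base = l.length)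
    (hi : ∀ i, M.inp i = l.getD i 0) (hlim : 0 < M.lim) (hf : 0 < flag ∧ flag < numArrays)
    (h : Runs M s (fun _ => none) (fun _ _ => 0) t Q) :
    ∃ σ', Q σ' ∧ run (program s flag) M.ρ (t + 15) (init w l) =
      some (decide (¬ 2 ^ w ∣ σ' flag 0)) := by
  have hP : CodeAt (program s flag) 0 (program s flag) := fun i _ => by rw [zero_add]
  nth_rewrite 2 [program] at hP
  generalize program s flag = P at *
  obtain ⟨r1, p1⟩ := reach_straight (ρ := M.ρ) _ rfl 0 (init w l) hP.append_left rfl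
  have h1 := hP.append_right
  have h2 := h1.append_right
  rw [Stmt.length_code] at h2
  have h3 := h2.append_right
  rw [Expr.length_code] at h3
  simp only [List.length_cons, List.length_nil, zero_add] at r1 p1 h1 h2 h3
  have hfit := M.fits
  -- Since `lim` is positive, `2 ^ w` is at least `32`; in particular the constant `1` is not
  -- reduced.
  have hN : 1 * 32 ≤ M.lim * numArrays := Nat.mul_le_mul_right _ hlim
  have hrep : M.Rep (fun _ => none) (fun _ _ => 0) (List.foldl (exec M.ρ) (init w l)
      [.const 1 1, .load 1 1, .op .add 1 1 1, .const 3 2, .op .add 0 1 3]) := by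
    refine ⟨?_, by simp, fun i hi' => ?_, fun A i _ hA hi' => ?_, rfl⟩
    · have h1 : (1 : ℕ) % 2 ^ w = 1 := Nat.mod_eq_of_lt (by omega)
      rw [hb, hl]
      simp [exec, Config.setReg, init, Op.eval, h1, BitVec.ofNat_add, two_mul]
      ac_rfl
    · have : i % 2 ^ w = i := Nat.mod_eq_of_lt (by omega)
      simp only [List.foldl_cons, List.foldl_nil, exec, Config.setReg, init, BitVec.toNat_ofNat]
      rw [this, hi]
    · have : (M.base + (i * numArrays + A)) % 2 ^ w = M.base + (i * numArrays + A) :=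
        Nat.mod_eq_of_lt (addr_lt hA hi')
      simp only [List.foldl_cons, List.foldl_nil, exec, Config.setReg, init, BitVec.toNat_ofNat]
      rw [this, List.getD_eq_default _ _ (by omega)]
  obtain ⟨c2, t2, σ', ht, r2, p2, rep2, -, hQ⟩ := h _ 5 _ h1.append_left p1 hrep
  obtain ⟨c3, r3, p3, k3, rep3, e3⟩ := (Expr.read flag (.const 0)).reach_code 0 _ (ρ := M.ρ)
    h2.append_left p2 rep2 ⟨trivial, hf.1, hf.2, hlim⟩
  simp only [Expr.len] at r3 p3 h3
  have r4 : Reach _ M.ρ c3 1 _ := Reach.step (by rw [p3]; exact h3.head) (by simp)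
  have t01 : tmpReg 0 ≠ tmpReg 1 := by simp [tmpReg]
  have e4 : (exec M.ρ c3 (.const (tmpReg 1) 0)).reg (tmpReg 0) = BitVec.ofNat w (σ' flag 0) := by
    simp [exec, Config.setReg, t01, e3, Expr.eval]
  have e5 : (exec M.ρ c3 (.const (tmpReg 1) 0)).reg (tmpReg 1) = BitVec.ofNat w 0 := by
    simp [exec, Config.setReg]
  have p4 : (exec M.ρ c3 (.const (tmpReg 1) 0)).pc = 5 + s.len + (1 + 6) + 1 := by rw [← p3]; rfl
  have r5 : Reach P M.ρ (exec M.ρ c3 (.const (tmpReg 1) 0)) 1 _ :=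
    Reach.step (by rw [p4]; exact h3.tail.head) (by simp)
  have hiff : BitVec.ofNat w (σ' flag 0) = BitVec.ofNat w 0 ↔ 2 ^ w ∣ σ' flag 0 := by
    rw [← BitVec.toNat_inj, BitVec.toNat_ofNat, BitVec.toNat_ofNat, Nat.zero_mod,
      Nat.dvd_iff_mod_eq_zero]
  have r := (((r1.trans r2).trans r3).trans r4).trans r5
  refine ⟨σ', hQ, ?_⟩
  generalize exec M.ρ c3 (.const (tmpReg 1) 0) = c4 at *
  obtain ⟨d, rfl⟩ := Nat.exists_eq_add_of_le ht
  have hr := r (d + 1)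
  have hs : run P M.ρ (d + 1) (exec M.ρ c4
      (.jeq (tmpReg 0) (tmpReg 1) (s.len + 15))) = some (decide (¬ 2 ^ w ∣ σ' flag 0)) := by
    rw [run]
    rw [exec, e4, e5]
    by_cases hz : 2 ^ w ∣ σ' flag 0
    · have h5 := h3.tail.tail.tail.head
      rw [show 5 + s.len + (1 + 6) + 1 + 1 + 1 = s.len + 15 by ring] at h5
      rw [if_pos (hiff.2 hz), Config.goto, h5]
      simp only [hz, not_true_eq_false, decide_false]
    · rw [if_neg (fun hh => hz (hiff.1 hh)), Config.goto, p4, h3.tail.tail.head]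
      simp only [hz, not_false_eq_true, decide_true]
  rw [hs] at hr
  exact (congrArg (fun k => run P M.ρ k (init w l)) (by ring)).trans hr

end WordRAM

/-! ### Expressions in ordinary notation, and statements that write to one array -/

namespace WordRAM

open Function

instance : Add Expr := ⟨.add⟩
instance : Mul Expr := ⟨.mul⟩
instance : Div Expr := ⟨.div⟩
instance : Mod Expr := ⟨.mod⟩

/-- No variables are bound. -/
def Env.empty : Env := fun _ => none

namespace Expr

variable {w : ℕ} {M : Machine w} {env : Env} {σ : State}

@[simp] theorem eval_add (a b : Expr) : (a + b).eval M env σ = a.eval M env σ + b.eval M env σ := rfl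
@[simp] theorem eval_mul (a b : Expr) : (a * b).eval M env σ = a.eval M env σ * b.eval M env σ := rfl
@[simp] theorem eval_div (a b : Expr) : (a / b).eval M env σ = a.eval M env σ / b.eval M env σ := rfl
@[simp] theorem eval_mod (a b : Expr) : (a % b).eval M env σ = a.eval M env σ % b.eval M env σ := rfl
@[simp] theorem eval_const (k : ℕ) : (const k).eval M env σ = k := rfl
@[simp] theorem eval_var (x : ℕ) : (var x).eval M env σ = (env x).getD 0 := rfl
@[simp] theorem eval_read (A : ℕ) (e : Expr) : (read A e).eval M env σ = σ A (e.eval M env σ) := rfl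
@[simp] theorem eval_inp (e : Expr) : (inp e).eval M env σ = M.inp (e.eval M env σ) := rfl
@[simp] theorem eval_negOne : negOne.eval M env σ = 2 ^ w - 1 := rfl

@[simp] theorem ok_add (a b : Expr) : (a + b).ok M env σ ↔ a.ok M env σ ∧ b.ok M env σ := Iff.rfl
@[simp] theorem ok_mul (a b : Expr) : (a * b).ok M env σ ↔ a.ok M env σ ∧ b.ok M env σ := Iff.rfl
@[simp] theorem ok_div (a b : Expr) : (a / b).ok M env σ ↔ a.ok M env σ ∧ b.ok M env σ ∧
    a.eval M env σ < 2 ^ w ∧ b.eval M env σ < 2 ^ w := Iff.rfl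
@[simp] theorem ok_mod (a b : Expr) : (a % b).ok M env σ ↔ a.ok M env σ ∧ b.ok M env σ ∧
    a.eval M env σ < 2 ^ w ∧ b.eval M env σ < 2 ^ w := Iff.rfl
@[simp] theorem ok_const (k : ℕ) : (const k).ok M env σ := trivial
@[simp] theorem ok_negOne : negOne.ok M env σ := trivial
@[simp] theorem ok_var (x : ℕ) : (var x).ok M env σ ↔ (env x).isSome := Iff.rfl
@[simp] theorem ok_read (A : ℕ) (e : Expr) : (read A e).ok M env σ ↔
    e.ok M env σ ∧ 0 < A ∧ A < numArrays ∧ e.eval M env σ < M.lim := Iff.rfl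
@[simp] theorem ok_inp (e : Expr) : (inp e).ok M env σ ↔
    e.ok M env σ ∧ e.eval M env σ < M.base := Iff.rfl

@[simp] theorem len_add (a b : Expr) : (a + b).len = a.len + b.len + 1 := rfl
@[simp] theorem len_mul (a b : Expr) : (a * b).len = a.len + b.len + 1 := rfl
@[simp] theorem len_div (a b : Expr) : (a / b).len = a.len + b.len + 1 := rfl
@[simp] theorem len_mod (a b : Expr) : (a % b).len = a.len + b.len + 1 := rfl
@[simp] theorem len_const (k : ℕ) : (const k).len = 1 := rfl
@[simp] theorem len_var (x : ℕ) : (var x).len = 2 := rfl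
@[simp] theorem len_read (A : ℕ) (e : Expr) : (read A e).len = e.len + 6 := rfl
@[simp] theorem len_inp (e : Expr) : (inp e).len = e.len + 1 := rfl
@[simp] theorem len_negOne : negOne.len = 3 := rfl

end Expr

/-! Names of the variables and of the arrays. -/

notation "vn" => (0 : ℕ)
notation "vm" => (1 : ℕ)
notation "vK" => (2 : ℕ)
notation "vM" => (3 : ℕ)
notation "vh" => (4 : ℕ)
notation "vb" => (5 : ℕ)
notation "vk" => (6 : ℕ)
notation "vrk" => (7 : ℕ)
notation "vL" => (8 : ℕ)
notation "vlev" => (9 : ℕ)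
notation "vD" => (10 : ℕ)
notation "vQ" => (11 : ℕ)
notation "vc" => (12 : ℕ)
notation "vYb" => (13 : ℕ)
notation "vVb" => (14 : ℕ)
notation "vi" => (15 : ℕ)
notation "vj" => (16 : ℕ)
notation "vx" => (17 : ℕ)
notation "ve" => (18 : ℕ)
notation "vy" => (19 : ℕ)
notation "vvb" => (20 : ℕ)
notation "vyb" => (21 : ℕ)
notation "vS" => (22 : ℕ)
notation "vR" => (23 : ℕ)
notation "vT" => (24 : ℕ)
notation "vq" => (25 : ℕ)
notation "vJ" => (26 : ℕ)
notation "aSrc" => (1 : ℕ)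
notation "aDst" => (2 : ℕ)
notation "aDeg" => (3 : ℕ)
notation "aAdj" => (4 : ℕ)
notation "aRnd" => (5 : ℕ)
notation "aA" => (6 : ℕ)
notation "aB" => (7 : ℕ)
notation "aX" => (8 : ℕ)
notation "aY" => (9 : ℕ)
notation "aZ" => (10 : ℕ)
notation "aCA" => (11 : ℕ)
notation "aCB" => (12 : ℕ)
notation "aCC" => (13 : ℕ)
notation "aSpr" => (14 : ℕ)
notation "aLst" => (15 : ℕ)
notation "aIdx" => (16 : ℕ)
notation "aCnt" => (17 : ℕ)
notation "aPow" => (18 : ℕ)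
notation "aExp" => (19 : ℕ)
notation "aT" => (20 : ℕ)
notation "aL" => (21 : ℕ)
notation "aFlag" => (22 : ℕ)
notation "aD" => (23 : ℕ)
notation "aIdxH" => (24 : ℕ)
notation "aLstL" => (25 : ℕ)

/-- Sequential composition. -/
infixr:60 " ;; " => Stmt.seq

@[simp] theorem State.set_set (σ : State) (A : ℕ) (f g : ℕ → ℕ) :
    (σ.set A f).set A g = σ.set A g := update_idem _ _ _

@[simp] theorem State.set_eq_self (σ : State) (A : ℕ) : σ.set A (σ A) = σ := update_eq_self _ _

theorem Machine.lt_two_pow {w : ℕ} (M : Machine w) {x : ℕ} (h : x < M.lim) : x < 2 ^ w := by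
  have h1 := M.fits
  have h2 : M.lim * 1 ≤ M.lim * numArrays := Nat.mul_le_mul_left _ (by decide)
  omega

section

variable {w : ℕ} {M : Machine w} {env : Env} {σ : State} {t t' : ℕ} {A : ℕ} {g v v' : ℕ → ℕ}
  {P P' : ℕ → Prop} {s s' : Stmt}

open Classical in
/-- The function that is `v` where `P` holds and `g` elsewhere. -/
noncomputable def setOn (P : ℕ → Prop) (v g : ℕ → ℕ) (i : ℕ) : ℕ := if P i then v i else g i

theorem setOn_pos {i : ℕ} (h : P i) : setOn P v g i = v i := if_pos h

theorem setOn_neg {i : ℕ} (h : ¬ P i) : setOn P v g i = g i := if_neg h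

theorem setOn_false (v g : ℕ → ℕ) : setOn (fun _ => False) v g = g := funext fun _ => if_neg id

/-- Started with the contents `g` of the array `A`, and `σ` for all others, the statement `s` sets
the cells of `A` that satisfy `P` to the values `v` and changes nothing else. -/
def Sets (M : Machine w) (s : Stmt) (env : Env) (σ : State) (A : ℕ) (g : ℕ → ℕ) (t : ℕ)
    (P : ℕ → Prop) (v : ℕ → ℕ) : Prop :=
  Runs M s env (σ.set A g) t fun σ' => σ' = σ.set A (setOn P v g)

theorem Sets.runs {Q : State → Prop} (h : Sets M s env σ A (σ A) t P v)
    (ht : t ≤ t') (hQ : Q (σ.set A (setOn P v (σ A)))) :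
    Runs M s env σ t' Q := by
  have := Runs.mono h ht (R := Q) (fun _ h => h ▸ hQ)
  rwa [State.set_eq_self] at this

theorem Sets.mono (h : Sets M s env σ A g t P v) (ht : t ≤ t') (hP : ∀ i, P i ↔ P' i)
    (hv : ∀ i, P' i → v i = v' i) : Sets M s env σ A g t' P' v' := by
  refine Runs.mono h ht fun σ' h' => h'.trans ?_
  congr 1
  funext i
  by_cases hi : P' i
  · rw [setOn_pos hi, setOn_pos ((hP i).2 hi), hv i hi]
  · rw [setOn_neg hi, setOn_neg (fun hh => hi ((hP i).1 hh))]

theorem Sets.write {i e : Expr} (hA : 0 < A ∧ A < numArrays) (hi : i.ok M env (σ.set A g))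
    (he : e.ok M env (σ.set A g)) (hl : i.eval M env (σ.set A g) < M.lim)
    (hv : e.eval M env (σ.set A g) = v (i.eval M env (σ.set A g))) :
    Sets M (.write A i e) env σ A g (i.len + e.len + 6) (· = i.eval M env (σ.set A g)) v := by
  refine Runs.write hA hi he hl ?_
  rw [State.set_set, State.set_self]
  congr 1
  funext j
  by_cases h : j = i.eval M env (σ.set A g)
  · rw [setOn_pos (P := (· = i.eval M env (σ.set A g))) h, h, update_self, hv]
  · rw [setOn_neg (P := (· = i.eval M env (σ.set A g))) h, update_of_ne h]

theorem Sets.bind {x : ℕ} {e : Expr} (hx : env x = none) (he : e.ok M env (σ.set A g))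
    (h : Sets M s (env.bind x (e.eval M env (σ.set A g))) σ A g t P v) :
    Sets M (.bind x e s) env σ A g (e.len + 2 + t) P v :=
  Runs.bind hx he h

theorem Sets.ifLt {a b : Expr} (ha : a.ok M env (σ.set A g)) (hb : b.ok M env (σ.set A g))
    (ha' : a.eval M env (σ.set A g) < 2 ^ w) (hb' : b.eval M env (σ.set A g) < 2 ^ w)
    (h : a.eval M env (σ.set A g) < b.eval M env (σ.set A g) → Sets M s env σ A g t P v) :
    Sets M (.ifLt a b s) env σ A g (a.len + b.len + 2 + t)
      (fun i => a.eval M env (σ.set A g) < b.eval M env (σ.set A g) ∧ P i) v := by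
  refine Runs.ifLt ha hb ha' hb' (fun hlt => ?_) (fun hlt => ?_)
  · exact (h hlt).mono le_rfl (fun i => by simp [hlt]) (fun _ _ => rfl)
  · simp [hlt, setOn_false]

theorem Sets.ifZero {a : Expr} (ha : a.ok M env (σ.set A g))
    (h : 2 ^ w ∣ a.eval M env (σ.set A g) → Sets M s env σ A g t P v) :
    Sets M (.ifZero a s) env σ A g (a.len + 3 + t)
      (fun i => 2 ^ w ∣ a.eval M env (σ.set A g) ∧ P i) v := by
  refine Runs.ifZero ha (fun hz => ?_) (fun hz => ?_)
  · exact (h hz).mono le_rfl (fun i => by simp [hz]) (fun _ _ => rfl)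
  · simp [hz, setOn_false]

/-- The values `v` do not depend on the round, so overlapping writes agree and only the union of the
written sets matters. The body may assume that cells not yet written still hold `g`. -/
theorem Sets.loop {x N : ℕ} {e : Expr} {P : ℕ → ℕ → Prop} (hx : env x = none)
    (he : e.ok M env (σ.set A g)) (heN : e.eval M env (σ.set A g) = N) (hN : N < 2 ^ w)
    (h : ∀ k < N, ∀ g', (∀ i, (∀ k' < k, ¬ P k' i) → g' i = g i) →
      Sets M s (env.bind x k) σ A g' t (P k) v) :
    Sets M (.loop x e s) env σ A g (N * (t + 4) + (e.len + 5)) (fun i => ∃ k < N, P k i) v := by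
  subst heN
  rw [Sets]
  refine Runs.loop (fun k σ' => σ' = σ.set A (setOn (fun i => ∃ k' < k, P k' i) v g))
    hx he hN (by simp [setOn_false]) fun k hk σ' hσ => ?_
  subst hσ
  refine Runs.mono (h k hk _ fun i hi => setOn_neg (by push Not; exact hi)) le_rfl
    fun σ' hσ => hσ.trans ?_
  congr 1
  funext i
  by_cases h1 : P k i
  · rw [setOn_pos h1, setOn_pos ⟨k, by omega, h1⟩]
  · rw [setOn_neg h1]
    have hiff : (∃ k' < k, P k' i) ↔ ∃ k' < k + 1, P k' i :=
      ⟨fun ⟨k', hk', h'⟩ => ⟨k', by omega, h'⟩, fun ⟨k', hk', h'⟩ =>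
        ⟨k', lt_of_le_of_ne (Nat.lt_succ_iff.1 hk') (by rintro rfl; exact h1 h'), h'⟩⟩
    by_cases h2 : ∃ k' < k, P k' i
    · rw [setOn_pos h2, setOn_pos (hiff.1 h2)]
    · rw [setOn_neg h2, setOn_neg (fun h3 => h2 (hiff.2 h3))]

/-- Summation into a cell of an array. -/
theorem Runs.sum {x N c : ℕ} {e i e' : Expr} {f : ℕ → ℕ} {Q : State → Prop}
    (hA : 0 < A ∧ A < numArrays)
    (hx : env x = none) (he : e.ok M env σ) (heN : e.eval M env σ = N) (hN : N < 2 ^ w)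
    (hc : c < M.lim)
    (hi : ∀ k < N, ∀ g, i.ok M (env.bind x k) (σ.set A g) ∧ i.eval M (env.bind x k) (σ.set A g) = c)
    (he' : ∀ k < N, ∀ g, (∀ j, j ≠ c → g j = σ A j) → e'.ok M (env.bind x k) (σ.set A g) ∧
      e'.eval M (env.bind x k) (σ.set A g) = f k)
    (hQ : Q (σ.set A (update (σ A) c (σ A c + ∑ k ∈ Finset.range N, f k)))) :
    Runs M (.loop x e (.write A i (.read A i + e'))) env σ
      (N * (i.len + (i.len + 6 + e'.len + 1) + 6 + 4) + (e.len + 5)) Q := by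
  subst heN
  refine Runs.mono (Runs.loop (fun k σ' => σ' = σ.set A (update (σ A) c
    (σ A c + ∑ k ∈ Finset.range k, f k))) hx he hN (by simp) (fun k hk σ' hσ => ?_)) le_rfl
    (fun σ' h => h ▸ hQ)
  subst hσ
  obtain ⟨i1, i2⟩ := hi k hk (update (σ A) c (σ A c + ∑ k ∈ Finset.range k, f k))
  obtain ⟨e1, e2⟩ := he' k hk (update (σ A) c (σ A c + ∑ k ∈ Finset.range k, f k))
    (fun j hj => update_of_ne hj _ _)
  refine Runs.write hA i1 ⟨⟨i1, hA.1, hA.2, i2.symm ▸ hc⟩, e1⟩ (i2.symm ▸ hc) ?_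
  rw [Expr.eval_add, Expr.eval_read, i2, e2, State.set_set, State.set_self, update_self, update_idem,
    Finset.sum_range_succ, add_assoc]

end

end WordRAM

/-! ### Yates's algorithm for Kronecker powers -/

namespace WordRAM

open Function



/-- Fill the first cells of an array. -/
def fill (A : ℕ) (len val : Expr) : Stmt := .loop vS len (.write A (.var vS) val)

/-- Copy a segment of the array `B` to the beginning of the array `A`. -/
def copy (A B : ℕ) (len off : Expr) : Stmt :=
  .loop vS len (.write A (.var vS) (.read B (off + .var vS)))

/-- Contract the lowest digit (in base `J`) of the index of the array `X` with the matrix `C`, and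
make the resulting digit (in base `r`) the highest one; `aL` holds the length of `X`. -/
def yatesStep (C X r J : ℕ) : Stmt :=
  .bind vR (.read aL (.const 0) / .const J)
    (.loop vT (.const r) (.loop vq (.var vR)
      (.write aT (.var vT * .var vR + .var vq) (.const 0) ;;
      .loop vJ (.const J) (.write aT (.var vT * .var vR + .var vq)
        (.read aT (.var vT * .var vR + .var vq) +
          .read C (.var vT * .const J + .var vJ) * .read X (.var vq * .const J + .var vJ))))) ;;
    copy X aT (.const r * .var vR) (.const 0) ;;
    .write aL (.const 0) (.const r * .var vR))

/-- Apply the matrix `C` to each of the digits of the index of `X`. -/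
def yates (C X r J : ℕ) (len : Expr) : Stmt :=
  .write aL (.const 0) len ;; .loop vy (.var vk) (yatesStep C X r J)

section

variable {w : ℕ} {M : Machine w} {env : Env} {σ : State} {t : ℕ} {Q : State → Prop}

theorem runs_fill {A N v : ℕ} {len val : Expr} (hA : 0 < A ∧ A < numArrays)
    (hx : env vS = none) (h1 : len.ok M env σ) (h2 : len.eval M env σ = N)
    (hN : N ≤ M.lim) (hN' : N < 2 ^ w)
    (h3 : ∀ k g, val.ok M (env.bind vS k) (σ.set A g))
    (h4 : ∀ k g, val.eval M (env.bind vS k) (σ.set A g) = v)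
    (ht : N * (val.len + 12) + (len.len + 5) ≤ t)
    (hQ : Q (σ.set A (setOn (· < N) (fun _ => v) (σ A)))) :
    Runs M (fill A len val) env σ t Q := by
  have h : Sets M (fill A len val) env σ A (σ A) (N * (2 + val.len + 6 + 4) + (len.len + 5))
      (fun i => ∃ k < N, i = k) (fun _ => v) := by
    refine Sets.loop hx (by simpa using h1) (by simpa using h2) hN' fun k hk g hg => ?_
    exact (Sets.write hA (by simp) (h3 _ _) (by simp; omega) (h4 _ _)).mono le_rfl (by simp)
      (fun _ _ => rfl)
  refine (h.mono (le_trans (le_of_eq (by ring)) ht) (P' := (· < N)) (fun i => ?_)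
    (fun _ _ => rfl)).runs le_rfl hQ
  constructor
  · rintro ⟨k, hk, rfl⟩; exact hk
  · exact fun hi => ⟨i, hi, rfl⟩

theorem runs_copy {A B N o : ℕ} {len off : Expr} (hA : 0 < A ∧ A < numArrays)
    (hB : 0 < B ∧ B < numArrays) (hAB : B ≠ A)
    (hx : env vS = none) (h1 : len.ok M env σ) (h2 : len.eval M env σ = N)
    (hN : N ≤ M.lim) (hN' : N < 2 ^ w)
    (h3 : ∀ k g, off.ok M (env.bind vS k) (σ.set A g))
    (h4 : ∀ k g, off.eval M (env.bind vS k) (σ.set A g) = o) (ho : o + N ≤ M.lim)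
    (ht : N * (off.len + 21) + (len.len + 5) ≤ t)
    (hQ : Q (σ.set A (setOn (· < N) (fun i => σ B (o + i)) (σ A)))) :
    Runs M (copy A B len off) env σ t Q := by
  have h : Sets M (copy A B len off) env σ A (σ A)
      (N * (2 + (off.len + 2 + 1 + 6) + 6 + 4) + (len.len + 5))
      (fun i => ∃ k < N, i = k) (fun i => σ B (o + i)) := by
    refine Sets.loop hx (by simpa using h1) (by simpa using h2) hN' fun k hk g hg => ?_
    refine (Sets.write hA (by simp) ?_ (by simp; omega) ?_).mono le_rfl (by simp) (fun _ _ => rfl)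
    · simp [h3, h4, hB]; omega
    · simp [h4, hAB]
  refine (h.mono (le_trans (le_of_eq (by ring)) ht) (P' := (· < N)) (fun i => ?_)
    (fun _ _ => rfl)).runs le_rfl hQ
  constructor
  · rintro ⟨k, hk, rfl⟩; exact hk
  · exact fun hi => ⟨i, hi, rfl⟩

/-- One step of `yates`: the lowest digit of the index of `x` is contracted, there are `R` values
of the other digits. -/
def yStep (J : ℕ) (C : ℕ → ℕ) (R : ℕ) (x : ℕ → ℕ) (i : ℕ) : ℕ :=
  ∑ j ∈ Finset.range J, C (i / R * J + j) * x (i % R * J + j)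

/-- The new array is built in `aT`, as every entry of `X` is read for several outputs, and is then
copied back. -/
theorem runs_yatesStep {C X r J R L : ℕ} (hC : 0 < C ∧ C < numArrays) (hX : 0 < X ∧ X < numArrays)
    (hCT : C ≠ aT) (hXT : X ≠ aT) (hXL : X ≠ aL)
    (hS : env vS = none) (hR : env vR = none) (hT : env vT = none) (hq : env vq = none)
    (hJ : env vJ = none) (hJ0 : 0 < J)
    (hL : L < M.lim) (h1 : σ aL 0 = R * J) (h2 : R * J ≤ L) (h3 : r * R ≤ L) (h4 : r * J ≤ L)
    (hrL : r ≤ L) (hJL : J ≤ L)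
    (ht : (L + r) * (60 * J + 100) + 100 ≤ t)
    (hQ : ∀ σ', σ' aL 0 = r * R → (∀ i < r * R, σ' X i = yStep J (σ C) R (σ X) i) →
      (∀ B, B ≠ X → B ≠ aT → B ≠ aL → σ' B = σ B) → Q σ') :
    Runs M (yatesStep C X r J) env σ t Q := by
  have hL' : L < 2 ^ w := M.lt_two_pow hL
  have hRL : R ≤ L := le_trans (Nat.le_mul_of_pos_right _ hJ0) h2
  have inner : ∀ a < r, ∀ q < R, ∀ g, Sets M (.write aT (.var vT * .var vR + .var vq) (.const 0) ;;
      .loop vJ (.const J) (.write aT (.var vT * .var vR + .var vq)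
        (.read aT (.var vT * .var vR + .var vq) +
          .read C (.var vT * .const J + .var vJ) * .read X (.var vq * .const J + .var vJ))))
      (((env.bind vR R).bind vT a).bind vq q) σ aT g (60 * J + 30) (· = a * R + q)
      (yStep J (σ C) R (σ X)) := by
    intro a ha q hqR g
    have e1 : a * R + q < r * R := by nlinarith
    refine Runs.mono (Runs.seq (Q := fun σ' => σ' = σ.set aT (update g (a * R + q) 0))
      (Runs.write (by decide) (by simp) (by simp) (by simp; omega) (by simp))
      (t' := J * 60 + 6) (R := fun σ' => σ' = σ.set aT (setOn (· = a * R + q)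
        (yStep J (σ C) R (σ X)) g)) ?_) (by simp; omega) (fun _ h => h)
    rintro _ rfl
    refine (Runs.sum (N := J) (c := a * R + q)
      (f := fun j => σ C (a * J + j) * σ X (q * J + j)) (by decide)
      (by simp [hJ]) (by simp) (by simp) (by omega) (by omega)
      (fun k hk g' => by simp) (fun k hk g' hg' => ?_) ?_).mono (t' := J * 60 + 6)
      (by simp) (fun _ h => h)
    · have e2 : a * J + k < r * J := by nlinarith
      have e3 : q * J + k < R * J := by nlinarith
      simp [hC, hX, hCT, hXT]
      omega
    · simp only [State.set_set, State.set_self, update_self, zero_add, update_idem]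
      congr 1
      funext i
      by_cases hi : i = a * R + q
      · have hR0 : 0 < R := by omega
        rw [setOn_pos (P := (· = a * R + q)) hi, hi, update_self, yStep,
          show (a * R + q) / R = a by
            rw [add_comm, Nat.add_mul_div_right _ _ hR0, Nat.div_eq_of_lt hqR, zero_add],
          show (a * R + q) % R = q by
            rw [add_comm, Nat.add_mul_mod_self_right, Nat.mod_eq_of_lt hqR]]
      · rw [setOn_neg (P := (· = a * R + q)) hi, update_of_ne hi]
  have outer : Sets M (.loop vT (.const r) (.loop vq (.var vR)
      (.write aT (.var vT * .var vR + .var vq) (.const 0) ;;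
      .loop vJ (.const J) (.write aT (.var vT * .var vR + .var vq)
        (.read aT (.var vT * .var vR + .var vq) +
          .read C (.var vT * .const J + .var vJ) * .read X (.var vq * .const J + .var vJ))))))
      (env.bind vR R) σ aT (σ aT) (r * ((R * (60 * J + 30 + 4) + 7) + 4) + 6) (· < r * R)
      (yStep J (σ C) R (σ X)) := by
    refine (Sets.loop (N := r) (by simp [hT]) (by simp) (by simp) (by omega)
      fun a ha g _ => Sets.loop (N := R) (by simp [hq]) (by simp) (by simp) (by omega)
        fun q hqR g' _ => inner a ha q hqR g').mono (by simp) (fun i => ?_) (fun _ _ => rfl)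
    constructor
    · rintro ⟨a, ha, q, hqR, rfl⟩
      nlinarith
    · intro hi
      have hR0 : 0 < R := Nat.pos_of_ne_zero (by rintro rfl; simp at hi)
      exact ⟨i / R, Nat.div_lt_of_lt_mul (by rwa [mul_comm] at hi), i % R, Nat.mod_lt _ hR0,
        (Nat.div_add_mod' i R).symm⟩
  refine Runs.mono (Runs.bind (t := (r * ((R * (60 * J + 30 + 4) + 7) + 4) + 6) +
    ((r * R * 22 + 9) + 12)) (Q := Q) hR (by simp [numArrays]; omega) ?_) ?_ (fun _ h => h)
  · have hev : Expr.eval M env σ (.read aL (.const 0) / .const J) = R := by simp [h1, hJ0]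
    rw [hev]
    refine Runs.seq (Q := fun σ' => σ' = σ.set aT (setOn (· < r * R)
      (yStep J (σ C) R (σ X)) (σ aT))) (outer.runs le_rfl rfl) ?_
    rintro _ rfl
    refine Runs.seq (Q := fun σ' => (∀ i < r * R, σ' X i = yStep J (σ C) R (σ X) i) ∧
      ∀ B, B ≠ X → B ≠ aT → B ≠ aL → σ' B = σ B) ?_ ?_
    · refine runs_copy (N := r * R) (o := 0) hX (by decide) (by simpa using hXT.symm) (by simp [hS])
        (by simp) (by simp) (by omega) (by omega) (by simp) (by simp) (by omega) (by simp) ?_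
      refine ⟨fun i hi => ?_, fun B hB1 hB2 _ => by simp [hB1, hB2]⟩
      rw [State.set_self, setOn_pos (P := (· < r * R)) hi, State.set_self, zero_add,
        setOn_pos (P := (· < r * R)) hi]
    · rintro σ' ⟨hσ1, hσ2⟩
      refine (Runs.write (by decide) (by simp) (by simp) (by simp; omega) (hQ _ (by simp) ?_ ?_)).mono
        (by simp) (fun _ h => h)
      · intro i hi; simpa [hXL] using hσ1 i hi
      · intro B hB1 hB2 hB3
        simpa [hB3] using hσ2 B hB1 hB2 hB3
  · have : r * R * (60 * J + 56) ≤ L * (60 * J + 56) := Nat.mul_le_mul_right _ h3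
    simp
    nlinarith

theorem yStep_congr {r J R i : ℕ} {C x x' : ℕ → ℕ} (hi : i < r * R)
    (h : ∀ j < R * J, x j = x' j) : yStep J C R x i = yStep J C R x' i := by
  have hR : 0 < R := Nat.pos_of_ne_zero (by rintro rfl; simp at hi)
  refine Finset.sum_congr rfl fun j hj => ?_
  rw [h]
  have h1 : i % R < R := Nat.mod_lt _ hR
  have h2 : j < J := Finset.mem_range.1 hj
  nlinarith

/-- The array after `s` of the `k` steps of `yates`. -/
def yIter (r J : ℕ) (C : ℕ → ℕ) (k : ℕ) (x : ℕ → ℕ) : ℕ → ℕ → ℕ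
  | 0 => x
  | s + 1 => yStep J C (r ^ s * J ^ (k - (s + 1))) (yIter r J C k x s)

/-- After `s` steps the array has length `r ^ s * J ^ (k - s)`; `L` bounds all these lengths, so the
`k` steps cost about `k * L` up to constants instead of the size of the full Kronecker power. -/
theorem runs_yates {C X r J k L : ℕ} {len : Expr} (hC : 0 < C ∧ C < numArrays)
    (hX : 0 < X ∧ X < numArrays) (hCX : C ≠ X) (hCT : C ≠ aT) (hXT : X ≠ aT) (hCL : C ≠ aL)
    (hXL : X ≠ aL) (hk : env vk = some k) (hy : env vy = none)
    (hS : env vS = none) (hR : env vR = none) (hT : env vT = none) (hq : env vq = none)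
    (hJ : env vJ = none) (hJ0 : 0 < J) (hl : len.ok M env σ) (hl' : len.eval M env σ = J ^ k)
    (hL : L < M.lim) (hk' : k < M.lim) (h2 : ∀ s ≤ k, r ^ s * J ^ (k - s) ≤ L) (h4 : r * J ≤ L)
    (hrL : r ≤ L) (hJL : J ≤ L)
    (ht : len.len + 14 + k * ((L + r) * (60 * J + 100) + 104) ≤ t)
    (hQ : ∀ σ', (∀ i < r ^ k, σ' X i = yIter r J (σ C) k (σ X) k i) →
      (∀ B, B ≠ X → B ≠ aT → B ≠ aL → σ' B = σ B) → Q σ') :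
    Runs M (yates C X r J len) env σ t Q := by
  refine (Runs.seq (Q := fun σ' => σ' = σ.set aL (update (σ aL) 0 (J ^ k))) (Runs.write (by decide)
    (by simp) hl (by simp; omega) (by simp [hl'])) (t' := k * ((L + r) * (60 * J + 100) + 104) + 7)
    (R := Q) ?_).mono (by simp; omega) (fun _ h => h)
  rintro _ rfl
  refine (Runs.loop (t := (L + r) * (60 * J + 100) + 100) (fun s σ' => σ' aL 0 = r ^ s * J ^ (k - s) ∧
    (∀ i < r ^ s * J ^ (k - s), σ' X i = yIter r J (σ C) k (σ X) s i) ∧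
    ∀ B, B ≠ X → B ≠ aT → B ≠ aL → σ' B = σ B) hy (by simp [hk])
    (by simpa [hk] using M.lt_two_pow hk') ?_ ?_).mono ?_ ?_
  · refine ⟨by simp, fun i _ => by simp [hXL, yIter], fun B _ _ hB => by simp [hB]⟩
  · simp only [Expr.eval_var, hk, Option.getD_some]
    rintro s hs σ' ⟨h5, h6, h7⟩
    have e1 : r ^ s * J ^ (k - (s + 1)) * J = r ^ s * J ^ (k - s) := by
      rw [show k - s = k - (s + 1) + 1 by omega]; ring
    have e2 : r * (r ^ s * J ^ (k - (s + 1))) = r ^ (s + 1) * J ^ (k - (s + 1)) := by ring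
    refine runs_yatesStep (R := r ^ s * J ^ (k - (s + 1))) hC hX hCT hXT hXL (by simp [hS])
      (by simp [hR]) (by simp [hT]) (by simp [hq]) (by simp [hJ]) hJ0 hL (h5.trans e1.symm)
      (e1.trans_le (h2 s hs.le)) (e2.trans_le (h2 (s + 1) hs)) h4 hrL hJL le_rfl ?_
    intro σ'' h8 h9 h10
    refine ⟨h8.trans e2, fun i hi => ?_, fun B hB1 hB2 hB3 =>
      (h10 B hB1 hB2 hB3).trans (h7 B hB1 hB2 hB3)⟩
    rw [← e2] at hi
    rw [h9 i hi, h7 C hCX hCT hCL, yIter]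
    exact yStep_congr hi fun j hj => h6 j (by rwa [e1] at hj)
  · simp [hk]
  · simp only [Expr.eval_var, hk, Option.getD_some]
    rintro σ' ⟨-, h6, h7⟩
    refine hQ σ' (fun i hi => h6 i (by simpa using hi)) h7

end

/-- The entries of the `s`-th Kronecker power of the `r × J` matrix `C`. -/
def ker (r J : ℕ) (C : ℕ → ℕ) : ℕ → ℕ → ℕ → ℕ
  | 0, _, _ => 1
  | s + 1, τ, η => C (τ / r ^ s * J + η / J ^ s) * ker r J C s (τ % r ^ s) (η % J ^ s)

theorem sum_range_mul {R : Type*} [AddCommMonoid R] (f : ℕ → R) (a b : ℕ) :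
    ∑ i ∈ Finset.range (a * b), f i =
      ∑ q ∈ Finset.range a, ∑ i ∈ Finset.range b, f (q * b + i) := by
  induction a with
  | zero => simp
  | succ a ih => rw [Nat.succ_mul, Finset.sum_range_add, ih, Finset.sum_range_succ]

theorem mul_add_div_of_lt {q b i : ℕ} (hi : i < b) : (q * b + i) / b = q := by
  rw [add_comm, Nat.add_mul_div_right _ _ (by omega), Nat.div_eq_of_lt hi, zero_add]

theorem mul_add_mod_of_lt {q b i : ℕ} (hi : i < b) : (q * b + i) % b = i := by
  rw [add_comm, Nat.add_mul_mod_self_right, Nat.mod_eq_of_lt hi]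

/-- Each step removes the lowest digit and puts the contracted one on top, so the digits rotate.
After `s` steps the `k - s` untouched digits `ξ` are the low part and the contracted ones `τ` the
high part; after `k` steps the original order is restored. -/
theorem yIter_eq {r J k : ℕ} (C x : ℕ → ℕ) : ∀ s ≤ k, ∀ τ < r ^ s, ∀ ξ < J ^ (k - s),
    yIter r J C k x s (τ * J ^ (k - s) + ξ) =
      ∑ η ∈ Finset.range (J ^ s), ker r J C s τ η * x (ξ * J ^ s + η)
  | 0, _, τ, hτ, ξ, _ => by
    have : τ = 0 := by simpa using hτ
    simp [yIter, ker, this]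
  | s + 1, hs, τ, hτ, ξ, hξ => by
    have hr : 0 < r ^ s := Nat.pos_of_ne_zero fun h => by simp [pow_succ, h] at hτ
    set p := J ^ (k - (s + 1)) with hp
    have e1 : J ^ (k - s) = p * J := by rw [show k - s = k - (s + 1) + 1 by omega, pow_succ]
    have e2 : τ * p + ξ = τ / r ^ s * (r ^ s * p) + (τ % r ^ s * p + ξ) := by
      conv_lhs => rw [← Nat.div_add_mod' τ (r ^ s)]
      ring
    have h1 : τ % r ^ s < r ^ s := Nat.mod_lt _ hr
    have h2 : τ % r ^ s * p + ξ < r ^ s * p := by nlinarith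
    rw [yIter, yStep, ← hp, e2, mul_add_div_of_lt h2, mul_add_mod_of_lt h2, pow_succ' J s,
      sum_range_mul]
    refine Finset.sum_congr rfl fun j hj => ?_
    have hj' : j < J := Finset.mem_range.1 hj
    have h3 : ξ * J + j < J ^ (k - s) := by rw [e1]; nlinarith
    rw [show (τ % r ^ s * p + ξ) * J + j = τ % r ^ s * J ^ (k - s) + (ξ * J + j) by rw [e1]; ring,
      yIter_eq C x s (by omega) _ h1 _ h3, Finset.mul_sum]
    refine Finset.sum_congr rfl fun η hη => ?_
    have hη' : η < J ^ s := Finset.mem_range.1 hη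
    rw [ker, mul_add_div_of_lt hη', mul_add_mod_of_lt hη', ← mul_assoc]
    congr 2
    ring

theorem yIter_self {r J k i : ℕ} (C x : ℕ → ℕ) (hi : i < r ^ k) :
    yIter r J C k x k i = ∑ η ∈ Finset.range (J ^ k), ker r J C k i η * x η := by
  simpa using yIter_eq C x k le_rfl i hi 0 (by simp)

end WordRAM

namespace WordRAM

open Finset

/-! ## Kronecker powers of a bilinear algorithm for matrix multiplication -/

/-- The tensor of the multiplication of `N × N` matrices, with pairs encoded in base `N`. -/
def mmDelta (N p q q' : ℕ) : ℕ :=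
  if q / N = p / N ∧ q' / N = q % N ∧ q' % N = p % N then 1 else 0

theorem exists_int_of_rat {ι : Type*} [Finite ι] (f : ι → ℚ) :
    ∃ D : ℕ, 0 < D ∧ ∃ z : ι → ℤ, ∀ i, (z i : ℚ) = D * f i := by
  classical
  cases nonempty_fintype ι
  refine ⟨∏ i, (f i).den, Finset.prod_pos fun i _ => (f i).pos,
    fun i => (f i).num * ∏ j ∈ univ.erase i, ((f j).den : ℤ), fun i => ?_⟩
  rw [← Finset.mul_prod_erase univ _ (mem_univ i)]
  push_cast
  have := Rat.mul_den_eq_num (f i)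
  linear_combination (∏ j ∈ univ.erase i, ((f j).den : ℚ)) * this.symm

/-- Applied to pairs of matrix units, the algorithm becomes an identity of tensors. Denominators are
cleared separately in the three families of coefficients, and `D` is the product of the three
factors. -/
theorem exists_int_bilinear {N r r' : ℕ} (h : HasBilinearMatMul ℚ N r) (hr : r ≤ r') :
    ∃ (a b c : ℕ → ℤ) (D : ℕ), 0 < D ∧ ∀ p < N * N, ∀ q < N * N, ∀ q' < N * N,
      ∑ t ∈ range r', c (p * r' + t) * a (t * (N * N) + q) * b (t * (N * N) + q') =
        D * mmDelta N p q q' := by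
  obtain ⟨a, b, c, h⟩ := h
  obtain ⟨Da, hDa, za, ha⟩ := exists_int_of_rat (fun x : Fin r × Fin N × Fin N => a x.1 x.2.1 x.2.2)
  obtain ⟨Db, hDb, zb, hb⟩ := exists_int_of_rat (fun x : Fin r × Fin N × Fin N => b x.1 x.2.1 x.2.2)
  obtain ⟨Dc, hDc, zc, hc⟩ := exists_int_of_rat (fun x : Fin r × Fin N × Fin N => c x.1 x.2.1 x.2.2)
  rcases Nat.eq_zero_or_pos N with rfl | hN
  · exact ⟨0, 0, 0, 1, one_pos, fun p hp => by simp at hp⟩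
  let e : ℕ → Fin N := fun i => ⟨i % N, Nat.mod_lt _ hN⟩
  -- The additional products from `r` to `r'` get coefficients `0`.
  let ext : (Fin r × Fin N × Fin N → ℤ) → ℕ → ℕ → ℤ := fun z t q =>
    if ht : t < r then z (⟨t, ht⟩, e (q / N), e q) else 0
  refine ⟨fun i => ext za (i / (N * N)) (i % (N * N)), fun i => ext zb (i / (N * N)) (i % (N * N)),
    fun i => ext zc (i % r') (i / r'), Da * Db * Dc, by positivity, fun p hp q hq q' hq' => ?_⟩
  have key := congrFun₂ (h (Matrix.single (e (q / N)) (e q) 1)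
    (Matrix.single (e (q' / N)) (e q') 1)) (e (p / N)) (e p)
  have hlhs : (Matrix.single (e (q / N)) (e q) (1 : ℚ) * Matrix.single (e (q' / N)) (e q') 1 :
      Matrix (Fin N) (Fin N) ℚ) (e (p / N)) (e p) = mmDelta N p q q' := by
    have hd : ∀ (x : ℕ) (hx : x < N * N), e (x / N) = ⟨x / N, Nat.div_lt_of_lt_mul hx⟩ := fun x hx =>
      Fin.ext (Nat.mod_eq_of_lt (Nat.div_lt_of_lt_mul hx))
    rw [hd q hq, hd q' hq', hd p hp]
    simp only [Matrix.mul_apply, Matrix.single_apply, mmDelta, e]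
    rw [Finset.sum_eq_single ⟨q % N, Nat.mod_lt _ hN⟩]
    · simp only [Fin.mk.injEq]
      by_cases h1 : q / N = p / N <;> by_cases h2 : q' / N = q % N <;>
        by_cases h3 : q' % N = p % N <;> simp [h1, h2, h3]
    · intro j _ hj
      simp [Ne.symm hj]
    · simp
  rw [hlhs, Matrix.sum_apply] at key
  have hsum : ∀ (z : Fin r → Matrix (Fin N) (Fin N) ℚ) (t : Fin r) (i j : Fin N),
      ∑ i', ∑ j', z t i' j' * Matrix.single i j (1 : ℚ) i' j' = z t i j := by
    intro z t i j
    rw [Finset.sum_eq_single i, Finset.sum_eq_single j]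
    · simp
    · intro j' _ hj'; simp [Ne.symm hj']
    · simp
    · intro i' _ hi'; simp [Ne.symm hi']
    · simp
  simp only [hsum, Matrix.smul_apply, smul_eq_mul] at key
  have : ((∑ t ∈ range r', ext zc ((p * r' + t) % r') ((p * r' + t) / r') *
      ext za ((t * (N * N) + q) / (N * N)) ((t * (N * N) + q) % (N * N)) *
      ext zb ((t * (N * N) + q') / (N * N)) ((t * (N * N) + q') % (N * N)) : ℤ) : ℚ) =
      ((Da * Db * Dc * mmDelta N p q q' : ℤ) : ℚ) := by
    push_cast
    rw [key, Finset.mul_sum, ← Finset.sum_subset (Finset.range_subset_range.2 hr),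
      Finset.sum_range]
    · refine Finset.sum_congr rfl fun t _ => ?_
      have htr : (t : ℕ) < r' := lt_of_lt_of_le t.2 hr
      rw [mul_add_mod_of_lt htr, mul_add_div_of_lt htr, mul_add_mod_of_lt hq, mul_add_div_of_lt hq,
        mul_add_mod_of_lt hq', mul_add_div_of_lt hq']
      simp only [ext, Fin.is_lt, dif_pos, Fin.eta, ha, hb, hc]
      ring
    · intro t htr' htr
      have htr' := Finset.mem_range.1 htr'
      rw [mul_add_mod_of_lt htr']
      have : ¬ t < r := fun h => htr (Finset.mem_range.2 h)
      simp [ext, this]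
  exact_mod_cast this

/-- The tensor of the multiplication of `N ^ k × N ^ k` matrices, as a Kronecker power. -/
def mmDeltaPow (N : ℕ) : ℕ → ℕ → ℕ → ℕ → ℕ
  | 0, _, _, _ => 1
  | k + 1, p, q, q' => mmDelta N (p / (N * N) ^ k) (q / (N * N) ^ k) (q' / (N * N) ^ k) *
      mmDeltaPow N k (p % (N * N) ^ k) (q % (N * N) ^ k) (q' % (N * N) ^ k)

section

variable {R : Type*} [CommRing R]

/-- Tensor identities are multiplicative under Kronecker products: the top digit is handled by `h`
and the others by induction. The ring is arbitrary because the machine computes in `ZMod (2 ^ w)`.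
-/
theorem sum_ker {N r D : ℕ} {a b c : ℕ → ℕ}
    (h : ∀ p < N * N, ∀ q < N * N, ∀ q' < N * N,
      ∑ t ∈ range r, (c (p * r + t) : R) * a (t * (N * N) + q) * b (t * (N * N) + q') =
        D * mmDelta N p q q') (k : ℕ) :
    ∀ p < (N * N) ^ k, ∀ q < (N * N) ^ k, ∀ q' < (N * N) ^ k,
      ∑ t ∈ range (r ^ k), (ker (N * N) r c k p t : R) * ker r (N * N) a k t q *
        ker r (N * N) b k t q' = D ^ k * mmDeltaPow N k p q q' := by
  induction k with
  | zero => intro p _ q _ q' _; simp [ker, mmDeltaPow]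
  | succ k ih =>
    intro p hp q hq q' hq'
    have hpos : 0 < (N * N) ^ k := Nat.pos_of_ne_zero fun h => by simp [pow_succ, h] at hp
    rw [pow_succ] at hp hq hq'
    have h1 := h _ (Nat.div_lt_of_lt_mul hp) _ (Nat.div_lt_of_lt_mul hq) _
      (Nat.div_lt_of_lt_mul hq')
    have h2 := ih _ (Nat.mod_lt p hpos) _ (Nat.mod_lt q hpos) _ (Nat.mod_lt q' hpos)
    rw [mmDeltaPow, pow_succ' r, sum_range_mul, pow_succ (D : R)]
    push_cast
    rw [show (D : R) ^ k * D * (mmDelta N (p / (N * N) ^ k) (q / (N * N) ^ k) (q' / (N * N) ^ k) *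
        mmDeltaPow N k (p % (N * N) ^ k) (q % (N * N) ^ k) (q' % (N * N) ^ k)) =
        (D * mmDelta N (p / (N * N) ^ k) (q / (N * N) ^ k) (q' / (N * N) ^ k)) *
        (D ^ k * mmDeltaPow N k (p % (N * N) ^ k) (q % (N * N) ^ k) (q' % (N * N) ^ k)) by ring,
      ← h1, ← h2, Finset.sum_mul_sum]
    refine Finset.sum_congr rfl fun t _ => Finset.sum_congr rfl fun s hs => ?_
    have hs' := Finset.mem_range.1 hs
    simp only [ker, mul_add_div_of_lt hs', mul_add_mod_of_lt hs']
    push_cast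
    ring

theorem sum_mmDelta {N u v : ℕ} (hu : u < N) (hv : v < N) (F : ℕ → ℕ → R) :
    ∑ q ∈ range (N * N), ∑ q' ∈ range (N * N), (mmDelta N (u * N + v) q q' : R) * F q q' =
      ∑ y ∈ range N, F (u * N + y) (y * N + v) := by
  rw [sum_range_mul, Finset.sum_eq_single_of_mem u (mem_range.2 hu)]
  · refine Finset.sum_congr rfl fun y hy => ?_
    have hy' := mem_range.1 hy
    rw [sum_range_mul, Finset.sum_eq_single_of_mem y hy, Finset.sum_eq_single_of_mem v
      (mem_range.2 hv)]
    · simp [mmDelta, mul_add_div_of_lt, Nat.mod_eq_of_lt, hv, hy']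
    · intro j hj hjv
      have hj' := mem_range.1 hj
      simp [mmDelta, mul_add_div_of_lt, Nat.mod_eq_of_lt, hv, hy', hj', hjv]
    · intro i hi hiy
      refine Finset.sum_eq_zero fun j hj => ?_
      have hj' := mem_range.1 hj
      simp [mmDelta, mul_add_div_of_lt, Nat.mod_eq_of_lt, hv, hy', hj', hiy]
  · intro i hi hiu
    refine Finset.sum_eq_zero fun j hj => Finset.sum_eq_zero fun q' _ => ?_
    have hj' := mem_range.1 hj
    simp [mmDelta, mul_add_div_of_lt, hv, hj', hiu]

/-- Reinterpret the base `N` digits of a number in base `N * N`. -/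
def spread (N x : ℕ) : ℕ := Nat.ofDigits (N * N) (N.digits x)

theorem spread_eq {N : ℕ} (hN : 2 ≤ N) (x : ℕ) :
    spread N x = spread N (x / N) * (N * N) + x % N := by
  rcases Nat.eq_zero_or_pos x with rfl | hx
  · simp [spread]
  · rw [spread, Nat.digits_def' hN hx, Nat.ofDigits_cons, spread]
    ring

theorem spread_mul_add {N : ℕ} (hN : 2 ≤ N) (k : ℕ) : ∀ u u₀ : ℕ, u₀ < N ^ k →
    spread N (u * N ^ k + u₀) = spread N u * (N * N) ^ k + spread N u₀ := by
  induction k with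
  | zero =>
    intro u u₀ h
    have : u₀ = 0 := by simpa using h
    simp [this, spread]
  | succ k ih =>
    intro u u₀ h
    have hN0 : 0 < N := by omega
    have h1 : u₀ / N < N ^ k := Nat.div_lt_of_lt_mul (by rwa [pow_succ'] at h)
    have h2 : u * N ^ (k + 1) + u₀ = u₀ + N * (u * N ^ k) := by ring
    rw [spread_eq hN (u * N ^ (k + 1) + u₀), spread_eq hN u₀, h2, Nat.add_mul_div_left _ _ hN0,
      Nat.add_mul_mod_self_left, add_comm (u₀ / N), ih u _ h1]
    ring

theorem spread_of_lt {N x : ℕ} (hN : 2 ≤ N) (hx : x < N) : spread N x = x := by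
  rw [spread_eq hN, Nat.div_eq_of_lt hx, Nat.mod_eq_of_lt hx]
  simp [spread]

/-- The index of the entry `(u, v)` of a matrix, when the base `N` digits of `u` and `v` are
interleaved. -/
def zIndex (N u v : ℕ) : ℕ := N * spread N u + spread N v

/-- The top digits of `u` and `v` together form the top base `N * N` digit of the index. This makes
the interleaved order match the block structure of the Kronecker power. -/
theorem zIndex_mul_add {N k : ℕ} (hN : 2 ≤ N) {u u₀ v v₀ : ℕ} (hu : u < N) (hu₀ : u₀ < N ^ k)
    (hv : v < N) (hv₀ : v₀ < N ^ k) :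
    zIndex N (u * N ^ k + u₀) (v * N ^ k + v₀) =
      (u * N + v) * (N * N) ^ k + zIndex N u₀ v₀ := by
  rw [zIndex, spread_mul_add hN k u u₀ hu₀, spread_mul_add hN k v v₀ hv₀, spread_of_lt hN hu,
    spread_of_lt hN hv, zIndex]
  ring

theorem zIndex_lt {N : ℕ} (hN : 2 ≤ N) (k : ℕ) : ∀ {u v : ℕ}, u < N ^ k → v < N ^ k →
    zIndex N u v < (N * N) ^ k := by
  induction k with
  | zero =>
    intro u v hu hv
    have hu : u = 0 := by simpa using hu
    have hv : v = 0 := by simpa using hv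
    simp [zIndex, spread, hu, hv]
  | succ k ih =>
    intro u v hu hv
    have hpos : 0 < N ^ k := by positivity
    rw [pow_succ] at hu hv
    have hu1 := Nat.div_lt_of_lt_mul hu
    have hv1 := Nat.div_lt_of_lt_mul hv
    have h0 := ih (Nat.mod_lt u hpos) (Nat.mod_lt v hpos)
    rw [← Nat.div_add_mod' u (N ^ k), ← Nat.div_add_mod' v (N ^ k), zIndex_mul_add hN hu1
      (Nat.mod_lt u hpos) hv1 (Nat.mod_lt v hpos), pow_succ']
    have : u / N ^ k * N + v / N ^ k + 1 ≤ N * N := by nlinarith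
    nlinarith

/-- Induction on `k`: a summation index splits into its top digit, where `sum_mmDelta` applies, and
the rest. Thus the Kronecker power of the small tensor is the tensor of `N ^ k × N ^ k` matrices in
interleaved order. -/
theorem sum_mmDeltaPow {N : ℕ} (hN : 2 ≤ N) (k : ℕ) : ∀ {u v : ℕ}, u < N ^ k → v < N ^ k →
    ∀ F : ℕ → ℕ → R,
    ∑ q ∈ range ((N * N) ^ k), ∑ q' ∈ range ((N * N) ^ k),
      (mmDeltaPow N k (zIndex N u v) q q' : R) * F q q' =
      ∑ y ∈ range (N ^ k), F (zIndex N u y) (zIndex N y v) := by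
  induction k with
  | zero =>
    intro u v hu hv F
    have hu : u = 0 := by simpa using hu
    have hv : v = 0 := by simpa using hv
    simp [zIndex, spread, hu, hv, mmDeltaPow]
  | succ k ih =>
    intro u v hu hv F
    have hpos : 0 < N ^ k := by positivity
    rw [pow_succ] at hu hv
    have hu1 := Nat.div_lt_of_lt_mul hu
    have hv1 := Nat.div_lt_of_lt_mul hv
    have hu0 := Nat.mod_lt u hpos
    have hv0 := Nat.mod_lt v hpos
    conv_lhs => rw [← Nat.div_add_mod' u (N ^ k), ← Nat.div_add_mod' v (N ^ k)]
    rw [zIndex_mul_add hN hu1 hu0 hv1 hv0, pow_succ' (N * N), pow_succ' N,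
      sum_range_mul _ (N * N) ((N * N) ^ k), sum_range_mul _ N (N ^ k)]
    have h1 : ∀ y ∈ range N, ∀ y₀ ∈ range (N ^ k),
        F (zIndex N u (y * N ^ k + y₀)) (zIndex N (y * N ^ k + y₀) v) =
        F ((u / N ^ k * N + y) * (N * N) ^ k + zIndex N (u % N ^ k) y₀)
          ((y * N + v / N ^ k) * (N * N) ^ k + zIndex N y₀ (v % N ^ k)) := by
      intro y hy y₀ hy₀
      rw [← zIndex_mul_add hN hu1 hu0 (mem_range.1 hy) (mem_range.1 hy₀),
        ← zIndex_mul_add hN (mem_range.1 hy) (mem_range.1 hy₀) hv1 hv0, Nat.div_add_mod',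
        Nat.div_add_mod']
    rw [Finset.sum_congr rfl fun y hy => Finset.sum_congr rfl fun y₀ hy₀ => h1 y hy y₀ hy₀]
    have h2 := sum_mmDelta hu1 hv1 fun q q' => ∑ y₀ ∈ range (N ^ k),
      F (q * (N * N) ^ k + zIndex N (u % N ^ k) y₀) (q' * (N * N) ^ k + zIndex N y₀ (v % N ^ k))
    rw [← h2]
    refine Finset.sum_congr rfl fun q hq => ?_
    rw [Finset.sum_congr rfl fun q₀ _ => sum_range_mul _ _ _, Finset.sum_comm]
    refine Finset.sum_congr rfl fun q' hq' => ?_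
    rw [← ih hu0 hv0 fun q₀ q₀' => F (q * (N * N) ^ k + q₀) (q' * (N * N) ^ k + q₀'),
      Finset.mul_sum]
    refine Finset.sum_congr rfl fun q₀ hq₀ => ?_
    rw [Finset.mul_sum]
    refine Finset.sum_congr rfl fun q₀' hq₀' => ?_
    have e0 := zIndex_lt hN k hu0 hv0
    rw [mmDeltaPow, mul_add_div_of_lt e0, mul_add_mod_of_lt e0,
      mul_add_div_of_lt (mem_range.1 hq₀), mul_add_mod_of_lt (mem_range.1 hq₀),
      mul_add_div_of_lt (mem_range.1 hq₀'), mul_add_mod_of_lt (mem_range.1 hq₀')]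
    push_cast
    ring

/-- The Kronecker power of a bilinear algorithm multiplies matrices. -/
theorem sum_ker_mul {N r D k : ℕ} (hN : 2 ≤ N) {a b c : ℕ → ℕ}
    (h : ∀ p < N * N, ∀ q < N * N, ∀ q' < N * N,
      ∑ t ∈ range r, (c (p * r + t) : R) * a (t * (N * N) + q) * b (t * (N * N) + q') =
        D * mmDelta N p q q') {u v : ℕ} (hu : u < N ^ k) (hv : v < N ^ k) (X Y : ℕ → ℕ) :
    ∑ t ∈ range (r ^ k), (ker (N * N) r c k (zIndex N u v) t : R) *
      ((∑ q ∈ range ((N * N) ^ k), (ker r (N * N) a k t q : R) * X q) *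
        ∑ q' ∈ range ((N * N) ^ k), (ker r (N * N) b k t q' : R) * Y q') =
      D ^ k * ∑ y ∈ range (N ^ k), (X (zIndex N u y) : R) * Y (zIndex N y v) := by
  rw [← sum_mmDeltaPow hN k hu hv fun q q' => (X q : R) * Y q', Finset.mul_sum]
  simp_rw [Finset.sum_mul_sum, Finset.mul_sum]
  rw [Finset.sum_comm]
  refine Finset.sum_congr rfl fun q hq => ?_
  rw [Finset.sum_comm]
  refine Finset.sum_congr rfl fun q' hq' => ?_
  rw [← mul_assoc, ← sum_ker h k _ (zIndex_lt hN k hu hv) _ (mem_range.1 hq) _ (mem_range.1 hq'),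
    Finset.sum_mul]
  refine Finset.sum_congr rfl fun t _ => ?_
  ring

end

end WordRAM

namespace WordRAM

open Function

/-! ## The program -/

/-- Parameters of the program, and the contents of the arrays that are computed once: `n` vertices
and `M` arcs `src e → dst e`, out-degrees `dg`, the adjacency matrix `adj`, random words `rnd`, and
`h` vertices `hv` of high degree. Matrices have size `N ^ k`; `ca`, `cb`, `cc` are the coefficients
of a bilinear algorithm with `r` multiplications for `N × N` matrices. -/
structure Inst where
  N : ℕ
  r : ℕ
  n : ℕ
  m : ℕ
  K : ℕ
  M : ℕ
  h : ℕ
  k : ℕ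
  L : ℕ
  src : ℕ → ℕ
  dst : ℕ → ℕ
  dg : ℕ → ℕ
  adj : ℕ → ℕ
  rnd : ℕ → ℕ
  hv : ℕ → ℕ
  ca : ℕ → ℕ
  cb : ℕ → ℕ
  cc : ℕ → ℕ

/-- List the vertices with degree in `[lo, hi)`: the array `A` holds their numbers in this list, the
array `B` holds the list, and `aCnt` its length. -/
def selectDeg (lo hi : Expr) (A B : ℕ) : Stmt :=
  .write aCnt (.const 0) (.const 0) ;;
  .loop vx (.var vn) (.ifLt lo (.read aDeg (.var vx) + .const 1)
    (.ifLt (.read aDeg (.var vx)) hi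
      (.write A (.var vx) (.read aCnt (.const 0)) ;;
      .write B (.read aCnt (.const 0)) (.var vx) ;;
      .write aCnt (.const 0) (.read aCnt (.const 0) + .const 1))))

/-- The bucket of vertex `x` under hash function `j`. -/
def bucket (x : Expr) : Expr :=
  .var vj * .var vQ + .read aRnd (x * .var vK + .var vj) % .var vQ

def zIndexExpr (N : ℕ) (u v : Expr) : Expr := .const N * .read aSpr u + .read aSpr v

/-- Mark the buckets of the vertices not dominated by the vertices of high degree. -/
def setA (N : ℕ) : Stmt :=
  .loop vi (.var vh) (.loop vx (.var vn)
    (.ifZero (.read aAdj (.read aLstL (.var vi) * .var vn + .var vx))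
      (.loop vj (.var vK) (.bind vy (bucket (.var vx))
        (.write aA (.var vy / .var vb * (.var vb * .var vb) +
          zIndexExpr N (.var vi) (.var vy % .var vb)) (.const 1))))))

/-- Unmark the buckets of the vertices dominated by the vertices of the current level. -/
def setB (N : ℕ) : Stmt :=
  .loop ve (.var vM) (.ifLt (.var vD) (.read aDeg (.read aSrc (.var ve)) + .const 1)
    (.ifLt (.read aDeg (.read aSrc (.var ve))) (.const 2 * .var vD)
      (.bind vi (.read aIdx (.read aSrc (.var ve)))
        (.loop vj (.var vK) (.bind vy (bucket (.read aDst (.var ve)))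
          (.write aB ((.var vi / .var vb * .var vYb + .var vy / .var vb) * (.var vb * .var vb) +
            zIndexExpr N (.var vy % .var vb) (.var vi % .var vb)) (.const 0)))))))

/-- Apply the Kronecker power of the matrix `C` to a block of the array `A`. -/
def transform (N r C X A : ℕ) (off : Expr) : Stmt :=
  copy X A (.var vb * .var vb) off ;; yates C X r (N * N) (.var vb * .var vb)

/-- Multiply a row of blocks of `aA` with a column of blocks of `aB`, and look for zeros. -/
def block (N r : ℕ) : Stmt :=
  fill aZ (.var vrk) (.const 0) ;;
  .loop vyb (.var vYb)
    (transform N r aCA aX aA (.var vyb * (.var vb * .var vb)) ;;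
    transform N r aCB aY aB ((.var vvb * .var vYb + .var vyb) * (.var vb * .var vb)) ;;
    .loop vS (.var vrk)
      (.write aZ (.var vS) (.read aZ (.var vS) + .read aX (.var vS) * .read aY (.var vS)))) ;;
  yates aCC aZ (N * N) r (.var vrk) ;;
  .loop vx (.var vb) (.ifLt (.var vvb * .var vb + .var vx) (.var vc)
    (.loop vi (.var vh) (.ifZero (.read aZ (zIndexExpr N (.var vi) (.var vx)))
      (.write aFlag (.const 0) (.const 1)))))

/-- Look for dominating pairs with one vertex of high degree and the other one in the level `vD`. -/
def level (N r : ℕ) : Stmt :=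
  .bind vD (.read aD (.const 0)) (.bind vQ (.const 4 * .var vD)
    (selectDeg (.var vD) (.const 2 * .var vD) aIdx aLst ;;
    .bind vc (.read aCnt (.const 0)) (.bind vYb (.var vK * .var vQ / .var vb + .const 1)
      (.bind vVb (.var vc / .var vb + .const 1)
        (fill aA (.var vYb * (.var vb * .var vb)) (.const 0) ;;
        fill aB (.var vVb * (.var vYb * (.var vb * .var vb))) (.const 1) ;;
        setA N ;; setB N ;; .loop vvb (.var vVb) (block N r) ;;
        .write aD (.const 0) (.const 2 * .var vD))))))

namespace Inst

variable (I : Inst)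

/-- The size of the blocks. -/
def b : ℕ := I.N ^ I.k

/-- The variables during the levels. -/
def env : Env := ((((((((Env.empty.bind vn I.n).bind vm I.m).bind vL I.L).bind vK
  I.K).bind vM I.M).bind vh I.h).bind vb I.b).bind vk I.k).bind vrk (I.r ^ I.k)

@[simp] theorem env_vn : I.env vn = some I.n := rfl
@[simp] theorem env_vm : I.env vm = some I.m := rfl
@[simp] theorem env_vK : I.env vK = some I.K := rfl
@[simp] theorem env_vM : I.env vM = some I.M := rfl
@[simp] theorem env_vh : I.env vh = some I.h := rfl
@[simp] theorem env_vb : I.env vb = some I.b := rfl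
@[simp] theorem env_vk : I.env vk = some I.k := rfl
@[simp] theorem env_vrk : I.env vrk = some (I.r ^ I.k) := rfl
@[simp] theorem env_vL : I.env vL = some I.L := rfl
@[simp] theorem env_none {x : ℕ} (h : vL < x) : I.env x = none := by
  simp only [env]
  repeat rw [Env.bind_of_ne _ _ (by omega)]
  rfl

/-- The state contains the arrays that are computed once. -/
structure Has (σ : State) : Prop where
  src : ∀ e < I.M, σ aSrc e = I.src e
  dst : ∀ e < I.M, σ aDst e = I.dst e
  dg : ∀ x < I.n, σ aDeg x = I.dg x
  adj : ∀ u < I.n, ∀ x < I.n, σ aAdj (u * I.n + x) = I.adj (u * I.n + x)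
  rnd : ∀ i < I.n * I.K, σ aRnd i = I.rnd i
  hv : ∀ i < I.h, σ aLstL i = I.hv i
  spr : ∀ x < I.b, σ aSpr x = spread I.N x
  ca : ∀ i < I.r * (I.N * I.N), σ aCA i = I.ca i
  cb : ∀ i < I.r * (I.N * I.N), σ aCB i = I.cb i
  cc : ∀ i < I.N * I.N * I.r, σ aCC i = I.cc i

/-- Conditions on an instance; all arrays and numbers fit. -/
structure Valid {w : ℕ} (M : Machine w) : Prop where
  two_le_N : 2 ≤ I.N
  N_le_r : I.N * I.N ≤ I.r
  one_le_K : 1 ≤ I.K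
  two_le_n : 2 ≤ I.n
  h_le_b : I.h ≤ I.b
  h_le_n : I.h ≤ I.n
  src_lt : ∀ e < I.M, I.src e < I.n
  dst_lt : ∀ e < I.M, I.dst e < I.n
  hv_lt : ∀ i < I.h, I.hv i < I.n
  dg_le : ∀ x < I.n, I.dg x ≤ I.n
  adj_le : ∀ i, I.adj i ≤ 1
  rnd_lt : ∀ i, I.rnd i < 2 ^ w
  fits : (I.n + I.b) * (8 * I.n * I.K + I.b) + (I.r ^ I.k + I.r * (I.N * I.N)) + I.M + I.k + I.L < M.lim

end Inst

/-- The state `τ` agrees with `σ` on all arrays not in `S`. -/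
def Agree (S : List ℕ) (σ τ : State) : Prop := ∀ A, A ∉ S → τ A = σ A

theorem Inst.Has.congr {I : Inst} {σ τ : State} {S : List ℕ} (h : I.Has σ) (hS : Agree S σ τ)
    (h' : S.all fun A => A ∉ [aSrc, aDst, aDeg, aAdj, aRnd, aLstL, aSpr, aCA, aCB, aCC]) :
    I.Has τ := by
  simp only [List.all_eq_true] at h'
  have key : ∀ A ∈ [aSrc, aDst, aDeg, aAdj, aRnd, aLstL, aSpr, aCA, aCB, aCC], τ A = σ A :=
    fun A hA => hS A fun hA' => by simpa [hA] using h' A hA'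
  constructor
  all_goals rw [key _ (by simp)]
  exacts [h.src, h.dst, h.dg, h.adj, h.rnd, h.hv, h.spr, h.ca, h.cb, h.cc]

theorem Agree.trans {S : List ℕ} {σ τ υ : State} (h : Agree S σ τ) (h' : Agree S τ υ) :
    Agree S σ υ := fun A hA => (h' A hA).trans (h A hA)

theorem Agree.mono {S S' : List ℕ} {σ τ : State} (h : Agree S σ τ) (h' : S ⊆ S') :
    Agree S' σ τ := fun A hA => h A fun hA' => hA (h' hA')

theorem Agree.refl (S : List ℕ) (σ : State) : Agree S σ σ := fun _ _ => rfl

theorem agree_set {S : List ℕ} (σ : State) {A : ℕ} (f : ℕ → ℕ) (hA : A ∈ S) :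
    Agree S σ (σ.set A f) := fun _ hB => State.set_of_ne _ _ (by rintro rfl; exact hB hA)

end WordRAM

/-! ### Listing the vertices in a range of degrees -/

namespace WordRAM

open Function

section

variable {w : ℕ} {M : Machine w} {I : Inst} {env : Env} {σ : State} {t : ℕ} {Q : State → Prop}

/-- A listed vertex is numbered by how many listed vertices precede it. So `Nat.count` describes the
numbering, and at `n` also the length of the list. -/
theorem runs_selectDeg {A B a b : ℕ} {lo hi : Expr} (hA : A = aIdx ∧ B = aLst ∨ A = aIdxH ∧ B = aLstL)
    (hn : env vn = some I.n) (hx : env vx = none) (hnl : I.n + 1 < M.lim)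
    (hdg : ∀ x < I.n, σ aDeg x = I.dg x) (hdn : ∀ x < I.n, I.dg x ≤ I.n)
    (hlo : ∀ k τ, lo.ok M (env.bind vx k) τ ∧ lo.eval M (env.bind vx k) τ = a)
    (hhi : ∀ k τ, hi.ok M (env.bind vx k) τ ∧ hi.eval M (env.bind vx k) τ = b)
    (ha : a < 2 ^ w) (hb : b < 2 ^ w)
    (ht : I.n * (lo.len + hi.len + 90) + 20 ≤ t)
    (hQ : ∀ σ', Agree [A, B, aCnt] σ σ' →
      σ' aCnt 0 = Nat.count (fun x => a ≤ I.dg x ∧ I.dg x < b) I.n →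
      (∀ x < I.n, a ≤ I.dg x ∧ I.dg x < b →
        σ' A x = Nat.count (fun x => a ≤ I.dg x ∧ I.dg x < b) x ∧
        σ' B (Nat.count (fun x => a ≤ I.dg x ∧ I.dg x < b) x) = x) → Q σ') :
    Runs M (selectDeg lo hi A B) env σ t Q := by
  set p : ℕ → Prop := fun x => a ≤ I.dg x ∧ I.dg x < b with hp
  have hA1 : 0 < A ∧ A < numArrays := by rcases hA with ⟨rfl, -⟩ | ⟨rfl, -⟩ <;> decide
  have hB1 : 0 < B ∧ B < numArrays := by rcases hA with ⟨-, rfl⟩ | ⟨-, rfl⟩ <;> decide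
  have hAB : A ≠ B := by rcases hA with ⟨rfl, rfl⟩ | ⟨rfl, rfl⟩ <;> decide
  have hAc : A ≠ aCnt := by rcases hA with ⟨rfl, rfl⟩ | ⟨rfl, rfl⟩ <;> decide
  have hBc : B ≠ aCnt := by rcases hA with ⟨rfl, rfl⟩ | ⟨rfl, rfl⟩ <;> decide
  have hAd : aDeg ∉ [A, B, aCnt] := by rcases hA with ⟨rfl, rfl⟩ | ⟨rfl, rfl⟩ <;> decide
  refine (Runs.seq (Q := fun σ' => σ' = σ.set aCnt (update (σ aCnt) 0 0)) (Runs.write (by decide)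
    (by simp) (by simp) (by simp; omega) (by simp)) (t' := I.n * (lo.len + hi.len + 90) + 7)
    (R := Q) ?_).mono (by simp; omega) (fun _ h => h)
  rintro _ rfl
  refine (Runs.loop (t := lo.len + hi.len + 86) (fun k σ' => Agree [A, B, aCnt] σ σ' ∧
    σ' aCnt 0 = Nat.count p k ∧
    ∀ x < k, p x → σ' A x = Nat.count p x ∧ σ' B (Nat.count p x) = x) hx (by simp [hn])
    (by simpa [hn] using M.lt_two_pow (by omega)) ?_ ?_).mono (by simp [hn]) ?_
  · exact ⟨agree_set _ _ (by simp), by simp, by simp⟩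
  · simp only [Expr.eval_var, hn, Option.getD_some]
    rintro x hxn σ' ⟨h1, h2, h3⟩
    have hdgx : σ' aDeg x = I.dg x := (congrFun (h1 _ hAd) x).trans (hdg x hxn)
    have hdn' := hdn x hxn
    have hcl : Nat.count p x ≤ x := Nat.count_le p
    obtain ⟨lo1, lo2⟩ := hlo x σ'
    obtain ⟨hi1, hi2⟩ := hhi x σ'
    have hno : ¬ p x → Agree [A, B, aCnt] σ σ' ∧ σ' aCnt 0 = Nat.count p (x + 1) ∧
        ∀ y < x + 1, p y → σ' A y = Nat.count p y ∧ σ' B (Nat.count p y) = y := by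
      intro hpx
      refine ⟨h1, by rw [h2, Nat.count_succ, if_neg hpx, add_zero], fun y hy hpy => h3 y ?_ hpy⟩
      have : y ≠ x := by rintro rfl; exact hpx hpy
      omega
    refine (Runs.ifLt (t := hi.len + 70) lo1 (by simp [numArrays]; omega) (by omega) ?_ (fun hlt => ?_)
      (fun hlt => hno ?_)).mono (by simp; omega) (fun _ h => h)
    · simp [hdgx]
      exact M.lt_two_pow (by omega)
    · simp only [lo2, Expr.eval_add, Expr.eval_read, Expr.eval_var, Env.bind_self,
        Option.getD_some, hdgx, Expr.eval_const] at hlt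
      refine (Runs.ifLt (t := 56) (by simp [numArrays]; omega) hi1 ?_ (by omega) (fun hlt' => ?_)
        (fun hlt' => hno ?_)).mono (by simp; omega) (fun _ h => h)
      · simp [hdgx]
        exact M.lt_two_pow (by omega)
      · simp only [hi2, Expr.eval_read, Expr.eval_var, Env.bind_self, Option.getD_some, hdgx] at hlt'
        have hpx : p x := ⟨by omega, hlt'⟩
        refine (Runs.seq (Q := fun τ => τ = σ'.set A (update (σ' A) x (Nat.count p x)))
          (Runs.write hA1 (by simp) (by simp [numArrays]; omega) (by simp; omega) (by simp [h2]))
          (t' := 40) (R := _) ?_).mono (by simp) (fun _ h => h)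
        rintro _ rfl
        refine (Runs.seq (Q := fun τ => τ = (σ'.set A (update (σ' A) x (Nat.count p x))).set B
          (update (σ' B) (Nat.count p x) x))
          (Runs.write hB1 (by simp [numArrays]; omega) (by simp) ?_ ?_)
          (t' := 22) (R := _) ?_).mono (by simp) (fun _ h => h)
        · simp [hAc.symm, h2]; omega
        · simp [hAc.symm, h2, hAB.symm]
        rintro _ rfl
        refine (Runs.write (by decide) (by simp) (by simp [numArrays]; omega) (by simp; omega)
          ?_).mono (by simp) (fun _ h => h)
        refine ⟨?_, ?_, fun y hy hpy => ?_⟩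
        · refine Agree.trans (Agree.trans (Agree.trans h1 (agree_set _ _ ?_)) (agree_set _ _ ?_))
            (agree_set _ _ ?_) <;> simp
        · simp [hAc.symm, hBc.symm, h2, Nat.count_succ, hpx]
        · rcases Nat.lt_succ_iff_lt_or_eq.1 hy with hy | rfl
          · have h4 : Nat.count p y < Nat.count p x := Nat.count_strict_mono hpy hy
            simpa [hAc, hBc, hAB, h4.ne, hy.ne] using h3 y hy hpy
          · simp [hAc, hBc, hAB]
      · rintro ⟨-, h5⟩
        simp [hi2, hdgx] at hlt'
        omega
    · rintro ⟨h5, -⟩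
      simp [lo2, hdgx] at hlt
      omega
  · simp only [Expr.eval_var, hn, Option.getD_some]
    rintro σ' ⟨h1, h2, h3⟩
    exact hQ σ' h1 h2 h3

end

end WordRAM

/-! ### The two matrices of a level -/

namespace WordRAM

open Function

namespace Inst

variable (I : Inst) (lev D c : ℕ)

/-- Number of blocks of buckets. -/
def Yb : ℕ := I.K * (4 * D) / I.b + 1

/-- Number of blocks of `c` vertices. -/
def Vb : ℕ := c / I.b + 1

/-- The variables within a level. -/
def lenv : Env := ((((((I.env.bind vlev lev).bind vD D).bind vQ (4 * D)).bind vc c).bind vYb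
  (I.Yb D)).bind vVb (I.Vb c))

@[simp] theorem lenv_vn : I.lenv lev D c vn = some I.n := rfl
@[simp] theorem lenv_vK : I.lenv lev D c vK = some I.K := rfl
@[simp] theorem lenv_vM : I.lenv lev D c vM = some I.M := rfl
@[simp] theorem lenv_vh : I.lenv lev D c vh = some I.h := rfl
@[simp] theorem lenv_vb : I.lenv lev D c vb = some I.b := rfl
@[simp] theorem lenv_vk : I.lenv lev D c vk = some I.k := rfl
@[simp] theorem lenv_vrk : I.lenv lev D c vrk = some (I.r ^ I.k) := rfl
@[simp] theorem lenv_vD : I.lenv lev D c vD = some D := rfl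
@[simp] theorem lenv_vQ : I.lenv lev D c vQ = some (4 * D) := rfl
@[simp] theorem lenv_vc : I.lenv lev D c vc = some c := rfl
@[simp] theorem lenv_vYb : I.lenv lev D c vYb = some (I.Yb D) := rfl
@[simp] theorem lenv_vVb : I.lenv lev D c vVb = some (I.Vb c) := rfl
@[simp] theorem lenv_none {x : ℕ} (h : vVb < x) : I.lenv lev D c x = none := by
  simp only [lenv]
  repeat rw [Env.bind_of_ne _ _ (by omega)]
  exact I.env_none (by omega)

/-- The bucket of `x` under the hash function `j`. -/
def bkt (x j : ℕ) : ℕ := j * (4 * D) + I.rnd (x * I.K + j) % (4 * D)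

/-- The position of the entry `(i, y)` in `aA`. -/
def posA (i y : ℕ) : ℕ := y / I.b * (I.b * I.b) + zIndex I.N i (y % I.b)

/-- The position of the entry `(y, i)` in `aB`. -/
def posB (y i : ℕ) : ℕ :=
  (i / I.b * I.Yb D + y / I.b) * (I.b * I.b) + zIndex I.N (y % I.b) (i % I.b)

end Inst

namespace Inst.Valid

variable {w : ℕ} {M : Machine w} {I : Inst}

theorem b_pos (hI : I.Valid M) : 0 < I.b := Nat.pow_pos (by have := hI.two_le_N; omega)

theorem zIndex_lt (hI : I.Valid M) {u v : ℕ} (hu : u < I.b) (hv : v < I.b) : zIndex I.N u v < I.b * I.b := by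
  have := WordRAM.zIndex_lt hI.two_le_N I.k hu hv
  rwa [mul_pow] at this

theorem Yb_mul_le (_ : I.Valid M) {D : ℕ} (hD : D ≤ 2 * I.n) : I.Yb D * I.b ≤ 8 * I.n * I.K + I.b := by
  rw [Inst.Yb, Nat.succ_mul]
  have h1 := Nat.div_mul_le_self (I.K * (4 * D)) I.b
  have h2 : I.K * (4 * D) ≤ I.K * (4 * (2 * I.n)) := by gcongr
  have h3 : I.K * (4 * (2 * I.n)) = 8 * I.n * I.K := by ring
  omega

theorem Vb_mul_le (_ : I.Valid M) {c : ℕ} (hc : c ≤ I.n) : I.Vb c * I.b ≤ I.n + I.b := by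
  rw [Inst.Vb, Nat.succ_mul]
  have h1 := Nat.div_mul_le_self c I.b
  omega

theorem VY_le (hI : I.Valid M) {D c : ℕ} (hD : D ≤ 2 * I.n) (hc : c ≤ I.n) :
    I.Vb c * (I.Yb D * (I.b * I.b)) ≤ (I.n + I.b) * (8 * I.n * I.K + I.b) := by
  have := Nat.mul_le_mul (hI.Vb_mul_le hc) (hI.Yb_mul_le hD)
  calc _ = (I.Vb c * I.b) * (I.Yb D * I.b) := by ring
    _ ≤ _ := this

theorem Y_le (hI : I.Valid M) {D : ℕ} (hD : D ≤ 2 * I.n) :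
    I.Yb D * (I.b * I.b) ≤ (I.n + I.b) * (8 * I.n * I.K + I.b) := by
  have := hI.VY_le hD (Nat.zero_le I.n)
  simpa [Inst.Vb] using this

theorem bb_le (_ : I.Valid M) : I.b * I.b ≤ (I.n + I.b) * (8 * I.n * I.K + I.b) :=
  Nat.mul_le_mul (by omega) (by omega)

theorem nn_le (hI : I.Valid M) : I.n * I.n ≤ (I.n + I.b) * (8 * I.n * I.K + I.b) := by
  refine Nat.mul_le_mul (by omega) ?_
  have : I.n * 1 ≤ I.n * I.K := Nat.mul_le_mul_left _ hI.one_le_K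
  nlinarith

theorem nK_le (hI : I.Valid M) : 8 * I.n * I.K ≤ (I.n + I.b) * (8 * I.n * I.K + I.b) := by
  have : 1 * (8 * I.n * I.K + I.b) ≤ (I.n + I.b) * (8 * I.n * I.K + I.b) :=
    Nat.mul_le_mul_right _ (by have := hI.b_pos; omega)
  omega

theorem n_lt (hI : I.Valid M) : I.n < I.n * I.n := by
  have := hI.two_le_n
  nlinarith

theorem KQ_le (_ : I.Valid M) {D : ℕ} (hD : D ≤ 2 * I.n) : I.K * (4 * D) ≤ 8 * I.n * I.K := by
  have h2 : I.K * (4 * D) ≤ I.K * (4 * (2 * I.n)) := by gcongr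
  have h3 : I.K * (4 * (2 * I.n)) = 8 * I.n * I.K := by ring
  omega

theorem bkt_lt (_ : I.Valid M) {D x j : ℕ} (hD : 0 < D) (hj : j < I.K) : I.bkt D x j < I.K * (4 * D) := by
  have : I.rnd (x * I.K + j) % (4 * D) < 4 * D := Nat.mod_lt _ (by omega)
  rw [Inst.bkt]
  nlinarith

theorem posA_lt (hI : I.Valid M) {D i y : ℕ} (hi : i < I.b) (hy : y < I.K * (4 * D)) :
    I.posA i y < I.Yb D * (I.b * I.b) := by
  have h1 := hI.zIndex_lt hi (Nat.mod_lt y hI.b_pos)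
  have h2 : y / I.b + 1 ≤ I.Yb D := Nat.succ_le_succ (Nat.div_le_div_right hy.le)
  have h3 := Nat.mul_le_mul_right (I.b * I.b) h2
  rw [Inst.posA]
  linarith

theorem posB_lt (hI : I.Valid M) {D c i y : ℕ} (hi : i < c) (hy : y < I.K * (4 * D)) :
    I.posB D y i < I.Vb c * (I.Yb D * (I.b * I.b)) := by
  have h1 := hI.zIndex_lt (Nat.mod_lt y hI.b_pos) (Nat.mod_lt i hI.b_pos)
  have h2 : y / I.b + 1 ≤ I.Yb D := Nat.succ_le_succ (Nat.div_le_div_right hy.le)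
  have h4 : i / I.b + 1 ≤ I.Vb c := Nat.succ_le_succ (Nat.div_le_div_right hi.le)
  have h5 := Nat.mul_le_mul_right (I.Yb D) h4
  have h3 : i / I.b * I.Yb D + y / I.b + 1 ≤ I.Vb c * I.Yb D := by linarith
  have h6 := Nat.mul_le_mul_right (I.b * I.b) h3
  rw [Inst.posB]
  linarith

end Inst.Valid

section

variable {w : ℕ} {M : Machine w} {I : Inst} {σ : State} {t : ℕ} {Q : State → Prop} {lev D c : ℕ}

/-- A cell may be marked many times, but always with `1`, so only the set of marked cells has to be
known. The cost is `h * n * K`, and `h * n` is of the order of the number of arcs. -/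
theorem runs_setA (hI : I.Valid M) (hσ : I.Has σ) (hD0 : 0 < D) (hD : D ≤ 2 * I.n)
    (ht : I.h * (I.n * (I.K * 110 + 40) + 20) + 20 ≤ t)
    (hQ : Q (σ.set aA (setOn (fun p => ∃ i < I.h, ∃ x < I.n, I.adj (I.hv i * I.n + x) = 0 ∧
      ∃ j < I.K, p = I.posA i (I.bkt D x j)) (fun _ => 1) (σ aA)))) :
    Runs M (setA I.N) (I.lenv lev D c) σ t Q := by
  have hfit := hI.fits
  have hbb := hI.bb_le
  have hnn := hI.nn_le
  have hnK := hI.nK_le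
  have hYb := hI.Y_le hD
  have hKQ := hI.KQ_le hD
  have hn := hI.n_lt
  have hb0 := hI.b_pos
  have hw : M.lim ≤ 2 ^ w := le_of_not_gt fun h => lt_irrefl _ (M.lt_two_pow h)
  have hK1 := hI.one_le_K
  have hnK' : I.n * I.K ≤ 8 * I.n * I.K := Nat.mul_le_mul_right _ (by omega)
  have hKn : I.K * 1 ≤ I.K * (4 * D) := Nat.mul_le_mul_left _ (by omega)
  have h4D : 1 * (4 * D) ≤ I.K * (4 * D) := Nat.mul_le_mul_right _ hK1
  have hbb' : I.b * 1 ≤ I.b * I.b := Nat.mul_le_mul_left _ hb0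
  refine Sets.runs (P := fun p => ∃ i < I.h, ∃ x < I.n, I.adj (I.hv i * I.n + x) = 0 ∧
      ∃ j < I.K, p = I.posA i (I.bkt D x j)) (v := fun _ => 1)
      (t := I.h * (I.n * ((23 + (I.K * (100 + 4) + 7)) + 4) + 7 + 4) + 7) ?_ ?_ hQ
  · refine Sets.loop (by simp) (by simp) (by simp) (by have := hI.h_le_n; omega)
      fun i hi g _ => ?_
    have hib : i < I.b := lt_of_lt_of_le hi hI.h_le_b
    have hin : i < I.n := lt_of_lt_of_le hi hI.h_le_n
    refine Sets.loop (by simp) (by simp) (by simp) (by omega) fun x hx g' _ => ?_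
    have hhv := hI.hv_lt i hi
    have hpos : I.hv i * I.n + x < I.n * I.n := by nlinarith
    -- The test is for divisibility by `2 ^ w`; it is exact because the entry is at most `1`.
    have hadj : (I.adj (I.hv i * I.n + x) = 0 ↔ 2 ^ w ∣ I.adj (I.hv i * I.n + x)) := by
      refine ⟨fun h => by rw [h]; exact dvd_zero _, fun h => ?_⟩
      have := hI.adj_le (I.hv i * I.n + x)
      by_contra h0
      have h1 := Nat.le_of_dvd (by omega) h
      omega
    have hev : Expr.eval M (((I.lenv lev D c).bind vi i).bind vx x) (σ.set aA g')
        (.read aAdj (.read aLstL (.var vi) * .var vn + .var vx)) = I.adj (I.hv i * I.n + x) := by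
      simp [hσ.hv i hi, hσ.adj _ hhv x hx]
    refine (Sets.ifZero (t := I.K * (100 + 4) + 7)
      (P := fun p => ∃ j < I.K, p = I.posA i (I.bkt D x j)) ?_ fun _ => ?_).mono
      (by simp) (fun p => by rw [hev, hadj]) (fun _ _ => rfl)
    · simp [numArrays, hσ.hv i hi]; omega
    refine Sets.loop (t := 100) (by simp) (by simp) (by simp) (by omega) fun j hj g'' _ => ?_
    have hxj : x * I.K + j < I.n * I.K := by nlinarith
    have hbk := hI.bkt_lt (x := x) hD0 hj
    have hpA := hI.posA_lt hib hbk
    have hrnd := hI.rnd_lt (x * I.K + j)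
    have hmod : I.bkt D x j % I.b < I.b := Nat.mod_lt _ hb0
    have hb : Expr.eval M ((((I.lenv lev D c).bind vi i).bind vx x).bind vj j) (σ.set aA g'')
        (bucket (.var vx)) = I.bkt D x j := by
      simp [bucket, hσ.rnd _ hxj, Inst.bkt]
    refine (Sets.bind (t := 70) (P := (· = I.posA i (I.bkt D x j))) (by simp) ?_ ?_).mono
      (by simp [bucket]) (fun _ => Iff.rfl) (fun _ _ => rfl)
    · simp [bucket, numArrays, hσ.rnd _ hxj]; omega
    rw [hb]
    have hp : Expr.eval M (((((I.lenv lev D c).bind vi i).bind vx x).bind vj j).bind vy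
        (I.bkt D x j)) (σ.set aA g'') (.var vy / .var vb * (.var vb * .var vb) +
          zIndexExpr I.N (.var vi) (.var vy % .var vb)) = I.posA i (I.bkt D x j) := by
      simp [zIndexExpr, hσ.spr i hib, hσ.spr _ hmod, Inst.posA, zIndex]
    refine (Sets.write (by decide) ?_ (by simp) ?_ (by simp)).mono (by simp [zIndexExpr])
      (fun p => by rw [hp]) (fun _ _ => rfl)
    · simp [zIndexExpr, numArrays]; omega
    · rw [hp]; omega
  · refine le_trans ?_ ht
    have : I.n * ((23 + (I.K * (100 + 4) + 7)) + 4) + 7 + 4 ≤ I.n * (I.K * 110 + 40) + 20 := by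
      have : I.n * ((23 + (I.K * (100 + 4) + 7)) + 4) ≤ I.n * (I.K * 110 + 40) :=
        Nat.mul_le_mul_left _ (by omega)
      omega
    have := Nat.mul_le_mul_left I.h this
    omega

-- The arcs are scanned rather than pairs of vertices, so the cost is of order `M * K`. Of the
-- numbering `idx` only the bound by `c` is needed here; injectivity enters in `Inst.pass_iff`.
set_option maxHeartbeats 1000000 in
theorem runs_setB (hI : I.Valid M) (hσ : I.Has σ) (hD0 : 0 < D) (hD : D ≤ 2 * I.n)
    {idx : ℕ → ℕ} (hc : c ≤ I.n)
    (hidx : ∀ x < I.n, D ≤ I.dg x ∧ I.dg x < 2 * D → σ aIdx x = idx x ∧ idx x < c)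
    (ht : I.M * (I.K * 120 + 80) + 20 ≤ t)
    (hQ : Q (σ.set aB (setOn (fun p => ∃ e < I.M, (D ≤ I.dg (I.src e) ∧ I.dg (I.src e) < 2 * D) ∧
      ∃ j < I.K, p = I.posB D (I.bkt D (I.dst e) j) (idx (I.src e))) (fun _ => 0) (σ aB)))) :
    Runs M (setB I.N) (I.lenv lev D c) σ t Q := by
  have hfit := hI.fits
  have hbb := hI.bb_le
  have hnn := hI.nn_le
  have hnK := hI.nK_le
  have hVY := hI.VY_le hD hc
  have hKQ := hI.KQ_le hD
  have hn := hI.n_lt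
  have hb0 := hI.b_pos
  have hw : M.lim ≤ 2 ^ w := le_of_not_gt fun h => lt_irrefl _ (M.lt_two_pow h)
  have hK1 := hI.one_le_K
  have hnK' : I.n * I.K ≤ 8 * I.n * I.K := Nat.mul_le_mul_right _ (by omega)
  have hKn : I.K * 1 ≤ I.K * (4 * D) := Nat.mul_le_mul_left _ (by omega)
  have h4D : 1 * (4 * D) ≤ I.K * (4 * D) := Nat.mul_le_mul_right _ hK1
  have hbb' : I.b * 1 ≤ I.b * I.b := Nat.mul_le_mul_left _ hb0
  refine Sets.runs (P := fun p => ∃ e < I.M, (D ≤ I.dg (I.src e) ∧ I.dg (I.src e) < 2 * D) ∧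
      ∃ j < I.K, p = I.posB D (I.bkt D (I.dst e) j) (idx (I.src e))) (v := fun _ => 0)
      (t := I.M * (I.K * (114 + 4) + 74 + 4) + 7) ?_ ?_ hQ
  · refine Sets.loop (by simp) (by simp) (by simp) (by omega) fun e he g _ => ?_
    have hs := hI.src_lt e he
    have hd := hI.dst_lt e he
    have hdg := hI.dg_le _ hs
    refine (Sets.ifLt (P := fun p => I.dg (I.src e) < 2 * D ∧ ∃ j < I.K,
      p = I.posB D (I.bkt D (I.dst e) j) (idx (I.src e))) (t := I.K * (114 + 4) + 48) (by simp) ?_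
      (by simp; omega) ?_ fun h1 => ?_).mono (by simp; omega) (fun p => ?_) (fun _ _ => rfl)
    · simp [numArrays, hσ.src e he]; omega
    · simp [hσ.src e he, hσ.dg _ hs]; omega
    · have h1' : D ≤ I.dg (I.src e) := by
        simp [hσ.src e he, hσ.dg _ hs] at h1; omega
      refine (Sets.ifLt (P := fun p => ∃ j < I.K,
        p = I.posB D (I.bkt D (I.dst e) j) (idx (I.src e))) (t := I.K * (114 + 4) + 24) ?_ (by simp)
        ?_ (by simp; omega) fun h2 => ?_).mono (by simp; omega) (fun p => ?_) (fun _ _ => rfl)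
      · simp [numArrays, hσ.src e he]; omega
      · simp [hσ.src e he, hσ.dg _ hs]; omega
      · have h2' : I.dg (I.src e) < 2 * D := by simpa [hσ.src e he, hσ.dg _ hs] using h2
        obtain ⟨hx1, hx2⟩ := hidx _ hs ⟨h1', h2'⟩
        have hev : Expr.eval M ((I.lenv lev D c).bind ve e) (σ.set aB g)
            (.read aIdx (.read aSrc (.var ve))) = idx (I.src e) := by
          simp [hσ.src e he, hx1]
        refine (Sets.bind (t := I.K * (114 + 4) + 7) (P := fun p => ∃ j < I.K,
          p = I.posB D (I.bkt D (I.dst e) j) (idx (I.src e))) (by simp) ?_ ?_).mono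
          (by simp; omega) (fun _ => Iff.rfl) (fun _ _ => rfl)
        · simp [numArrays, hσ.src e he]; omega
        rw [hev]
        refine Sets.loop (t := 114) (by simp) (by simp) (by simp) (by omega) fun j hj g'' _ => ?_
        have hxj : I.dst e * I.K + j < I.n * I.K := by nlinarith
        have hbk := hI.bkt_lt (x := I.dst e) hD0 hj
        have hpB := hI.posB_lt hx2 hbk
        have hrnd := hI.rnd_lt (I.dst e * I.K + j)
        have hmod : I.bkt D (I.dst e) j % I.b < I.b := Nat.mod_lt _ hb0
        have hmod' : idx (I.src e) % I.b < I.b := Nat.mod_lt _ hb0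
        have hb : Expr.eval M ((((I.lenv lev D c).bind ve e).bind vi (idx (I.src e))).bind vj j)
            (σ.set aB g'') (bucket (.read aDst (.var ve))) = I.bkt D (I.dst e) j := by
          simp [bucket, hσ.dst e he, hσ.rnd _ hxj, Inst.bkt]
        refine (Sets.bind (t := 82) (P := (· = I.posB D (I.bkt D (I.dst e) j) (idx (I.src e))))
          (by simp) ?_ ?_).mono (by simp [bucket]) (fun _ => Iff.rfl) (fun _ _ => rfl)
        · simp [bucket, numArrays, hσ.dst e he, hσ.rnd _ hxj]; omega
        rw [hb]
        have hp : Expr.eval M (((((I.lenv lev D c).bind ve e).bind vi (idx (I.src e))).bind vj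
            j).bind vy (I.bkt D (I.dst e) j)) (σ.set aB g'')
            ((.var vi / .var vb * .var vYb + .var vy / .var vb) * (.var vb * .var vb) +
            zIndexExpr I.N (.var vy % .var vb) (.var vi % .var vb)) =
            I.posB D (I.bkt D (I.dst e) j) (idx (I.src e)) := by
          simp [zIndexExpr, hσ.spr _ hmod', hσ.spr _ hmod, Inst.posB, zIndex]
        refine (Sets.write (by decide) ?_ (by simp) ?_ (by simp)).mono (by simp [zIndexExpr])
          (fun p => by rw [hp]) (fun _ _ => rfl)
        · simp [zIndexExpr, numArrays]; omega
        · rw [hp]; omega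
      · simp [hσ.src e he, hσ.dg _ hs]
    · have : D < I.dg (I.src e) + 1 ↔ D ≤ I.dg (I.src e) := Nat.lt_succ_iff
      simp [hσ.src e he, hσ.dg _ hs, this, and_assoc]
  · refine le_trans ?_ ht
    have := Nat.mul_le_mul_left I.M
      (show I.K * (114 + 4) + 74 + 4 ≤ I.K * 120 + 80 by omega)
    omega

end

end WordRAM

/-! ### Transforming a block -/

namespace WordRAM

open Function

theorem zIndex_eq {N : ℕ} (hN : 2 ≤ N) (u v : ℕ) : zIndex N u v =
    zIndex N (u / N) (v / N) * (N * N) + (u % N * N + v % N) := by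
  rw [zIndex, zIndex, spread_eq hN u, spread_eq hN v]
  ring

theorem zIndex_inj {N : ℕ} (hN : 2 ≤ N) (k : ℕ) : ∀ {u v u' v' : ℕ}, u < N ^ k → v < N ^ k →
    u' < N ^ k → v' < N ^ k → zIndex N u v = zIndex N u' v' → u = u' ∧ v = v' := by
  induction k with
  | zero =>
    intro u v u' v' h1 h2 h3 h4 _
    simp only [pow_zero] at h1 h2 h3 h4
    omega
  | succ k ih =>
    intro u v u' v' h1 h2 h3 h4 h
    have hN0 : 0 < N := by omega
    rw [zIndex_eq hN, zIndex_eq hN u'] at h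
    have lt : ∀ x y, x % N * N + y % N < N * N := fun x y => by
      have := Nat.mod_lt x hN0
      have := Nat.mod_lt y hN0
      nlinarith
    have e1 := congrArg (· / (N * N)) h
    have e2 := congrArg (· % (N * N)) h
    simp only [mul_add_div_of_lt (lt _ _), mul_add_mod_of_lt (lt _ _)] at e1 e2
    have dl : ∀ {x}, x < N ^ (k + 1) → x / N < N ^ k := fun {x} hx =>
      Nat.div_lt_of_lt_mul (by rwa [pow_succ, mul_comm] at hx)
    obtain ⟨e3, e4⟩ := ih (dl h1) (dl h2) (dl h3) (dl h4) e1
    have e5 := congrArg (· / N) e2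
    have e6 := congrArg (· % N) e2
    simp only [mul_add_div_of_lt (Nat.mod_lt _ hN0), mul_add_mod_of_lt (Nat.mod_lt _ hN0)] at e5 e6
    rw [← Nat.div_add_mod u N, ← Nat.div_add_mod v N, ← Nat.div_add_mod u' N,
      ← Nat.div_add_mod v' N, e3, e4, e5, e6]
    exact ⟨rfl, rfl⟩

namespace Inst

variable (I : Inst)

/-- A bound on the size of the arrays for `yates`. -/
def yl : ℕ := I.r ^ I.k + I.r * (I.N * I.N)

/-- A bound on the cost of `yates`. -/
def yc : ℕ := 20 + I.k * (2 * I.yl * (60 * I.r + 100) + 104)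

/-- The entry `t` of the transform of a block. -/
def hat (c a : ℕ → ℕ) (o t : ℕ) : ℕ :=
  ∑ η ∈ Finset.range ((I.N * I.N) ^ I.k), ker I.r (I.N * I.N) c I.k t η * a (o + η)

/-- The entry `p` of the sum of `m` products of blocks. -/
def prodSum (σ : State) (m : ℕ) (o o' : ℕ → ℕ) (p : ℕ) : ℕ :=
  ∑ t ∈ Finset.range (I.r ^ I.k), ker (I.N * I.N) I.r (σ aCC) I.k p t *
    ∑ y ∈ Finset.range m, I.hat (σ aCA) (σ aA) (o y) t * I.hat (σ aCB) (σ aB) (o' y) t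

end Inst

section

variable {w : ℕ} {M : Machine w} {I : Inst} {env : Env} {σ : State} {t : ℕ} {Q : State → Prop}
  {lev D c : ℕ}

theorem Inst.Valid.r_pos (hI : I.Valid M) : 0 < I.r := by
  have := hI.two_le_N
  have := hI.N_le_r
  nlinarith

theorem Inst.Valid.bb_eq (_ : I.Valid M) : I.b * I.b = (I.N * I.N) ^ I.k := by
  rw [mul_pow]; rfl

theorem Inst.Valid.bb_le_rk (hI : I.Valid M) : I.b * I.b ≤ I.r ^ I.k := by
  rw [hI.bb_eq]
  exact Nat.pow_le_pow_left hI.N_le_r _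

theorem Inst.Valid.r_le_yl (hI : I.Valid M) : I.r * (I.N * I.N) ≤ I.yl ∧ I.r ≤ I.yl ∧
    I.N * I.N ≤ I.yl ∧ 4 ≤ I.N * I.N := by
  have h1 := hI.two_le_N
  have h2 : 4 ≤ I.N * I.N := by nlinarith
  have h3 : I.r * 1 ≤ I.r * (I.N * I.N) := Nat.mul_le_mul_left _ (by omega)
  have h4 := hI.N_le_r
  have h5 : I.r * (I.N * I.N) ≤ I.yl := Nat.le_add_left _ _
  exact ⟨h5, by omega, by omega, h2⟩

theorem Inst.Valid.yl_lt (hI : I.Valid M) : I.yl < M.lim ∧ I.k < M.lim := by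
  have := hI.fits
  rw [Inst.yl]
  omega

/-- The two alternatives in `hX` treat the left and the right factor at once. A block is contiguous
and in interleaved order, so its copy can be fed to `yates` as it stands. -/
theorem runs_transform {A X C o : ℕ} {off : Expr} (hI : I.Valid M)
    (hX : A = aA ∧ X = aX ∧ C = aCA ∨ A = aB ∧ X = aY ∧ C = aCB)
    (hb : env vb = some I.b) (hk : env vk = some I.k)
    (hfree : ∀ x, vVb < x → x ≠ vvb → x ≠ vyb → env x = none)
    (h3 : ∀ k τ, off.ok M (env.bind vS k) τ) (h4 : ∀ k τ, off.eval M (env.bind vS k) τ = o)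
    (ho : o + I.b * I.b ≤ M.lim)
    (ht : I.r ^ I.k * (off.len + 21) + I.yc + 10 ≤ t)
    (hQ : ∀ σ', Agree [X, aT, aL] σ σ' → (∀ i < I.r ^ I.k, σ' X i = I.hat (σ C) (σ A) o i) → Q σ') :
    Runs M (transform I.N I.r C X A off) env σ t Q := by
  have hA1 : 0 < A ∧ A < numArrays := by rcases hX with ⟨rfl, -, -⟩ | ⟨rfl, -, -⟩ <;> decide
  have hX1 : 0 < X ∧ X < numArrays := by rcases hX with ⟨-, rfl, -⟩ | ⟨-, rfl, -⟩ <;> decide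
  have hC1 : 0 < C ∧ C < numArrays := by rcases hX with ⟨-, -, rfl⟩ | ⟨-, -, rfl⟩ <;> decide
  have hAX : A ≠ X := by rcases hX with ⟨rfl, rfl, -⟩ | ⟨rfl, rfl, -⟩ <;> decide
  have hCX : C ≠ X := by rcases hX with ⟨-, rfl, rfl⟩ | ⟨-, rfl, rfl⟩ <;> decide
  have hCT : C ≠ aT := by rcases hX with ⟨-, -, rfl⟩ | ⟨-, -, rfl⟩ <;> decide
  have hCL : C ≠ aL := by rcases hX with ⟨-, -, rfl⟩ | ⟨-, -, rfl⟩ <;> decide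
  have hXT : X ≠ aT := by rcases hX with ⟨-, rfl, -⟩ | ⟨-, rfl, -⟩ <;> decide
  have hXL : X ≠ aL := by rcases hX with ⟨-, rfl, -⟩ | ⟨-, rfl, -⟩ <;> decide
  obtain ⟨y1, y2, y3, y4⟩ := hI.r_le_yl
  obtain ⟨y5, y6⟩ := hI.yl_lt
  have hrk := hI.bb_le_rk
  have hrk' : I.r ^ I.k ≤ I.yl := Nat.le_add_right _ _
  have hw : M.lim ≤ 2 ^ w := le_of_not_gt fun h => lt_irrefl _ (M.lt_two_pow h)
  have f : ∀ x, vVb < x → x ≠ vvb → x ≠ vyb → env x = none := hfree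
  have hbb : Expr.eval M env σ (.var vb * .var vb) = I.b * I.b := by simp [hb]
  refine (Runs.seq (t' := I.yc) (R := Q) (runs_copy (N := I.b * I.b) (o := o) hX1 hA1 hAX
    (f _ (by decide) (by decide) (by decide)) (by simp [hb])
    hbb (by omega) (by omega) (fun _ _ => h3 _ _) (fun _ _ => h4 _ _) ho le_rfl
    (Q := (· = σ.set X (setOn (· < I.b * I.b) (fun i => σ A (o + i)) (σ X)))) rfl) ?_).mono ?_
    (fun _ h => h)
  · rintro _ rfl
    refine runs_yates (k := I.k) (L := I.yl) hC1 hX1 hCX hCT hXT hCL hXL hk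
      (f _ (by decide) (by decide) (by decide))
      (f _ (by decide) (by decide) (by decide)) (f _ (by decide) (by decide) (by decide))
      (f _ (by decide) (by decide) (by decide))
      (f _ (by decide) (by decide) (by decide)) (f _ (by decide) (by decide) (by decide))
      (by omega) (by simp [hb])
      (by simp [hb, hI.bb_eq]) y5 y6 (fun s hs => ?_) y1 y2 y3 ?_ ?_
    -- Because `N * N ≤ r`, the array only grows during the steps and `r ^ k` bounds all lengths.
    · refine le_trans ?_ hrk'
      calc I.r ^ s * (I.N * I.N) ^ (I.k - s) ≤ I.r ^ s * I.r ^ (I.k - s) :=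
            Nat.mul_le_mul_left _ (Nat.pow_le_pow_left hI.N_le_r _)
        _ = I.r ^ I.k := by rw [← pow_add]; congr 1; omega
    · have : (I.yl + I.r) * (60 * (I.N * I.N) + 100) ≤ 2 * I.yl * (60 * I.r + 100) :=
        Nat.mul_le_mul (by omega) (by have := hI.N_le_r; omega)
      have := Nat.mul_le_mul_left I.k (Nat.add_le_add_right this 104)
      simp only [Expr.len_mul, Expr.len_var, Inst.yc]
      omega
    · intro σ' h5 h6
      refine hQ σ' (fun B hB => ?_) (fun i hi => ?_)
      · simp only [List.mem_cons, List.not_mem_nil, or_false, not_or] at hB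
        rw [h6 B hB.1 hB.2.1 hB.2.2, State.set_of_ne _ _ hB.1]
      · rw [h5 i hi, yIter_self _ _ hi, Inst.hat, State.set_of_ne _ _ hCX, State.set_self]
        refine Finset.sum_congr rfl fun η hη => ?_
        have : η < I.b * I.b := by rw [hI.bb_eq]; exact Finset.mem_range.1 hη
        rw [setOn_pos (P := (· < I.b * I.b)) this]
  · refine le_trans ?_ ht
    have := Nat.mul_le_mul_right (off.len + 21) hrk
    simp only [Expr.len_mul, Expr.len_var]
    omega

end

end WordRAM

/-! ### A row of blocks times a column of blocks -/

namespace WordRAM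

open Function

section

variable {w : ℕ} {M : Machine w} {I : Inst} {σ : State} {t : ℕ} {Q : State → Prop}
  {lev D c vb₀ : ℕ}

/-- The pointwise products are added up in the transformed domain, so a column of blocks needs only
one inverse transform. As `h ≤ b`, the left matrix has a single row of blocks. -/
theorem runs_block (hI : I.Valid M) (hσ : I.Has σ) (hD : D ≤ 2 * I.n) (hc : c ≤ I.n)
    (hv : vb₀ < I.Vb c)
    (ht : I.Yb D * (150 * I.r ^ I.k + 2 * I.yc + 56 + 4) + I.yc + 13 * I.r ^ I.k +
      I.b * (I.h * 60 + 60) + 60 ≤ t)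
    (hQ : ∀ σ', Agree [aX, aY, aZ, aT, aL, aFlag] σ σ' →
      σ' aFlag = setOn (fun p => p = 0 ∧ ∃ x < I.b, vb₀ * I.b + x < c ∧ ∃ i < I.h,
        2 ^ w ∣ I.prodSum σ (I.Yb D) (fun y => y * (I.b * I.b))
          (fun y => (vb₀ * I.Yb D + y) * (I.b * I.b)) (zIndex I.N i x)) (fun _ => 1) (σ aFlag) →
      Q σ') :
    Runs M (block I.N I.r) ((I.lenv lev D c).bind vvb vb₀) σ t Q := by
  have hfit := hI.fits
  have hYb := hI.Y_le hD
  have hVY := hI.VY_le hD hc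
  have hVb := hI.Vb_mul_le hc
  have hnK := hI.nK_le
  have hbb := hI.bb_le
  have hb0 := hI.b_pos
  have hK1 := hI.one_le_K
  have hbb' : I.b * 1 ≤ I.b * I.b := Nat.mul_le_mul_left _ hb0
  have hnb : I.n + I.b ≤ (I.n + I.b) * (8 * I.n * I.K + I.b) :=
    Nat.le_mul_of_pos_right _ (by omega)
  have hhn := hI.h_le_n
  obtain ⟨y1, y2, y3, y4⟩ := hI.r_le_yl
  obtain ⟨y5, y6⟩ := hI.yl_lt
  have hrk := hI.bb_le_rk
  have hrk' : I.r ^ I.k ≤ I.yl := Nat.le_add_right _ _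
  have hw : M.lim ≤ 2 ^ w := le_of_not_gt fun h => lt_irrefl _ (M.lt_two_pow h)
  have hYb1 : I.Yb D * 1 ≤ I.Yb D * (I.b * I.b) := Nat.mul_le_mul_left _ (by nlinarith)
  have hCC : ∀ S : List ℕ, aCC ∉ S → aCA ∉ S → aCB ∉ S → ∀ {τ : State}, Agree S σ τ →
      τ aCC = σ aCC ∧ τ aCA = σ aCA ∧ τ aCB = σ aCB := fun S h1 h2 h3 τ h =>
    ⟨h _ h1, h _ h2, h _ h3⟩
  set o : ℕ → ℕ := fun y => y * (I.b * I.b) with ho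
  set o' : ℕ → ℕ := fun y => (vb₀ * I.Yb D + y) * (I.b * I.b) with ho'
  set Z : ℕ → ℕ → ℕ := fun m s =>
    ∑ y ∈ Finset.range m, I.hat (σ aCA) (σ aA) (o y) s * I.hat (σ aCB) (σ aB) (o' y) s with hZ
  have hfree : ∀ y, ∀ x, vVb < x → x ≠ vvb → x ≠ vyb →
      (((I.lenv lev D c).bind vvb vb₀).bind vyb y) x = none := fun y x h1 h2 h3 => by
    rw [Env.bind_of_ne _ _ h3, Env.bind_of_ne _ _ h2, I.lenv_none _ _ _ h1]
  refine (Runs.seq (t' := I.Yb D * (150 * I.r ^ I.k + 2 * I.yc + 56 + 4) + I.yc +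
      I.b * (I.h * 60 + 60) + 50) (R := Q)
    (runs_fill (N := I.r ^ I.k) (v := 0) (by decide) (by simp) (by simp) (by simp) (by omega)
      (by omega) (by simp) (by simp) le_rfl
      (Q := (· = σ.set aZ (setOn (· < I.r ^ I.k) (fun _ => 0) (σ aZ)))) rfl) ?_).mono
    (by simp; omega) (fun _ h => h)
  rintro _ rfl
  refine (Runs.seq (t' := I.yc + I.b * (I.h * 60 + 60) + 30) (R := Q)
    (Q := fun σ' => Agree [aX, aY, aZ, aT, aL] σ σ' ∧ ∀ s < I.r ^ I.k, σ' aZ s = Z (I.Yb D) s)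
    ((Runs.loop (t := 150 * I.r ^ I.k + 2 * I.yc + 56)
      (fun m σ' => Agree [aX, aY, aZ, aT, aL] σ σ' ∧ ∀ s < I.r ^ I.k, σ' aZ s = Z m s)
      (by simp) (by simp) (by simp; omega) ?_ ?_).mono le_rfl (by simp)) ?_).mono
    (by simp; omega) (fun _ h => h)
  · refine ⟨agree_set _ _ (by simp), fun s hs => ?_⟩
    rw [State.set_self, setOn_pos (P := (· < I.r ^ I.k)) hs]
    simp [hZ]
  · simp only [Expr.eval_var]
    rintro y hy σ₁ ⟨h1, h2⟩
    have hy : y < I.Yb D := by simpa using hy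
    have hoy : o y + I.b * I.b ≤ I.Yb D * (I.b * I.b) := by
      have := Nat.mul_le_mul_right (I.b * I.b) (show y + 1 ≤ I.Yb D from hy)
      simp only [ho]; linarith
    have hoy' : o' y + I.b * I.b ≤ I.Vb c * (I.Yb D * (I.b * I.b)) := by
      have h3 := Nat.mul_le_mul_right (I.Yb D) (show vb₀ + 1 ≤ I.Vb c from hv)
      have := Nat.mul_le_mul_right (I.b * I.b) (show vb₀ * I.Yb D + y + 1 ≤ I.Vb c * I.Yb D by
        linarith)
      simp only [ho']; linarith
    obtain ⟨c1, c2, c3⟩ := hCC _ (by simp) (by simp) (by simp) h1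
    refine (Runs.seq (runs_transform (A := aA) (o := o y) hI (Or.inl ⟨rfl, rfl, rfl⟩) (by simp)
      (by simp) (hfree y) (by simp) (by simp [ho]) (by omega) le_rfl
      (Q := fun τ => Agree [aX, aT, aL] σ₁ τ ∧
        ∀ s < I.r ^ I.k, τ aX s = I.hat (σ aCA) (σ aA) (o y) s) fun τ e1 e2 => ⟨e1, ?_⟩)
      (t' := 120 * I.r ^ I.k + I.yc + 30) (R := _) ?_).mono
      (by simp only [Expr.len_mul, Expr.len_var]; omega) (fun _ h => h)
    · rwa [c2, h1 aA (by simp)] at e2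
    rintro σ₂ ⟨h3, h4⟩
    have h5 : Agree [aX, aY, aZ, aT, aL] σ σ₂ := h1.trans (h3.mono (by simp))
    obtain ⟨c1, c2, c3⟩ := hCC _ (by simp) (by simp) (by simp) h5
    refine (Runs.seq (runs_transform (A := aB) (o := o' y) hI (Or.inr ⟨rfl, rfl, rfl⟩) (by simp)
      (by simp) (hfree y) (by simp) (by simp [ho']) (by omega) le_rfl
      (Q := fun τ => Agree [aY, aT, aL] σ₂ τ ∧
        ∀ s < I.r ^ I.k, τ aY s = I.hat (σ aCB) (σ aB) (o' y) s) fun τ e1 e2 => ⟨e1, ?_⟩)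
      (t' := 70 * I.r ^ I.k + 10) (R := _) ?_).mono
      (by simp only [Expr.len_mul, Expr.len_add, Expr.len_var]; omega) (fun _ h => h)
    · rwa [c3, h5 aB (by simp)] at e2
    rintro σ₃ ⟨h6, h7⟩
    have h8 : Agree [aX, aY, aZ, aT, aL] σ σ₃ := h5.trans (h6.mono (by simp))
    have hX : σ₃ aX = σ₂ aX := h6 aX (by simp)
    have hZ1 : σ₃ aZ = σ₁ aZ := (h6 aZ (by simp)).trans (h3 aZ (by simp))
    refine Sets.runs (A := aZ) (P := fun i => ∃ s < I.r ^ I.k, i = s) (v := Z (y + 1))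
      (t := I.r ^ I.k * (44 + 4) + 7) (Sets.loop (by simp) (by simp) (by simp) (by omega)
        fun s hs g hg => ?_) (by omega) ⟨h8.trans (agree_set _ _ (by simp)), fun s hs => ?_⟩
    · refine (Sets.write (by decide) (by simp) (by simp [numArrays]; omega) (by simp; omega)
        ?_).mono (by simp) (by simp) (fun _ _ => rfl)
      -- Earlier rounds wrote only the cells below `s`, so cell `s` still holds the sum over the
      -- previous blocks.
      have hgs : g s = Z y s := by
        rw [hg s (fun k' hk' => by omega), hZ1, h2 s hs]
      simp only [Expr.eval_add, Expr.eval_mul, Expr.eval_read, Expr.eval_var, Env.bind_self,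
        Option.getD_some, State.set_self, State.set_of_ne σ₃ g (show aX ≠ aZ by decide),
        State.set_of_ne σ₃ g (show aY ≠ aZ by decide), hgs, hX, h4 s hs, h7 s hs]
      simp only [hZ, Finset.sum_range_succ]
    · rw [State.set_self, setOn_pos (P := fun i => ∃ s < I.r ^ I.k, i = s) ⟨s, hs, rfl⟩]
  · rintro σ₁ ⟨h1, h2⟩
    obtain ⟨c1, c2, c3⟩ := hCC _ (by simp) (by simp) (by simp) h1
    refine (Runs.seq (runs_yates (k := I.k) (L := I.yl) (J := I.r) (r := I.N * I.N) (by decide)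
      (by decide) (by decide) (by decide) (by decide) (by decide) (by decide) (by simp) (by simp)
      (by simp) (by simp) (by simp) (by simp) (by simp) hI.r_pos (by simp) (by simp) y5 y6
      (fun s hs => ?_) (by linarith) y3 y2 (t := I.yc) ?_
      (Q := fun τ => Agree [aX, aY, aZ, aT, aL] σ τ ∧ ∀ p < I.b * I.b,
        τ aZ p = I.prodSum σ (I.Yb D) o o' p) fun τ e1 e2 => ⟨?_, fun p hp => ?_⟩)
      (t' := I.b * (I.h * 60 + 60) + 30) (R := _) ?_).mono (by omega) (fun _ h => h)
    · refine le_trans ?_ hrk'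
      calc (I.N * I.N) ^ s * I.r ^ (I.k - s) ≤ I.r ^ s * I.r ^ (I.k - s) :=
            Nat.mul_le_mul_right _ (Nat.pow_le_pow_left hI.N_le_r _)
        _ = I.r ^ I.k := by rw [← pow_add]; congr 1; omega
    · have : (I.yl + I.N * I.N) * (60 * I.r + 100) ≤ 2 * I.yl * (60 * I.r + 100) :=
        Nat.mul_le_mul (by omega) (by omega)
      have := Nat.mul_le_mul_left I.k (Nat.add_le_add_right this 104)
      simp only [Expr.len_var, Inst.yc]
      omega
    · refine h1.trans fun A hA => ?_
      simp only [List.mem_cons, List.not_mem_nil, or_false, not_or] at hA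
      exact e2 A hA.2.2.1 hA.2.2.2.1 hA.2.2.2.2
    · rw [e1 p (by rwa [← hI.bb_eq]), yIter_self _ _ (by rwa [← hI.bb_eq]), Inst.prodSum, c1]
      exact Finset.sum_congr rfl fun s hs => by rw [h2 s (Finset.mem_range.1 hs)]
    rintro σ₂ ⟨h3, h4⟩
    have hFl : σ₂ aFlag = σ aFlag := h3 aFlag (by simp)
    refine Sets.runs (A := aFlag) (v := fun _ => 1) (P := fun p => ∃ x < I.b, vb₀ * I.b + x < c ∧
      ∃ i < I.h, 2 ^ w ∣ I.prodSum σ (I.Yb D) o o' (zIndex I.N i x) ∧ p = 0)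
      (t := I.b * ((5 + 3 + 2 + 2 + (I.h * (45 + 4) + 7)) + 4) + 7)
      (Sets.loop (by simp) (by simp) (by simp) (by omega) fun x hx g hg => ?_) ?_ ?_
    · refine (Sets.ifLt (P := fun p => ∃ i < I.h, 2 ^ w ∣ I.prodSum σ (I.Yb D) o o'
        (zIndex I.N i x) ∧ p = 0) (t := I.h * (45 + 4) + 7) (by simp) (by simp) ?_ (by simp; omega)
        fun _ => Sets.loop (t := 45) (by simp) (by simp) (by simp) (by have := hI.h_le_n; omega)
        fun i hi g' _ => ?_).mono (by simp) (by simp) (fun _ _ => rfl)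
      · have := Nat.mul_le_mul_right I.b (show vb₀ + 1 ≤ I.Vb c from hv)
        have : (vb₀ + 1) * I.b = vb₀ * I.b + I.b := by ring
        simp; omega
      · have hib : i < I.b := lt_of_lt_of_le hi hI.h_le_b
        have hz := hI.zIndex_lt hib hx
        have hspr : ∀ x < I.b, σ₂ aSpr x = spread I.N x := fun x hx => by
          rw [h3 aSpr (by simp), hσ.spr x hx]
        have hev : Expr.eval M (((((I.lenv lev D c).bind vvb vb₀).bind vx x).bind vi i))
            (σ₂.set aFlag g') (zIndexExpr I.N (.var vi) (.var vx)) = zIndex I.N i x := by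
          simp [zIndexExpr, hspr i hib, hspr x hx, zIndex]
        have hev' : Expr.eval M (((((I.lenv lev D c).bind vvb vb₀).bind vx x).bind vi i))
            (σ₂.set aFlag g') (.read aZ (zIndexExpr I.N (.var vi) (.var vx))) =
            I.prodSum σ (I.Yb D) o o' (zIndex I.N i x) := by
          rw [Expr.eval_read, hev, State.set_of_ne _ _ (by decide), h4 _ hz]
        refine (Sets.ifZero (P := (· = 0)) (t := 8) ?_ fun _ => (Sets.write (by decide) (by simp)
          (by simp) (by simp; omega) (by simp)).mono (by simp) (by simp) (fun _ _ => rfl)).mono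
          (by simp [zIndexExpr]) (fun p => ?_) (fun _ _ => rfl)
        · rw [Expr.ok_read, hev]
          refine ⟨?_, by decide, by decide, by omega⟩
          simp [zIndexExpr, numArrays]; omega
        · rw [hev']
    · have : I.b * ((5 + 3 + 2 + 2 + (I.h * (45 + 4) + 7)) + 4) ≤ I.b * (I.h * 60 + 60) :=
        Nat.mul_le_mul_left _ (by omega)
      omega
    · refine hQ _ ?_ ?_
      · exact (h3.mono (by simp)).trans (agree_set _ _ (by simp))
      · rw [State.set_self, hFl]
        congr 1
        funext p
        refine propext ⟨?_, ?_⟩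
        · rintro ⟨x, hx, hx', i, hi, hd, rfl⟩
          exact ⟨rfl, x, hx, hx', i, hi, hd⟩
        · rintro ⟨rfl, x, hx, hx', i, hi, hd⟩
          exact ⟨x, hx, hx', i, hi, hd, rfl⟩

end

end WordRAM

/-! ### Exactness modulo `2 ^ w`, and the meaning of a zero entry -/

namespace WordRAM

open Function

namespace Inst

variable (I : Inst)

/-- The coefficients are those of a bilinear algorithm for `D₀` times the product of two `N × N`
matrices, and the entries of the products of matrices fit into words of `w` bits. -/
structure Exact (w D₀ : ℕ) : Prop where
  pos : 0 < D₀
  base : ∀ p < I.N * I.N, ∀ q < I.N * I.N, ∀ q' < I.N * I.N,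
    ∑ t ∈ Finset.range I.r, (I.cc (p * I.r + t) : ZMod (2 ^ w)) * I.ca (t * (I.N * I.N) + q) *
      I.cb (t * (I.N * I.N) + q') = D₀ * mmDelta I.N p q q'
  small : D₀ ^ I.k * (8 * I.n * I.K + I.b) < 2 ^ w

/-- The pair `(u, v)` passes the test of the level `D`. -/
def Pass (D u v : ℕ) : Prop := ∀ x < I.n, I.adj (u * I.n + x) = 0 → ∀ j < I.K,
  ∃ e < I.M, I.src e = v ∧ I.rnd (I.dst e * I.K + j) % (4 * D) = I.rnd (x * I.K + j) % (4 * D)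

/-- The vertex `x` belongs to the level `D`. -/
def InLevel (D x : ℕ) : Prop := D ≤ I.dg x ∧ I.dg x < 2 * D

end Inst

section

variable {w : ℕ} {M : Machine w} {I : Inst} {σ : State} {D c D₀ m : ℕ} {o o' : ℕ → ℕ}

/-- The inverse transform is linear, so the sum over the blocks can be taken last; each block is
then an instance of `sum_ker_mul` in `ZMod (2 ^ w)`. -/
theorem Inst.cast_prodSum (hI : I.Valid M) (hE : I.Exact w D₀) (hσ : I.Has σ) {i x : ℕ}
    (hi : i < I.b) (hx : x < I.b) :
    (I.prodSum σ m o o' (zIndex I.N i x) : ZMod (2 ^ w)) = ((D₀ ^ I.k * ∑ y ∈ Finset.range m,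
      ∑ y' ∈ Finset.range I.b, σ aA (o y + zIndex I.N i y') * σ aB (o' y + zIndex I.N y' x) : ℕ) :
      ZMod (2 ^ w)) := by
  have h4 := hI.r_le_yl.2.2.2
  have base : ∀ p < I.N * I.N, ∀ q < I.N * I.N, ∀ q' < I.N * I.N,
      ∑ t ∈ Finset.range I.r, (σ aCC (p * I.r + t) : ZMod (2 ^ w)) *
        σ aCA (t * (I.N * I.N) + q) * σ aCB (t * (I.N * I.N) + q') = D₀ * mmDelta I.N p q q' := by
    intro p hp q hq q' hq'
    rw [← hE.base p hp q hq q' hq']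
    refine Finset.sum_congr rfl fun t ht => ?_
    have ht := Finset.mem_range.1 ht
    rw [hσ.cc _ (by nlinarith), hσ.ca _ (by nlinarith), hσ.cb _ (by nlinarith)]
  have key := fun y => sum_ker_mul (R := ZMod (2 ^ w)) hI.two_le_N base (k := I.k) hi hx
    (fun q => σ aA (o y + q)) (fun q => σ aB (o' y + q))
  rw [Inst.prodSum]
  push_cast
  simp only [Finset.mul_sum (Finset.range m), Inst.hat]
  push_cast
  rw [Finset.sum_comm]
  exact Finset.sum_congr rfl fun y _ => key y

/-- The factors are 0-1 matrices, so the entry is at most `m * b`, and `D₀ ^ k` times it stays below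
`2 ^ w`. Vanishing modulo `2 ^ w` is then vanishing, and a sum of natural numbers vanishes iff every
term does. -/
theorem Inst.dvd_prodSum_iff (hI : I.Valid M) (hE : I.Exact w D₀) (hσ : I.Has σ) {i x : ℕ}
    (hi : i < I.b) (hx : x < I.b) (hm : m * I.b ≤ 8 * I.n * I.K + I.b)
    (hA : ∀ y < m, ∀ q < I.b * I.b, σ aA (o y + q) ≤ 1)
    (hB : ∀ y < m, ∀ q < I.b * I.b, σ aB (o' y + q) ≤ 1) :
    2 ^ w ∣ I.prodSum σ m o o' (zIndex I.N i x) ↔ ∀ y < m, ∀ y' < I.b,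
      σ aA (o y + zIndex I.N i y') = 0 ∨ σ aB (o' y + zIndex I.N y' x) = 0 := by
  rw [← ZMod.natCast_eq_zero_iff, Inst.cast_prodSum hI hE hσ hi hx, ZMod.natCast_eq_zero_iff]
  set S := ∑ y ∈ Finset.range m, ∑ y' ∈ Finset.range I.b,
    σ aA (o y + zIndex I.N i y') * σ aB (o' y + zIndex I.N y' x) with hS
  have hSm : S ≤ m * I.b := by
    rw [hS]
    refine (Finset.sum_le_card_nsmul _ _ I.b fun y hy => ?_).trans (by simp)
    refine (Finset.sum_le_card_nsmul _ _ 1 fun y' hy' => ?_).trans (by simp)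
    rw [Finset.mem_range] at hy hy'
    exact Nat.mul_le_mul (hA y hy _ (hI.zIndex_lt hi hy')) (hB y hy _ (hI.zIndex_lt hy' hx))
  have hlt : D₀ ^ I.k * S < 2 ^ w :=
    lt_of_le_of_lt (Nat.mul_le_mul_left _ (hSm.trans hm)) hE.small
  have h0 : 2 ^ w ∣ D₀ ^ I.k * S ↔ S = 0 := by
    constructor
    · intro h
      have := Nat.eq_zero_of_dvd_of_lt h hlt
      have hp := Nat.pow_pos (n := I.k) hE.pos
      exact (Nat.mul_eq_zero.1 this).resolve_left hp.ne'
    · intro h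
      simp [h]
  rw [h0, hS, Finset.sum_eq_zero_iff]
  simp only [Finset.sum_eq_zero_iff, Finset.mem_range, mul_eq_zero]

theorem Inst.bkt_inj (hD : 0 < D) {x j x' j' : ℕ} (h : I.bkt D x j = I.bkt D x' j') :
    j = j' ∧ I.rnd (x * I.K + j) % (4 * D) = I.rnd (x' * I.K + j') % (4 * D) := by
  have lt : ∀ z, z % (4 * D) < 4 * D := fun z => Nat.mod_lt _ (by omega)
  have e1 := congrArg (· / (4 * D)) h
  have e2 := congrArg (· % (4 * D)) h
  simp only [Inst.bkt, mul_add_div_of_lt (lt _), mul_add_mod_of_lt (lt _)] at e1 e2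
  exact ⟨e1, e2⟩

theorem Inst.posA_inj (hI : I.Valid M) {i i' y y' : ℕ} (hi : i < I.b) (hi' : i' < I.b)
    (h : I.posA i y = I.posA i' y') : i = i' ∧ y = y' := by
  have hb := hI.b_pos
  have lt := fun {u} (hu : u < I.b) z => hI.zIndex_lt hu (Nat.mod_lt z hb)
  have e1 := congrArg (· / (I.b * I.b)) h
  have e2 := congrArg (· % (I.b * I.b)) h
  simp only [Inst.posA, mul_add_div_of_lt (lt hi _), mul_add_mod_of_lt (lt hi _),
    mul_add_div_of_lt (lt hi' _), mul_add_mod_of_lt (lt hi' _)] at e1 e2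
  obtain ⟨e3, e4⟩ := zIndex_inj hI.two_le_N I.k hi (Nat.mod_lt _ hb) hi' (Nat.mod_lt _ hb) e2
  change y % I.b = y' % I.b at e4
  exact ⟨e3, by rw [← Nat.div_add_mod y I.b, ← Nat.div_add_mod y' I.b, e1, e4]⟩

theorem Inst.posB_inj (hI : I.Valid M) {i i' y y' : ℕ} (hy : y < I.Yb D * I.b)
    (hy' : y' < I.Yb D * I.b) (h : I.posB D y i = I.posB D y' i') : i = i' ∧ y = y' := by
  have hb := hI.b_pos
  have lt := fun u z => hI.zIndex_lt (Nat.mod_lt u hb) (Nat.mod_lt z hb)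
  have lt' : ∀ {u}, u < I.Yb D * I.b → u / I.b < I.Yb D := fun {u} hu =>
    Nat.div_lt_of_lt_mul (by rwa [mul_comm])
  have e1 := congrArg (· / (I.b * I.b)) h
  have e2 := congrArg (· % (I.b * I.b)) h
  simp only [Inst.posB, mul_add_div_of_lt (lt _ _), mul_add_mod_of_lt (lt _ _)] at e1 e2
  obtain ⟨e3, e4⟩ := zIndex_inj hI.two_le_N I.k (Nat.mod_lt _ hb) (Nat.mod_lt _ hb)
    (Nat.mod_lt _ hb) (Nat.mod_lt _ hb) e2
  have e5 := congrArg (· / I.Yb D) e1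
  have e6 := congrArg (· % I.Yb D) e1
  simp only [mul_add_div_of_lt (lt' hy), mul_add_mod_of_lt (lt' hy), mul_add_div_of_lt (lt' hy'),
    mul_add_mod_of_lt (lt' hy')] at e5 e6
  change y % I.b = y' % I.b at e3
  change i % I.b = i' % I.b at e4
  exact ⟨by rw [← Nat.div_add_mod i I.b, ← Nat.div_add_mod i' I.b, e5, e4],
    by rw [← Nat.div_add_mod y I.b, ← Nat.div_add_mod y' I.b, e6, e3]⟩

/-- The matrices of a level represent the test of the level. -/
theorem Inst.pass_iff (hI : I.Valid M) (hE : I.Exact w D₀) (hσ : I.Has σ) (hD0 : 0 < D)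
    (hD : D ≤ 2 * I.n) {idx : ℕ → ℕ}
    (hinj : ∀ x < I.n, I.InLevel D x → ∀ y < I.n, I.InLevel D y → idx x = idx y → x = y)
    (hA : ∀ p < I.Yb D * (I.b * I.b), σ aA p = setOn (fun p => ∃ i < I.h, ∃ x < I.n,
      I.adj (I.hv i * I.n + x) = 0 ∧ ∃ j < I.K, p = I.posA i (I.bkt D x j)) (fun _ => 1)
        (fun _ => 0) p)
    (hB : ∀ p < I.Vb c * (I.Yb D * (I.b * I.b)), σ aB p = setOn (fun p => ∃ e < I.M,
      I.InLevel D (I.src e) ∧ ∃ j < I.K, p = I.posB D (I.bkt D (I.dst e) j) (idx (I.src e)))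
        (fun _ => 0) (fun _ => 1) p)
    {vb₀ x i v : ℕ} (hv : vb₀ < I.Vb c) (hx : x < I.b) (hi : i < I.h) (hvn : v < I.n)
    (hvD : I.InLevel D v) (hidx : idx v = vb₀ * I.b + x) :
    2 ^ w ∣ I.prodSum σ (I.Yb D) (fun y => y * (I.b * I.b))
      (fun y => (vb₀ * I.Yb D + y) * (I.b * I.b)) (zIndex I.N i x) ↔ I.Pass D (I.hv i) v := by
  have hb := hI.b_pos
  have hib : i < I.b := lt_of_lt_of_le hi hI.h_le_b
  have hYb := hI.Yb_mul_le hD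
  have pA : ∀ y < I.Yb D, ∀ q < I.b * I.b, y * (I.b * I.b) + q < I.Yb D * (I.b * I.b) :=
    fun y hy q hq => by
      have := Nat.mul_le_mul_right (I.b * I.b) (show y + 1 ≤ I.Yb D from hy)
      linarith
  have pB : ∀ y < I.Yb D, ∀ q < I.b * I.b, (vb₀ * I.Yb D + y) * (I.b * I.b) + q <
      I.Vb c * (I.Yb D * (I.b * I.b)) := fun y hy q hq => by
    have h1 := Nat.mul_le_mul_right (I.Yb D) (show vb₀ + 1 ≤ I.Vb c from hv)
    have h2 : vb₀ * I.Yb D + y + 1 ≤ I.Vb c * I.Yb D := by linarith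
    have := Nat.mul_le_mul_right (I.b * I.b) h2
    linarith
  rw [Inst.dvd_prodSum_iff hI hE hσ hib hx hYb]
  rotate_left
  · intro y hy q hq
    rw [hA _ (pA y hy q hq), setOn]
    split_ifs <;> simp
  · intro y hy q hq
    rw [hB _ (pB y hy q hq), setOn]
    split_ifs <;> simp
  -- The `+ 1` in `Yb` makes room for all buckets, also when `b` does not divide their number.
  have hKY : I.K * (4 * D) < I.Yb D * I.b := by
    rw [Inst.Yb, Nat.succ_mul (I.K * (4 * D) / I.b)]
    have := Nat.div_add_mod' (I.K * (4 * D)) I.b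
    have := Nat.mod_lt (I.K * (4 * D)) hb
    omega
  -- Column by column: a term is zero iff the column is not marked on the left, or is hit by an arc
  -- that leaves `v`.
  have key : ∀ y < I.Yb D, ∀ y' < I.b, (σ aA (y * (I.b * I.b) + zIndex I.N i y') = 0 ∨
      σ aB ((vb₀ * I.Yb D + y) * (I.b * I.b) + zIndex I.N y' x) = 0) ↔
      (∀ z < I.n, I.adj (I.hv i * I.n + z) = 0 → ∀ j < I.K, y * I.b + y' = I.bkt D z j →
        ∃ e < I.M, I.src e = v ∧ ∃ j' < I.K, y * I.b + y' = I.bkt D (I.dst e) j') := by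
    intro y hy y' hy'
    have hYY : y * I.b + y' < I.Yb D * I.b := by
      have := Nat.mul_le_mul_right I.b (show y + 1 ≤ I.Yb D from hy)
      linarith
    have e1 : y * (I.b * I.b) + zIndex I.N i y' = I.posA i (y * I.b + y') := by
      rw [Inst.posA, mul_add_div_of_lt hy', mul_add_mod_of_lt hy']
    have e2 : (vb₀ * I.Yb D + y) * (I.b * I.b) + zIndex I.N y' x =
        I.posB D (y * I.b + y') (vb₀ * I.b + x) := by
      rw [Inst.posB, mul_add_div_of_lt hy', mul_add_mod_of_lt hy', mul_add_div_of_lt hx,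
        mul_add_mod_of_lt hx]
    rw [hA _ (pA y hy _ (hI.zIndex_lt hib hy')), hB _ (pB y hy _ (hI.zIndex_lt hy' hx)), e1, e2]
    have f1 : ∀ {P : Prop} {_ : Decidable P}, (if P then 1 else 0) = (0 : ℕ) ↔ ¬ P := by
      intros; split_ifs <;> simp_all
    have f2 : ∀ {P : Prop} {_ : Decidable P}, (if P then 0 else 1) = (0 : ℕ) ↔ P := by
      intros; split_ifs <;> simp_all
    simp only [setOn]
    rw [f1, f2]
    constructor
    · rintro (h | ⟨e, he, hl, j, hj, hp⟩) z hz hz' k hk hzk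
      · exact absurd ⟨i, hi, z, hz, hz', k, hk, by rw [hzk]⟩ h
      · obtain ⟨h1, h2⟩ := Inst.posB_inj hI hYY ((hI.bkt_lt hD0 hj).trans hKY) hp
        -- Equal positions only give equal numbers; the numbering is injective on the level, so the
        -- source of the arc is `v`.
        have := hinj v hvn hvD _ (hI.src_lt e he) hl (hidx.trans h1)
        exact ⟨e, he, this.symm, j, hj, h2⟩
    · intro h
      by_contra! hcon
      obtain ⟨⟨i', hi', z, hz, hz', k, hk, hp⟩, h'⟩ := hcon
      obtain ⟨rfl, h2⟩ := Inst.posA_inj hI hib (lt_of_lt_of_le hi' hI.h_le_b) hp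
      obtain ⟨e, he, hs, j', hj', h3⟩ := h z hz hz' k hk h2
      exact h' e he (hs ▸ hvD) j' hj' (by rw [h3, hs, hidx])
  constructor
  · intro h z hz hz' j hj
    have hbk := (hI.bkt_lt (x := z) hD0 hj).trans hKY
    -- For an undominated `z` the column to look at is its own bucket.
    have h1 : I.bkt D z j / I.b < I.Yb D := Nat.div_lt_of_lt_mul (by rwa [mul_comm])
    obtain ⟨e, he, hs, j', hj', h3⟩ := (key _ h1 _ (Nat.mod_lt _ hb)).1 (h _ h1 _ (Nat.mod_lt _ hb))
      z hz hz' j hj (Nat.div_add_mod' _ _)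
    rw [Nat.div_add_mod'] at h3
    obtain ⟨rfl, h4⟩ := Inst.bkt_inj hD0 h3
    exact ⟨e, he, hs, h4.symm⟩
  · intro h y hy y' hy'
    refine (key y hy y' hy').2 fun z hz hz' j hj hzj => ?_
    obtain ⟨e, he, hs, h1⟩ := h z hz hz' j hj
    exact ⟨e, he, hs, j, hj, by rw [hzj, Inst.bkt, Inst.bkt, h1]⟩

end

end WordRAM

/-! ### One level -/

namespace WordRAM

open Function

/-- The numbering by `Nat.count` is onto, so every number below the count comes from a listed
vertex. -/
theorem exists_of_lt_count {p : ℕ → Prop} [DecidablePred p] {i : ℕ} :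
    ∀ {n : ℕ}, i < Nat.count p n → ∃ x < n, p x ∧ Nat.count p x = i
  | 0, h => by simp at h
  | n + 1, h => by
    by_cases hi : i < Nat.count p n
    · obtain ⟨x, h1, h2⟩ := exists_of_lt_count hi
      exact ⟨x, by omega, h2⟩
    · rw [Nat.count_succ] at h
      by_cases hp : p n
      · rw [if_pos hp] at h
        exact ⟨n, by omega, hp, by omega⟩
      · rw [if_neg hp] at h
        omega

/-- The flag is only ever raised; consecutive rounds therefore combine to a disjunction. -/
theorem setOn_exists_succ (F : ℕ → Prop) (j : ℕ) (v g : ℕ → ℕ) :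
    setOn (fun p => p = 0 ∧ F j) v (setOn (fun p => p = 0 ∧ ∃ l < j, F l) v g) =
      setOn (fun p => p = 0 ∧ ∃ l < j + 1, F l) v g := by
  funext p
  simp only [setOn]
  by_cases hFj : F j
  · by_cases hp : p = 0
    · rw [if_pos ⟨hp, hFj⟩, if_pos ⟨hp, j, by omega, hFj⟩]
    · rw [if_neg (fun h => hp h.1), if_neg (fun h => hp h.1), if_neg (fun h => hp h.1)]
  · rw [if_neg (fun h => hFj h.2)]
    have : (∃ l < j, F l) ↔ ∃ l < j + 1, F l := ⟨fun ⟨l, h1, h2⟩ => ⟨l, by omega, h2⟩,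
      fun ⟨l, h1, h2⟩ => ⟨l, lt_of_le_of_ne (by omega) (by rintro rfl; exact hFj h2), h2⟩⟩
    by_cases h : p = 0 ∧ ∃ l < j, F l
    · rw [if_pos h, if_pos ⟨h.1, this.1 h.2⟩]
    · rw [if_neg h, if_neg (fun h' => h ⟨h'.1, this.2 h'.2⟩)]

namespace Inst

variable (I : Inst)

instance (D : ℕ) : DecidablePred (I.InLevel D) := fun _ => instDecidableAnd

/-- The cost of `block`. -/
def blockCost (D : ℕ) : ℕ := I.Yb D * (150 * I.r ^ I.k + 2 * I.yc + 56 + 4) + I.yc +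
  13 * I.r ^ I.k + I.b * (I.h * 60 + 60) + 60

/-- The cost of `level`. -/
def levelCost (D c : ℕ) : ℕ := I.n * 96 + I.Yb D * (I.b * I.b) * 13 +
  I.Vb c * (I.Yb D * (I.b * I.b)) * 13 + I.h * (I.n * (I.K * 110 + 40) + 20) +
  I.M * (I.K * 120 + 80) + I.Vb c * (I.blockCost D + 4) + 200

/-- The vertices of the level `D` in a pair that passes the test. -/
def Found (D : ℕ) : Prop := ∃ v < I.n, I.InLevel D v ∧ ∃ i < I.h, I.Pass D (I.hv i) v

end Inst

section

variable {w : ℕ} {M : Machine w} {I : Inst} {σ : State} {t : ℕ} {Q : State → Prop}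
  {lev D D₀ : ℕ}

/-- `setA` and `setB` leave the matrices in the form required by `Inst.pass_iff`. A block does not
change the matrices or the coefficients, so all blocks test the same product. The flag records their
disjunction. -/
theorem runs_level (hI : I.Valid M) (hE : I.Exact w D₀) (hσ : I.Has σ) (hD0 : 0 < D)
    (hD : D ≤ 2 * I.n) (hσD : σ aD 0 = D) (ht : I.levelCost D (Nat.count (I.InLevel D) I.n) ≤ t)
    (hQ : ∀ σ', Agree [aA, aB, aX, aY, aZ, aIdx, aLst, aCnt, aT, aL, aFlag, aD] σ σ' →
      σ' aD 0 = 2 * D →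
      σ' aFlag = setOn (fun p => p = 0 ∧ I.Found D) (fun _ => 1) (σ aFlag) → Q σ') :
    Runs M (level I.N I.r) (I.env.bind vlev lev) σ t Q := by
  set c := Nat.count (I.InLevel D) I.n with hcdef
  have hc : c ≤ I.n := Nat.count_le _
  have hfit := hI.fits
  have hYb := hI.Y_le hD
  have hVY := hI.VY_le hD hc
  have hVb := hI.Vb_mul_le hc
  have hnK := hI.nK_le
  have hKQ := hI.KQ_le hD
  have hbb := hI.bb_le
  have hnn := hI.nn_le
  have hn := hI.n_lt
  have hn2 := hI.two_le_n
  have hb0 := hI.b_pos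
  have hK1 := hI.one_le_K
  have hnK8 : 8 * I.n * 1 ≤ 8 * I.n * I.K := Nat.mul_le_mul_left _ hK1
  have hnb : I.n + I.b ≤ (I.n + I.b) * (8 * I.n * I.K + I.b) :=
    Nat.le_mul_of_pos_right _ (by omega)
  have hVb1 : I.Vb c * 1 ≤ I.Vb c * I.b := Nat.mul_le_mul_left _ hb0
  have hw : M.lim ≤ 2 ^ w := le_of_not_gt fun h => lt_irrefl _ (M.lt_two_pow h)
  have hle : I.env.bind vlev lev vD = none := by simp
  -- Throughout, every statement is charged to the time that remains; here `9` is `7` steps of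
  -- evaluation and `2` of assignment.
  refine (Runs.bind (t := t - 9) hle (by simp [numArrays]; omega) ?_).mono ?_ (fun _ h => h)
  swap
  · simp only [Inst.levelCost] at ht
    simp
    omega
  rw [show Expr.eval M (I.env.bind vlev lev) σ (.read aD (.const 0)) = D by simp [hσD]]
  refine (Runs.bind (t := t - 15) (by simp) (by simp) ?_).mono ?_ (fun _ h => h)
  swap
  · simp only [Inst.levelCost] at ht
    simp
    omega
  rw [show Expr.eval M ((I.env.bind vlev lev).bind vD D) σ (.const 4 * .var vD) = 4 * D by simp]
  refine (Runs.seq (t := I.n * 96 + 20) (t' := t - (I.n * 96 + 35)) (R := Q)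
    (runs_selectDeg (I := I) (Or.inl ⟨rfl, rfl⟩) (by simp) (by simp) (by omega) hσ.dg hI.dg_le
      (a := D) (b := 2 * D) (by simp) (by simp) (by omega) (by omega) (by simp)
      (Q := fun τ => Agree [aIdx, aLst, aCnt] σ τ ∧ τ aCnt 0 = c ∧ ∀ x < I.n, I.InLevel D x →
        τ aIdx x = Nat.count (I.InLevel D) x) (fun τ h1 h2 h3 => ⟨h1, h2, fun x hx hl =>
          (h3 x hx hl).1⟩)) ?_).mono ?_ (fun _ h => h)
  swap
  · simp only [Inst.levelCost] at ht
    omega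
  rintro σ₁ ⟨h1, h2, h3⟩
  refine (Runs.bind (t := t - (I.n * 96 + 44)) (by simp) (by simp [numArrays]; omega) ?_).mono ?_
    (fun _ h => h)
  swap
  · simp only [Inst.levelCost] at ht
    simp
    omega
  simp only [Expr.eval_read, Expr.eval_const, h2]
  refine (Runs.bind (t := t - (I.n * 96 + 56)) (by simp) (by simp; omega) ?_).mono ?_
    (fun _ h => h)
  swap
  · simp only [Inst.levelCost] at ht
    simp
    omega
  refine (Runs.bind (t := t - (I.n * 96 + 65)) (by simp) (by simp; omega) ?_).mono ?_
    (fun _ h => h)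
  swap
  · simp only [Inst.levelCost] at ht
    simp
    omega
  change Runs M _ (I.lenv lev D c) σ₁ _ Q
  have hh1 : I.Has σ₁ := hσ.congr h1 (by decide)
  refine (Runs.seq (t' := t - (I.n * 96 + 100 + I.Yb D * (I.b * I.b) * 13)) (R := Q)
    (runs_fill (N := I.Yb D * (I.b * I.b)) (v := 0) (by decide) (by simp) (by simp) (by simp)
      (by omega) (by omega) (by simp) (by simp) le_rfl
      (Q := (· = σ₁.set aA (setOn (· < I.Yb D * (I.b * I.b)) (fun _ => 0) (σ₁ aA)))) rfl) ?_).mono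
    ?_ (fun _ h => h)
  swap
  · simp only [Inst.levelCost] at ht
    simp
    omega
  rintro _ rfl
  refine (Runs.seq (t' := t - (I.n * 96 + 120 + I.Yb D * (I.b * I.b) * 13 +
    I.Vb c * (I.Yb D * (I.b * I.b)) * 13)) (R := Q)
    (runs_fill (N := I.Vb c * (I.Yb D * (I.b * I.b))) (v := 1) (by decide) (by simp) (by simp)
      (by simp) (by omega) (by omega) (by simp) (by simp) le_rfl rfl
      (Q := (· = State.set _ aB (setOn (· < I.Vb c * (I.Yb D * (I.b * I.b))) (fun _ => 1) _))))
    ?_).mono ?_ (fun _ h => h)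
  swap
  · simp only [Inst.levelCost] at ht
    simp
    omega
  rintro σ₂ h4
  have a2 : Agree [aIdx, aLst, aCnt, aA, aB] σ σ₂ := by
    rw [h4]
    exact ((h1.mono (by simp)).trans (agree_set _ _ (by simp))).trans (agree_set _ _ (by simp))
  have hh2 : I.Has σ₂ := hσ.congr a2 (by decide)
  have hA2 : ∀ p < I.Yb D * (I.b * I.b), σ₂ aA p = 0 := fun p hp => by
    rw [h4, State.set_of_ne _ _ (by decide), State.set_self,
      setOn_pos (P := (· < I.Yb D * (I.b * I.b))) hp]
  have hB2 : ∀ p < I.Vb c * (I.Yb D * (I.b * I.b)), σ₂ aB p = 1 := fun p hp => by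
    rw [h4, State.set_self, setOn_pos (P := (· < I.Vb c * (I.Yb D * (I.b * I.b)))) hp]
  have hI2 : ∀ x < I.n, I.InLevel D x → σ₂ aIdx x = Nat.count (I.InLevel D) x := fun x hx hl => by
    rw [h4, State.set_of_ne _ _ (by decide), State.set_of_ne _ _ (by decide), h3 x hx hl]
  clear h4
  refine (Runs.seq (t := I.h * (I.n * (I.K * 110 + 40) + 20) + 20)
    (t' := I.M * (I.K * 120 + 80) + I.Vb c * (I.blockCost D + 4) + 50) (R := Q)
    (runs_setA hI hh2 hD0 hD le_rfl rfl (Q := (· = _))) ?_).mono ?_ (fun _ h => h)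
  swap
  · simp only [Inst.levelCost] at ht
    omega
  rintro σ₃ h5
  have a3 : Agree [aIdx, aLst, aCnt, aA, aB] σ σ₃ := h5 ▸ a2.trans (agree_set _ _ (by simp))
  have hh3 : I.Has σ₃ := hσ.congr a3 (by decide)
  have hI3 : σ₃ aIdx = σ₂ aIdx := by rw [h5, State.set_of_ne _ _ (by decide)]
  have hB3 : σ₃ aB = σ₂ aB := by rw [h5, State.set_of_ne _ _ (by decide)]
  have hcl : ∀ x < I.n, I.InLevel D x → Nat.count (I.InLevel D) x < c := fun x hx hl =>
    Nat.count_strict_mono hl hx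
  refine (Runs.seq (t := I.M * (I.K * 120 + 80) + 20)
    (t' := I.Vb c * (I.blockCost D + 4) + 30) (R := Q)
    (runs_setB (c := c) (idx := Nat.count (I.InLevel D)) hI hh3 hD0 hD hc (fun x hx hl => ?_) le_rfl
      rfl (Q := (· = _))) ?_).mono (by omega) (fun _ h => h)
  · exact ⟨by rw [hI3, hI2 x hx hl], hcl x hx hl⟩
  rintro σ₄ h6
  have a4 : Agree [aIdx, aLst, aCnt, aA, aB] σ σ₄ := h6 ▸ a3.trans (agree_set _ _ (by simp))
  have hh4 : I.Has σ₄ := hσ.congr a4 (by decide)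
  have hA4 : ∀ p < I.Yb D * (I.b * I.b), σ₄ aA p = setOn (fun p => ∃ i < I.h, ∃ x < I.n,
      I.adj (I.hv i * I.n + x) = 0 ∧ ∃ j < I.K, p = I.posA i (I.bkt D x j)) (fun _ => 1)
        (fun _ => 0) p := fun p hp => by
    rw [h6, State.set_of_ne _ _ (by decide), h5, State.set_self, setOn, setOn, hA2 p hp]
  have hB4 : ∀ p < I.Vb c * (I.Yb D * (I.b * I.b)), σ₄ aB p = setOn (fun p => ∃ e < I.M,
      I.InLevel D (I.src e) ∧ ∃ j < I.K, p = I.posB D (I.bkt D (I.dst e) j)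
        (Nat.count (I.InLevel D) (I.src e))) (fun _ => 0) (fun _ => 1) p := fun p hp => by
    rw [h6, State.set_self, setOn, setOn, hB3, hB2 p hp]
    rfl
  have hpass : ∀ vb₀ < I.Vb c, ∀ x < I.b, ∀ i < I.h, ∀ v < I.n, I.InLevel D v →
      Nat.count (I.InLevel D) v = vb₀ * I.b + x →
      (2 ^ w ∣ I.prodSum σ₄ (I.Yb D) (fun y => y * (I.b * I.b))
        (fun y => (vb₀ * I.Yb D + y) * (I.b * I.b)) (zIndex I.N i x) ↔ I.Pass D (I.hv i) v) :=
    fun vb₀ hv x hx i hi v hvn hvl hcnt =>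
      Inst.pass_iff (c := c) hI hE hh4 hD0 hD (idx := Nat.count (I.InLevel D))
        (fun x hx hxl y hy hyl h => Nat.count_injective hxl hyl h) hA4 hB4 hv hx hi hvn hvl hcnt
  set F : ℕ → Prop := fun vb₀ => ∃ x < I.b, vb₀ * I.b + x < c ∧ ∃ i < I.h,
    2 ^ w ∣ I.prodSum σ₄ (I.Yb D) (fun y => y * (I.b * I.b))
      (fun y => (vb₀ * I.Yb D + y) * (I.b * I.b)) (zIndex I.N i x) with hF
  refine (Runs.seq (t' := 20) (R := Q) ((Runs.loop (t := I.blockCost D)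
    (fun m τ => Agree [aX, aY, aZ, aT, aL, aFlag] σ₄ τ ∧
      τ aFlag = setOn (fun p => p = 0 ∧ ∃ v < m, F v) (fun _ => 1) (σ₄ aFlag))
      (by simp) (by simp) (by simp; omega) ⟨Agree.refl _ _, ?_⟩ ?_).mono le_rfl (fun _ h => h))
      ?_).mono (by simp) (fun _ h => h)
  · simp [setOn_false]
  · simp only [Expr.eval_var, Inst.lenv_vVb, Option.getD_some]
    rintro m hm τ ⟨e1, e2⟩
    have hhτ : I.Has τ := hh4.congr e1 (by decide)
    refine runs_block hI hhτ hD hc hm le_rfl fun τ' e3 e4 => ⟨e1.trans e3, ?_⟩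
    have hps : ∀ p, I.prodSum τ (I.Yb D) (fun y => y * (I.b * I.b))
        (fun y => (m * I.Yb D + y) * (I.b * I.b)) p = I.prodSum σ₄ (I.Yb D)
        (fun y => y * (I.b * I.b)) (fun y => (m * I.Yb D + y) * (I.b * I.b)) p := fun p => by
      simp only [Inst.prodSum, e1 aCC (by simp), e1 aCA (by simp), e1 aCB (by simp),
        e1 aA (by simp), e1 aB (by simp)]
    simp only [hps] at e4
    rw [e4, e2]
    exact setOn_exists_succ F m _ _
  · simp only [Expr.eval_var, Inst.lenv_vVb, Option.getD_some]
    rintro σ₅ ⟨e1, e2⟩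
    have a5 : Agree [aIdx, aLst, aCnt, aA, aB, aX, aY, aZ, aT, aL, aFlag] σ σ₅ :=
      (a4.mono (by simp)).trans (e1.mono (by simp))
    refine (Runs.write (by decide) (by simp) (by simp) (by simp; omega) (hQ _ ?_ ?_ ?_)).mono
      (by simp) (fun _ h => h)
    · exact (a5.mono (by simp)).trans (agree_set _ _ (by simp))
    · simp
    · rw [State.set_of_ne _ _ (by decide), e2, a4 aFlag (by simp)]
      congr 1
      funext p
      refine propext (and_congr_right fun _ => ⟨?_, ?_⟩)
      -- The vertices of the level have the numbers `0, …, c - 1`; the condition `vb₀ * b + x < c`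
      -- discards the padding of the last block.
      · rintro ⟨vb₀, hv, x, hx, hvx, i, hi, hd⟩
        obtain ⟨v, hvn, hvl, hcnt⟩ := exists_of_lt_count hvx
        exact ⟨v, hvn, hvl, i, hi, (hpass vb₀ hv x hx i hi v hvn hvl hcnt).1 hd⟩
      · rintro ⟨v, hvn, hvl, i, hi, hp⟩
        have hlt := hcl v hvn hvl
        have hdm := Nat.div_add_mod' (Nat.count (I.InLevel D) v) I.b
        have hv : Nat.count (I.InLevel D) v / I.b < I.Vb c :=
          Nat.lt_succ_of_le (Nat.div_le_div_right hlt.le)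
        exact ⟨_, hv, _, Nat.mod_lt _ hb0, by omega, i, hi,
          (hpass _ hv _ (Nat.mod_lt _ hb0) i hi v hvn hvl hdm.symm).2 hp⟩

end

end WordRAM

namespace WordRAM

open Function

/-! ## The first phase -/

/-- Compute the least power of `base` that is at least `bound`. -/
def powLoop (base bound : Expr) : Stmt :=
  .write aPow (.const 0) (.const 1) ;; .write aExp (.const 0) (.const 0) ;;
  .loop vx bound (.ifLt (.read aPow (.const 0)) bound
    (.write aPow (.const 0) (base * .read aPow (.const 0)) ;;
    .write aExp (.const 0) (.read aExp (.const 0) + .const 1)))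

/-- Draw the random words. -/
def drawWords : Stmt := .loop vx (.var vn * .var vK) (.rand aRnd (.var vx))

/-- The arcs of the graph: both orientations of the edges, and a loop at every vertex. -/
def arcs : Stmt :=
  .loop ve (.const 2 * .var vm) (.write aSrc (.var ve) (.inp (.const 2 + .var ve))) ;;
  .loop ve (.const 2 * .var vm) (.write aDst (.var ve)
    (.inp (.const 2 + (.var ve / .const 2 * .const 2 + (.var ve + .const 1) % .const 2)))) ;;
  .loop vx (.var vn) (.write aSrc (.const 2 * .var vm + .var vx) (.var vx)) ;;
  .loop vx (.var vn) (.write aDst (.const 2 * .var vm + .var vx) (.var vx))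

/-- The out-degrees. -/
def degrees : Stmt := .loop ve (.var vM)
  (.write aDeg (.read aSrc (.var ve)) (.read aDeg (.read aSrc (.var ve)) + .const 1))

/-- The adjacency matrix. -/
def adjacency : Stmt := .loop ve (.var vM)
  (.write aAdj (.read aSrc (.var ve) * .var vn + .read aDst (.var ve)) (.const 1))

/-- The power `r ^ k`. -/
def powK (r : ℕ) : Stmt := .write aPow (.const 0) (.const 1) ;;
  .loop vx (.var vk) (.write aPow (.const 0) (.const r * .read aPow (.const 0)))

/-- The table of `spread`. -/
def spreads (N : ℕ) : Stmt := .loop vx (.var vb) (.write aSpr (.var vx)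
  (.read aSpr (.var vx / .const N) * .const (N * N) + .var vx % .const N))

/-- An integer constant. -/
def intExpr (z : ℤ) : Expr := if 0 ≤ z then .const z.toNat else .negOne * .const z.natAbs

/-- The value of `intExpr`. -/
def intEnc (w : ℕ) (z : ℤ) : ℕ := if 0 ≤ z then z.toNat else (2 ^ w - 1) * z.natAbs

/-- Write a table of integers. -/
def initArr (A : ℕ) (z : ℕ → ℤ) : ℕ → Stmt
  | 0 => .skip
  | l + 1 => initArr A z l ;; .write A (.const l) (intExpr (z l))

/-- Negative numbers are represented by multiples of `2 ^ w - 1`, which is `-1` modulo `2 ^ w`. -/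
theorem cast_intEnc (w : ℕ) (z : ℤ) : (intEnc w z : ZMod (2 ^ w)) = z := by
  rw [intEnc]
  split_ifs with h
  · rw [← Int.cast_natCast, Int.toNat_of_nonneg h]
  · have h1 : ((2 ^ w - 1 : ℕ) : ZMod (2 ^ w)) = -1 := by
      rw [Nat.cast_sub Nat.one_le_two_pow, ZMod.natCast_self]
      simp
    rw [Nat.cast_mul, h1]
    have h2 : (z.natAbs : ℤ) = -z := by omega
    rw [← Int.cast_natCast, h2]
    push_cast
    ring

section

variable {w : ℕ} {M : Machine w} {env : Env} {σ : State} {t : ℕ} {Q : State → Prop}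

/-- The tables are written out in the program as constants; their lengths depend on `N` and `r` but
not on the input. -/
theorem runs_initArr {A : ℕ} {z : ℕ → ℤ} (hA : 0 < A ∧ A < numArrays) : ∀ {l t : ℕ} {Q : State → Prop}
    (_ : l ≤ M.lim) (_ : l * 20 ≤ t)
    (_ : Q (σ.set A (setOn (· < l) (fun i => intEnc w (z i)) (σ A)))),
    Runs M (initArr A z l) env σ t Q
  | 0, t, Q, _, _, hQ => (Runs.skip (by simpa [setOn_false] using hQ)).mono (by omega) fun _ h => h
  | l + 1, t, Q, hl, ht, hQ => by
    refine (Runs.seq (t' := 20) (R := Q) (runs_initArr hA (by omega) le_rfl rfl (Q := (· = _)))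
      ?_).mono (by omega) (fun _ h => h)
    rintro _ rfl
    refine (Runs.write hA (by simp) ?_ (by simp; omega) ?_).mono ?_ (fun _ h => h)
    · rw [intExpr]; split_ifs <;> simp
    · convert hQ using 1
      rw [State.set_set, State.set_self]
      congr 1
      funext i
      have hv : Expr.eval M env (σ.set A (setOn (· < l) (fun i => intEnc w (z i)) (σ A)))
          (intExpr (z l)) = intEnc w (z l) := by
        rw [intExpr, intEnc]; split_ifs <;> simp
      rw [hv]
      simp only [Expr.eval_const]
      rcases lt_trichotomy i l with hi | rfl | hi
      · rw [update_of_ne hi.ne, setOn_pos (P := (· < l)) hi,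
          setOn_pos (P := (· < l + 1)) (show i < l + 1 by omega)]
      · rw [update_self, setOn_pos (P := (· < i + 1)) (show i < i + 1 by omega)]
      · rw [update_of_ne hi.ne', setOn_neg (P := (· < l)) (show ¬ i < l by omega),
          setOn_neg (P := (· < l + 1)) (show ¬ i < l + 1 by omega)]
    · rw [intExpr]; split_ifs <;> simp

/-- The language has no unbounded loop, so `n` rounds are made although `Nat.clog B n` suffice. Once
the power has reached the bound the test fails and nothing changes. -/
theorem runs_powLoop {base bound : Expr} {B n : ℕ} (hB : 2 ≤ B) (hx : env vx = none)
    (h1 : ∀ k τ, base.ok M (env.bind vx k) τ ∧ base.eval M (env.bind vx k) τ = B)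
    (h2 : ∀ k τ, bound.ok M (env.bind vx k) τ ∧ bound.eval M (env.bind vx k) τ = n)
    (h3 : ∀ τ, bound.ok M env τ ∧ bound.eval M env τ = n) (hn : n < 2 ^ w) (hlim : 0 < M.lim)
    (hBn : B ^ Nat.clog B n < 2 ^ w)
    (ht : n * (base.len + bound.len + 56 + 4) + bound.len + 30 ≤ t)
    (hQ : ∀ σ', Agree [aPow, aExp] σ σ' → σ' aPow 0 = B ^ Nat.clog B n →
      σ' aExp 0 = Nat.clog B n → Q σ') :
    Runs M (powLoop base bound) env σ t Q := by
  refine (Runs.seq (t' := n * (base.len + bound.len + 56 + 4) + bound.len + 20) (R := Q) (Runs.write (by decide) (by simp) (by simp)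
    (by simpa using hlim) rfl (Q := (· = σ.set aPow (update (σ aPow) 0 1)))) ?_).mono
    (by simp; omega) (fun _ h => h)
  rintro _ rfl
  refine (Runs.seq (t' := n * (base.len + bound.len + 56 + 4) + bound.len + 10) (R := Q) (Runs.write (by decide) (by simp) (by simp)
    (by simpa using hlim) rfl (Q := (· = State.set _ aExp (update _ 0 0)))) ?_).mono
    (by simp; omega) (fun _ h => h)
  rintro _ rfl
  have hcl : Nat.clog B n ≤ n := by
    rw [Nat.clog_le_iff_le_pow (by omega)]
    exact (Nat.lt_pow_self (by omega)).le
  -- The minimum in the invariant expresses that the power stops growing.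
  refine (Runs.loop (t := base.len + bound.len + 56) (fun j τ => Agree [aPow, aExp] σ τ ∧
    τ aPow 0 = B ^ min j (Nat.clog B n) ∧ τ aExp 0 = min j (Nat.clog B n)) hx (h3 _).1
    (by rw [(h3 _).2]; exact hn) ?_ ?_).mono (by rw [(h3 _).2]; omega) ?_
  · exact ⟨(agree_set _ _ (by simp)).trans (agree_set _ _ (by simp)), by simp, by simp⟩
  · rw [(h3 _).2]
    rintro j hj τ ⟨e1, e2, e3⟩
    have hlt : B ^ min j (Nat.clog B n) < 2 ^ w :=
      lt_of_le_of_lt (Nat.pow_le_pow_right (by omega) (min_le_right _ _)) hBn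
    refine (Runs.ifLt (t := base.len + 45) (by simpa [numArrays] using hlim) (h2 _ _).1
      (by simpa [e2] using hlt) (by rw [(h2 _ _).2]; exact hn) (fun h => ?_) (fun h => ?_)).mono
      (by simp; omega) (fun _ h => h)
    · have h' : j < Nat.clog B n := by
        rw [(h2 _ _).2, Expr.eval_read, Expr.eval_const, e2,
          ← Nat.lt_clog_iff_pow_lt (by omega)] at h
        omega
      refine (Runs.seq (t' := 20) (Runs.write (by decide) (by simp) (by simp [h1, numArrays, hlim])
        (by simpa using hlim) rfl (Q := (· = State.set _ aPow (update _ 0 _)))) ?_).mono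
        (by simp; omega) (fun _ h => h)
      rintro _ rfl
      refine (Runs.write (by decide) (by simp) (by simp [numArrays, hlim]) (by simpa using hlim)
        ?_).mono (by simp) (fun _ h => h)
      refine ⟨(e1.trans (agree_set _ _ (by simp))).trans (agree_set _ _ (by simp)), ?_, ?_⟩
      · simp [(h1 _ _).2, e2, min_eq_left h'.le, min_eq_left (Nat.succ_le_of_lt h'), pow_succ, mul_comm]
      · simp [e3, min_eq_left h'.le, min_eq_left (Nat.succ_le_of_lt h')]
    · have h' : Nat.clog B n ≤ j := by
        rw [(h2 _ _).2, Expr.eval_read, Expr.eval_const, e2,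
          ← Nat.lt_clog_iff_pow_lt (by omega)] at h
        omega
      rw [min_eq_right h'] at e2 e3
      rw [min_eq_right (by omega)]
      exact ⟨e1, e2, e3⟩
  · rw [(h3 _).2, min_eq_right hcl]
    rintro τ ⟨e1, e2, e3⟩
    exact hQ τ e1 e2 e3

/-- The number of used words equals the loop variable, so cell `i` receives the `i`-th random word.
The hash values thus become coordinates of the random sequence. -/
theorem runs_drawWords {n K : ℕ} (hx : env vx = none) (hn : env vn = some n) (hK : env vK = some K)
    (hnK : n * K < M.lim) (h0 : σ 0 0 = 0) (ht : n * K * 20 + 20 ≤ t)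
    (hQ : ∀ σ', Agree [0, aRnd] σ σ' → (∀ i < n * K, σ' aRnd i = (M.ρ i).toNat) → Q σ') :
    Runs M drawWords env σ t Q := by
  refine (Runs.loop (t := 9) (fun j τ => Agree [0, aRnd] σ τ ∧ τ 0 0 = j ∧
    ∀ i < j, τ aRnd i = (M.ρ i).toNat) hx (by simp [hn, hK])
    (by simpa [hn, hK] using M.lt_two_pow hnK) ⟨Agree.refl _ _, h0, by simp⟩ ?_).mono
    (by simp [hn, hK]; omega) ?_
  · simp only [Expr.eval_mul, Expr.eval_var, hn, hK, Option.getD_some]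
    rintro j hj τ ⟨e1, e2, e3⟩
    refine (Runs.rand (by decide) (by simp) (by simp; omega) ⟨?_, ?_, fun i hi => ?_⟩).mono
      (by simp) (fun _ h => h)
    · exact (e1.trans (agree_set _ _ (by simp))).trans (agree_set _ _ (by simp))
    · simp [e2]
    · rw [State.set_of_ne _ _ (by decide), State.set_self]
      simp only [Expr.eval_var, Env.bind_self, Option.getD_some, e2]
      rcases Nat.lt_succ_iff_lt_or_eq.1 hi with hi | rfl
      · rw [update_of_ne hi.ne, e3 i hi]
      · rw [update_self]
  · simp only [Expr.eval_mul, Expr.eval_var, hn, hK, Option.getD_some]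
    rintro τ ⟨e1, -, e3⟩
    exact hQ τ e1 e3

/-- The sources of the arcs. -/
def arcSrc (inp : ℕ → ℕ) (m e : ℕ) : ℕ := if e < 2 * m then inp (2 + e) else e - 2 * m

/-- The targets of the arcs. -/
def arcDst (inp : ℕ → ℕ) (m e : ℕ) : ℕ :=
  if e < 2 * m then inp (2 + (e / 2 * 2 + (e + 1) % 2)) else e - 2 * m

theorem runs_arcs {n m : ℕ} (he : env ve = none) (hx : env vx = none) (hn : env vn = some n)
    (hm : env vm = some m) (hlim : 2 * m + n + 2 < M.lim) (hbase : M.base = 2 + 2 * m)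
    (ht : m * 120 + n * 60 + 60 ≤ t)
    (hQ : ∀ σ', Agree [aSrc, aDst] σ σ' → (∀ e < 2 * m + n, σ' aSrc e = arcSrc M.inp m e) →
      (∀ e < 2 * m + n, σ' aDst e = arcDst M.inp m e) → Q σ') :
    Runs M arcs env σ t Q := by
  have hw : M.lim ≤ 2 ^ w := le_of_not_gt fun h => lt_irrefl _ (M.lt_two_pow h)
  refine (Runs.seq (t := 2 * m * (13 + 4) + 15) (t' := m * 80 + n * 60 + 40) (R := Q) (Sets.runs (A := aSrc)
    (P := fun i => ∃ e < 2 * m, i = e) (v := arcSrc M.inp m) (Sets.loop (t := 13) he (by simp [hm])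
    (by simp [hm]) (by omega) fun e hle g _ => ?_) (by simp) rfl (Q := (· = _))) ?_).mono (by omega)
    (fun _ h => h)
  · refine (Sets.write (by decide) (by simp) (by simp; omega) (by simp; omega) ?_).mono (by simp)
      (by simp) (fun _ _ => rfl)
    simp [arcSrc, hle]
  rintro σ₁ h1
  refine (Runs.seq (t := 2 * m * (31 + 4) + 10) (t' := n * 60 + 30) (R := Q) (Sets.runs (A := aDst)
    (P := fun i => ∃ e < 2 * m, i = e) (v := arcDst M.inp m) (Sets.loop (t := 31) he (by simp [hm])
    (by simp [hm]) (by omega) fun e hle g _ => ?_) (by simp) rfl (Q := (· = _))) ?_).mono (by omega)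
    (fun _ h => h)
  · refine (Sets.write (by decide) (by simp) (by simp; omega) (by simp; omega) ?_).mono (by simp)
      (by simp) (fun _ _ => rfl)
    simp [arcDst, hle]
  rintro σ₂ h2
  refine (Runs.seq (t := n * (15 + 4) + 7) (t' := n * 30 + 10) (R := Q) (Sets.runs (A := aSrc)
    (P := fun i => ∃ e < n, i = 2 * m + e) (v := arcSrc M.inp m) (Sets.loop (t := 15) hx (by simp [hn])
    (by simp [hn]) (by omega) fun e hle g _ => ?_) (by simp) rfl (Q := (· = _))) ?_).mono (by omega)
    (fun _ h => h)
  · refine (Sets.write (by decide) (by simp [hm]) (by simp) (by simp [hm]; omega) ?_).mono (by simp)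
      (by simp [hm]) (fun _ _ => rfl)
    simp [arcSrc, hm]
  rintro σ₃ h3
  refine Sets.runs (A := aDst)
    (P := fun i => ∃ e < n, i = 2 * m + e) (v := arcDst M.inp m) (Sets.loop (t := 15) hx (by simp [hn])
    (by simp [hn]) (by omega) fun e hle g _ => ?_) (by simp; omega) (hQ _ ?_ ?_ ?_)
  · refine (Sets.write (by decide) (by simp [hm]) (by simp) (by simp [hm]; omega) ?_).mono (by simp)
      (by simp [hm]) (fun _ _ => rfl)
    simp [arcDst, hm]
  · rw [h3, h2, h1]
    exact (((agree_set _ _ (by simp)).trans (agree_set _ _ (by simp))).trans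
      (agree_set _ _ (by simp))).trans (agree_set _ _ (by simp))
  · intro e hlt
    rw [State.set_of_ne _ _ (by decide), h3, State.set_self, h2, State.set_of_ne _ _ (by decide), h1,
      State.set_self]
    simp only [setOn]
    split_ifs with h4 h5
    · rfl
    · rfl
    · exact absurd ⟨e - 2 * m, by have := mt (fun h => (⟨e, h, rfl⟩ : ∃ e' < 2 * m, e = e')) h5; omega,
        by have := mt (fun h => (⟨e, h, rfl⟩ : ∃ e' < 2 * m, e = e')) h5; omega⟩ h4
  · intro e hlt
    rw [State.set_self, h3, State.set_of_ne _ _ (by decide), h2, State.set_self]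
    simp only [setOn]
    split_ifs with h4 h5
    · rfl
    · rfl
    · exact absurd ⟨e - 2 * m, by have := mt (fun h => (⟨e, h, rfl⟩ : ∃ e' < 2 * m, e = e')) h5; omega,
        by have := mt (fun h => (⟨e, h, rfl⟩ : ∃ e' < 2 * m, e = e')) h5; omega⟩ h4

theorem runs_degrees {n m : ℕ} {src : ℕ → ℕ} (he : env ve = none) (hM : env vM = some m)
    (hm : m < M.lim) (hn : n ≤ M.lim) (hs : ∀ e < m, σ aSrc e = src e) (hsn : ∀ e < m, src e < n)
    (h0 : σ aDeg = fun _ => 0) (ht : m * 60 + 20 ≤ t)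
    (hQ : Q (σ.set aDeg fun x => Nat.count (fun e => src e = x) m)) :
    Runs M degrees env σ t Q := by
  refine (Runs.loop (t := 50) (fun j τ => τ = σ.set aDeg fun x => Nat.count (fun e => src e = x) j)
    he (by simp [hM]) (by simpa [hM] using M.lt_two_pow hm) ?_ ?_).mono (by simp [hM]; omega) ?_
  · simp only [Nat.count_zero]
    rw [← h0, State.set_eq_self]
  · simp only [Expr.eval_var, hM, Option.getD_some]
    rintro j hj _ rfl
    have h1 := hs j hj
    have h2 := hsn j hj
    refine (Runs.write (by decide) (by simp [numArrays]; omega) ?_ ?_ ?_).mono (by simp)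
      (fun _ h => h)
    · simp [numArrays, h1]; omega
    · simp [h1]; omega
    · rw [State.set_set, State.set_self]
      congr 1
      funext x
      simp only [Expr.eval_read, Expr.eval_var, Env.bind_self, Option.getD_some, Expr.eval_add,
        State.set_self, State.set_of_ne σ _ (show aSrc ≠ aDeg by decide), h1, Expr.eval_const]
      by_cases hx : x = src j
      · subst hx; simp [Nat.count_succ]
      · rw [update_of_ne hx, Nat.count_succ, if_neg (Ne.symm hx), add_zero]
  · simp only [Expr.eval_var, hM, Option.getD_some]
    rintro _ rfl
    exact hQ

/-- Only the ones are written. The zeros are there from the start, so the `n * n` cells cost no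
time; filling them would exceed the time bound. -/
theorem runs_adjacency {n m : ℕ} {src dst : ℕ → ℕ} (he : env ve = none) (hn : env vn = some n)
    (hM : env vM = some m) (hm : m < M.lim) (hnl : n * n ≤ M.lim)
    (hs : ∀ e < m, σ aSrc e = src e) (hd : ∀ e < m, σ aDst e = dst e) (hsn : ∀ e < m, src e < n)
    (hdn : ∀ e < m, dst e < n) (ht : m * 60 + 20 ≤ t)
    (hQ : Q (σ.set aAdj (setOn (fun i => ∃ e < m, i = src e * n + dst e) (fun _ => 1) (σ aAdj)))) :
    Runs M adjacency env σ t Q := by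
  refine Sets.runs (Sets.loop (t := 50) he (by simp [hM]) (by simp [hM]) (M.lt_two_pow hm)
    fun e hle g _ => ?_) (by simp; omega) hQ
  have h1 := hs e hle
  have h2 := hsn e hle
  have h3 := hd e hle
  have h4 := hdn e hle
  have h5 : src e * n + dst e < n * n := by nlinarith
  have h6 : n * 1 ≤ n * n := Nat.mul_le_mul_left _ (by omega)
  refine (Sets.write (by decide) ?_ (by simp) ?_ (by simp)).mono (by simp) (by simp [hn, h1, h3])
    (fun _ _ => rfl)
  · simp [numArrays, hn]; omega
  · simp [hn, h1, h3]; omega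

theorem runs_powK {k r : ℕ} (hx : env vx = none) (hk : env vk = some k) (hkl : k < M.lim)
    (ht : k * 40 + 30 ≤ t) (hQ : ∀ σ', Agree [aPow] σ σ' → σ' aPow 0 = r ^ k → Q σ') :
    Runs M (powK r) env σ t Q := by
  refine (Runs.seq (t' := k * 40 + 20) (R := Q) (Runs.write (by decide) (by simp) (by simp)
    (by simp; omega) rfl (Q := (· = σ.set aPow (update (σ aPow) 0 1)))) ?_).mono
    (by simp; omega) (fun _ h => h)
  rintro _ rfl
  refine (Runs.loop (t := 30) (fun j τ => Agree [aPow] σ τ ∧ τ aPow 0 = r ^ j) hx (by simp [hk])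
    (by simpa [hk] using M.lt_two_pow hkl) ⟨agree_set _ _ (by simp), by simp⟩ ?_).mono
    (by simp [hk]; omega) ?_
  · rintro j hj τ ⟨e1, e2⟩
    refine (Runs.write (by decide) (by simp) (by simp [numArrays]; omega) (by simp; omega)
      ⟨e1.trans (agree_set _ _ (by simp)), ?_⟩).mono (by simp) (fun _ h => h)
    simp [e2, pow_succ, mul_comm]
  · simp only [Expr.eval_var, hk, Option.getD_some]
    rintro τ ⟨e1, e2⟩
    exact hQ τ e1 e2

/-- The table is filled by the recursion `spread_eq`. The entry at `0` is computed from itself,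
which is why it has to be `0` beforehand. -/
theorem runs_spreads {N b : ℕ} (hN : 2 ≤ N) (hx : env vx = none) (hb : env vb = some b)
    (hbl : b < M.lim) (hNl : N < 2 ^ w) (h0 : σ aSpr 0 = 0) (ht : b * 40 + 20 ≤ t)
    (hQ : ∀ σ', Agree [aSpr] σ σ' → (∀ x < b, σ' aSpr x = spread N x) → Q σ') :
    Runs M (spreads N) env σ t Q := by
  have hw := M.lt_two_pow hbl
  refine (Runs.loop (t := 30) (fun j τ => Agree [aSpr] σ τ ∧ τ aSpr 0 = 0 ∧
    ∀ x < j, τ aSpr x = spread N x) hx (by simp [hb])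
    (by simpa [hb] using hw) ⟨Agree.refl _ _, h0, by simp⟩ ?_).mono
    (by simp [hb]; omega) ?_
  · simp only [Expr.eval_var, hb, Option.getD_some]
    rintro j hj τ ⟨e1, e2, e3⟩
    have hdiv : j / N ≤ j := Nat.div_le_self _ _
    have hval : τ aSpr (j / N) * (N * N) + j % N = spread N j := by
      rcases Nat.eq_zero_or_pos j with rfl | hj0
      · simp [e2, spread]
      · rw [e3 _ (Nat.div_lt_self hj0 hN), ← spread_eq hN]
    refine (Runs.write (by decide) (by simp) (by simp [numArrays]; omega) (by simp; omega)
      ⟨e1.trans (agree_set _ _ (by simp)), ?_, fun x hx => ?_⟩).mono (by simp) (fun _ h => h)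
    · simp only [Expr.eval_var, Env.bind_self, Option.getD_some, Expr.eval_add, Expr.eval_mul,
        Expr.eval_read, Expr.eval_div, Expr.eval_mod, Expr.eval_const, hval, State.set_self]
      by_cases hj0 : j = 0
      · subst hj0; simp [spread]
      · rw [update_of_ne (Ne.symm hj0), e2]
    · simp only [Expr.eval_var, Env.bind_self, Option.getD_some, Expr.eval_add, Expr.eval_mul,
        Expr.eval_read, Expr.eval_div, Expr.eval_mod, Expr.eval_const, hval, State.set_self]
      rcases Nat.lt_succ_iff_lt_or_eq.1 hx with hx | rfl
      · rw [update_of_ne hx.ne, e3 x hx]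
      · rw [update_self]
  · simp only [Expr.eval_var, hb, Option.getD_some]
    rintro τ ⟨e1, -, e3⟩
    exact hQ τ e1 e3

end

end WordRAM

/-! ### The whole algorithm -/

namespace WordRAM

open Function

/-- The whole algorithm. -/
def main (N r c : ℕ) (ca cb cc : ℕ → ℤ) : Stmt :=
  .bind vn (.inp (.const 0)) (.bind vm (.inp (.const 1)) (.ifLt (.const 1) (.var vn)
    (powLoop (.const 2) (.var vn) ;;
    .bind vL (.read aExp (.const 0)) (.bind vK (.const 2 * .var vL + .const c)
      (.bind vM (.const 2 * .var vm + .var vn)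
        (drawWords ;; arcs ;; degrees ;; adjacency ;;
        selectDeg ((.var vn + .const 1) / .const 2) (.var vn + .const 1) aIdxH aLstL ;;
        .bind vh (.read aCnt (.const 0))
          (powLoop (.const N) (.var vh) ;;
          .bind vb (.read aPow (.const 0)) (.bind vk (.read aExp (.const 0))
            (powK r ;;
            .bind vrk (.read aPow (.const 0))
              (spreads N ;; initArr aCA ca (r * (N * N)) ;; initArr aCB cb (r * (N * N)) ;;
              initArr aCC cc (N * N * r) ;; .write aD (.const 0) (.const 1) ;;
              .loop vlev (.var vL + .const 1) (level N r)))))))))))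

/-- The out-degree of a vertex. -/
def arcDeg (inp : ℕ → ℕ) (n m x : ℕ) : ℕ := Nat.count (fun e => arcSrc inp m e = x) (2 * m + n)

/-- Vertices of high degree. -/
def IsHeavy (inp : ℕ → ℕ) (n m x : ℕ) : Prop :=
  (n + 1) / 2 ≤ arcDeg inp n m x ∧ arcDeg inp n m x < n + 1

instance (inp : ℕ → ℕ) (n m : ℕ) : DecidablePred (IsHeavy inp n m) := fun _ => instDecidableAnd

/-- The instance for a given input. -/
noncomputable def graphInst (w N r c n m : ℕ) (inp rnd : ℕ → ℕ) (ca cb cc : ℕ → ℤ) : Inst where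
  N := N
  r := r
  n := n
  m := m
  K := 2 * Nat.clog 2 n + c
  M := 2 * m + n
  h := Nat.count (IsHeavy inp n m) n
  k := Nat.clog N (Nat.count (IsHeavy inp n m) n)
  L := Nat.clog 2 n
  src := arcSrc inp m
  dst := arcDst inp m
  dg := arcDeg inp n m
  adj := setOn (fun i => ∃ e < 2 * m + n, i = arcSrc inp m e * n + arcDst inp m e) (fun _ => 1)
    (fun _ => 0)
  rnd := rnd
  hv := Nat.nth (IsHeavy inp n m)
  ca i := intEnc w (ca i)
  cb i := intEnc w (cb i)
  cc i := intEnc w (cc i)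

section

variable {w : ℕ} {M : Machine w} {env : Env} {σ : State} {t a : ℕ} {Q R : State → Prop}

/-- This form, with the time that remains, avoids guessing a bound for every tail of a long
sequence. -/
theorem Runs.seq_le {s s' : Stmt} (h : Runs M s env σ a Q) (ha : a ≤ t)
    (h' : ∀ σ', Q σ' → Runs M s' env σ' (t - a) R) : Runs M (s ;; s') env σ t R :=
  (Runs.seq h h').mono (by omega) fun _ h => h

theorem Runs.bind_le {x k : ℕ} {e : Expr} {s : Stmt} (hx : env x = none) (he : e.ok M env σ)
    (hk : e.eval M env σ = k) (ht : e.len + 2 ≤ t)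
    (h : Runs M s (env.bind x k) σ (t - (e.len + 2)) Q) : Runs M (.bind x e s) env σ t Q := by
  subst hk
  exact (Runs.bind hx he h).mono (by omega) fun _ h => h

/-- The cost of the first phase. -/
def Inst.preCost (I : Inst) : ℕ := I.n * 600 + I.n * I.K * 20 + I.M * 300 + I.h * 200 +
  I.k * 100 + I.b * 50 + I.r * (I.N * I.N) * 70 + 1000

-- The first phase builds the arrays demanded by `Inst.Has`; the loop over the levels then keeps
-- `Inst.Has` and collects the disjunction of `Found`. The instance is specified from the input in
-- advance, and each computed value is matched with its field.
set_option maxHeartbeats 4000000 in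
theorem runs_main {N r c n m D₀ C : ℕ} {ca cb cc : ℕ → ℤ} {I : Inst}
    (hIdef : I = graphInst w N r c n m M.inp (fun i => (M.ρ i).toNat) ca cb cc)
    (hI : I.Valid M) (hE : I.Exact w D₀) (hbase : M.base = 2 + 2 * m) (hn : M.inp 0 = n)
    (hm : M.inp 1 = m)
    (hC : ∀ lev < I.L + 1, I.levelCost (2 ^ lev) (Nat.count (I.InLevel (2 ^ lev)) n) ≤ C) :
    Runs M (main N r c ca cb cc) Env.empty (fun _ _ => 0) (I.preCost + (I.L + 1) * (C + 4))
      (fun σ' => σ' aFlag 0 = setOn (fun _ => ∃ lev < I.L + 1, I.Found (2 ^ lev)) (fun _ => 1)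
        (fun _ => 0) 0) := by
  have hfit := hI.fits
  have hbb := hI.bb_le
  have hnn := hI.nn_le
  have hnK := hI.nK_le
  have hnltnn := hI.n_lt
  have hb0 := hI.b_pos
  have hw : M.lim ≤ 2 ^ w := le_of_not_gt fun h => lt_irrefl _ (M.lt_two_pow h)
  have hK1 := hI.one_le_K
  have hnK' : I.n * I.K ≤ 8 * I.n * I.K := Nat.mul_le_mul_right _ (by omega)
  have hnK8 : 8 * I.n * 1 ≤ 8 * I.n * I.K := Nat.mul_le_mul_left _ hK1
  have hbb' : I.b * 1 ≤ I.b * I.b := Nat.mul_le_mul_left _ hb0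
  have hn2 := hI.two_le_n
  have hN2 := hI.two_le_N
  have hhn := hI.h_le_n
  have hnb : I.n + I.b ≤ (I.n + I.b) * (8 * I.n * I.K + I.b) :=
    Nat.le_mul_of_pos_right _ (by omega)
  obtain ⟨y1, y2, y3, y4⟩ := hI.r_le_yl
  obtain ⟨y5, y6⟩ := hI.yl_lt
  have hNN : I.N * 1 ≤ I.N * I.N := Nat.mul_le_mul_left _ (by omega)
  have dN : I.N = N := by rw [hIdef]; rfl
  have dr : I.r = r := by rw [hIdef]; rfl
  have dn : I.n = n := by rw [hIdef]; rfl
  have dK : I.K = 2 * I.L + c := by rw [hIdef]; rfl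
  have dM : I.M = 2 * m + n := by rw [hIdef]; rfl
  have dm : I.m = m := by rw [hIdef]; rfl
  have dL : I.L = Nat.clog 2 n := by rw [hIdef]; rfl
  have dh : I.h = Nat.count (IsHeavy M.inp n m) n := by rw [hIdef]; rfl
  have dk : I.k = Nat.clog N I.h := by rw [hIdef]; rfl
  have dsrc : I.src = arcSrc M.inp m := by rw [hIdef]; rfl
  have ddst : I.dst = arcDst M.inp m := by rw [hIdef]; rfl
  have ddg : I.dg = arcDeg M.inp n m := by rw [hIdef]; rfl
  have dadj : I.adj = setOn (fun i => ∃ e < I.M, i = I.src e * n + I.dst e) (fun _ => 1)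
    (fun _ => 0) := by rw [hIdef]; rfl
  have drnd : ∀ i, I.rnd i = (M.ρ i).toNat := by rw [hIdef]; intro; rfl
  have dhv : I.hv = Nat.nth (IsHeavy M.inp n m) := by rw [hIdef]; rfl
  have dca : ∀ i, I.ca i = intEnc w (ca i) := by rw [hIdef]; intro; rfl
  have dcb : ∀ i, I.cb i = intEnc w (cb i) := by rw [hIdef]; intro; rfl
  have dcc : ∀ i, I.cc i = intEnc w (cc i) := by rw [hIdef]; intro; rfl
  -- The last level is `Nat.clog 2 n`, whose power is less than `2 * n` as the preceding one is less
  -- than `n`.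
  have hpow : ∀ lev < I.L + 1, 2 ^ lev ≤ 2 * I.n := by
    intro lev hlev
    rcases Nat.eq_zero_or_pos lev with rfl | h0
    · simp; omega
    · have h1 : lev - 1 < Nat.clog 2 n := by omega
      rw [Nat.lt_clog_iff_pow_lt (by omega)] at h1
      have : 2 ^ lev = 2 * 2 ^ (lev - 1) := by rw [← pow_succ']; congr 1; omega
      omega
  clear hIdef
  obtain rfl := dn
  obtain rfl := dN
  obtain rfl := dr
  obtain rfl := dm
  generalize ht : I.preCost + (I.L + 1) * (C + 4) = t
  replace ht := ht.le
  have hp : I.preCost = I.n * 600 + I.n * I.K * 20 + I.M * 300 + I.h * 200 +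
    I.k * 100 + I.b * 50 + I.r * (I.N * I.N) * 70 + 1000 := rfl
  refine Runs.bind_le (k := I.n) rfl (by simp; omega) (by simpa using hn) (by simp; omega) ?_
  refine Runs.bind_le (k := I.m) rfl (by simp; omega) (by simpa using hm) (by simp; omega) ?_
  simp only [Expr.len_inp, Expr.len_const]
  refine (Runs.ifLt (t := t - 20) (by simp) (by simp) (by rw [Expr.eval_const]; omega) (by simp; omega) (fun _ => ?_)
    (fun h => absurd h (by simp; omega))).mono (by simp; omega) (fun _ h => h)
  refine Runs.seq_le (runs_powLoop (B := 2) (n := I.n) le_rfl (by simp [Env.empty]) (by simp)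
    (by simp) (by simp) (by omega) (by omega) (by rw [← dL]; have := hpow I.L (by omega); omega)
    le_rfl (Q := fun τ => Agree [aPow, aExp] (fun _ _ => 0) τ ∧ τ aExp 0 = I.L)
    fun τ h1 _ h2 => ⟨h1, h2.trans dL.symm⟩) (by simp; omega) ?_
  rintro σ₁ ⟨a1, hL1⟩
  refine Runs.bind_le (k := I.L) (by simp [Env.empty]) (by simp [numArrays]; omega)
    (by simpa using hL1) (by simp; omega) ?_
  refine Runs.bind_le (k := I.K) (by simp [Env.empty]) (by simp) (by simp [dK]) (by simp; omega) ?_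
  refine Runs.bind_le (k := I.M) (by simp [Env.empty]) (by simp) (by simp [dM]) (by simp; omega) ?_
  simp only [Expr.len_add, Expr.len_mul, Expr.len_const, Expr.len_var, Expr.len_read]
  set E := ((((Env.empty.bind vn I.n).bind vm I.m).bind vL I.L).bind vK I.K).bind vM I.M with hEdef
  have En : E vn = some I.n := rfl
  have Em : E vm = some I.m := rfl
  have EL : E vL = some I.L := rfl
  have EK : E vK = some I.K := rfl
  have EM : E vM = some I.M := rfl
  have Eh : E vh = none := rfl
  have Eb : E vb = none := rfl
  have Ek : E vk = none := rfl
  have Erk : E vrk = none := rfl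
  have E0 : ∀ x, vL < x → E x = none := fun x hx => by
    rw [hEdef]
    repeat rw [Env.bind_of_ne _ _ (by omega)]
    rfl
  clear_value E
  refine Runs.seq_le (runs_drawWords (E0 _ (by decide)) En EK (by omega) (a1 0 (by simp) ▸ rfl) le_rfl
    (Q := fun τ => Agree [0, aRnd, aPow, aExp] (fun _ _ => 0) τ ∧
      ∀ i < I.n * I.K, τ aRnd i = I.rnd i) fun τ h1 h2 => ⟨(a1.mono (by simp)).trans
      (h1.mono (by simp)), fun i hi => (h2 i hi).trans (drnd i).symm⟩) (by omega) ?_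
  rintro σ₂ ⟨a2, hrnd2⟩
  refine Runs.seq_le (runs_arcs (E0 _ (by decide)) (E0 _ (by decide)) En Em (by omega) hbase le_rfl
    (Q := fun τ => Agree [aSrc, aDst] σ₂ τ ∧ (∀ e < I.M, τ aSrc e = I.src e) ∧
      ∀ e < I.M, τ aDst e = I.dst e) fun τ h1 h2 h3 => ⟨h1, ?_, ?_⟩) (by omega) ?_
  · rw [dM, dsrc]; exact h2
  · rw [dM, ddst]; exact h3
  rintro σ₃ ⟨a3, hsrc3, hdst3⟩
  refine Runs.seq_le (runs_degrees (n := I.n) (E0 _ (by decide)) EM (by omega) (by omega) hsrc3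
    hI.src_lt (by rw [a3 aDeg (by simp), a2 aDeg (by simp)]) le_rfl (Q := (· = _)) rfl) (by omega) ?_
  rintro σ₄ h4
  refine Runs.seq_le (runs_adjacency (E0 _ (by decide)) En EM (by omega) (by omega)
    (by rw [h4]; exact hsrc3) (by rw [h4]; exact hdst3) hI.src_lt hI.dst_lt le_rfl rfl
    (Q := (· = _))) (by omega) ?_
  rintro σ₅ h5
  have hadj5 : σ₅ aAdj = I.adj := by
    rw [h5, State.set_self, dadj, h4, State.set_of_ne _ _ (by decide), a3 aAdj (by simp),
      a2 aAdj (by simp)]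
  have hdeg5 : σ₅ aDeg = I.dg := by
    rw [h5, State.set_of_ne _ _ (by decide), h4, State.set_self, ddg]
    funext x
    rw [arcDeg, ← dM, ← dsrc]
  have a5 : Agree [aAdj, aDeg] σ₃ σ₅ := by
    rw [h5]
    refine Agree.trans ?_ (agree_set _ _ (by simp))
    rw [h4]
    exact agree_set _ _ (by simp)
  clear h4 h5
  -- The upper end `n + 1` excludes nothing, since degrees are at most `n`.
  refine Runs.seq_le (runs_selectDeg (I := I) (Or.inr ⟨rfl, rfl⟩) En (E0 _ (by decide)) (by omega)
    (fun x _ => by rw [hdeg5]) hI.dg_le (a := (I.n + 1) / 2) (b := I.n + 1) (by simp [En]; omega)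
    (by simp [En]) (by omega) (by omega) le_rfl
    (Q := fun τ => Agree [aIdxH, aLstL, aCnt] σ₅ τ ∧ τ aCnt 0 = I.h ∧ ∀ x < I.n,
      IsHeavy M.inp I.n I.m x → τ aLstL (Nat.count (IsHeavy M.inp I.n I.m) x) = x) ?_)
    (by simp; omega) ?_
  · rw [ddg]
    exact fun τ h1 h2 h3 => ⟨h1, h2.trans dh.symm, fun x hx hh => (h3 x hx hh).2⟩
  rintro σ₆ ⟨a6, hh6, hl6⟩
  refine Runs.bind_le (k := I.h) Eh (by simp [numArrays]; omega)
    (by simpa using hh6) (by simp; omega) ?_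
  simp only [Expr.len_add, Expr.len_div, Expr.len_const, Expr.len_var, Expr.len_read]
  refine Runs.seq_le (runs_powLoop (B := I.N) (n := I.h) hN2 (by simp [E0]) (by simp)
    (by simp) (by simp) (by omega) (by omega) (by rw [← dk]; change I.b < _; omega)
    le_rfl (Q := fun τ => Agree [aPow, aExp] σ₆ τ ∧ τ aPow 0 = I.b ∧ τ aExp 0 = I.k)
    fun τ h1 h2 h3 => ⟨h1, by rw [h2, ← dk]; rfl, h3.trans dk.symm⟩) (by simp; omega) ?_
  rintro σ₇ ⟨a7, hb7, hk7⟩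
  simp only [Expr.len_const, Expr.len_var]
  refine Runs.bind_le (k := I.b) (by simp [Eb]) (by simp [numArrays]; omega)
    (by simpa using hb7) (by simp; omega) ?_
  refine Runs.bind_le (k := I.k) (by simp [Ek]) (by simp [numArrays]; omega)
    (by simpa using hk7) (by simp; omega) ?_
  refine Runs.seq_le (runs_powK (k := I.k) (by simp [E0]) (by simp) y6 le_rfl
    (Q := fun τ => Agree [aPow] σ₇ τ ∧ τ aPow 0 = I.r ^ I.k) fun τ h1 h2 => ⟨h1, h2⟩)
    (by simp; omega) ?_
  rintro σ₈ ⟨a8, hr8⟩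
  refine Runs.bind_le (k := I.r ^ I.k) (by simp [Erk]) (by simp [numArrays]; omega)
    (by simpa using hr8) (by simp; omega) ?_
  simp only [Expr.len_read, Expr.len_const]
  rw [show (((E.bind vh I.h).bind vb I.b).bind vk I.k).bind vrk (I.r ^ I.k) = I.env by
    rw [hEdef]; rfl]
  have a38 : Agree [aAdj, aDeg, aIdxH, aLstL, aCnt, aPow, aExp] σ₃ σ₈ :=
    (((a5.mono (by simp)).trans (a6.mono (by simp))).trans (a7.mono (by simp))).trans
      (a8.mono (by simp))
  have a08 : Agree [0, aRnd, aSrc, aDst, aAdj, aDeg, aIdxH, aLstL, aCnt, aPow, aExp] (fun _ _ => 0)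
      σ₈ := ((a2.mono (by simp)).trans (a3.mono (by simp))).trans (a38.mono (by simp))
  refine Runs.seq_le (runs_spreads (b := I.b) hN2 (by simp) (by simp) (by omega) (by omega)
    (by rw [a08 aSpr (by simp)]) le_rfl (Q := fun τ => Agree [aSpr] σ₈ τ ∧
      ∀ x < I.b, τ aSpr x = spread I.N x) fun τ h1 h2 => ⟨h1, h2⟩) (by omega) ?_
  rintro σ₉ ⟨a9, hs9⟩
  have hcomm : I.N * I.N * I.r = I.r * (I.N * I.N) := mul_comm _ _
  refine Runs.seq_le (runs_initArr (by decide) (by omega) le_rfl rfl (Q := (· = _))) (by omega) ?_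
  rintro σ₁₀ h10
  refine Runs.seq_le (runs_initArr (by decide) (by omega) le_rfl rfl (Q := (· = _))) (by omega) ?_
  rintro σ₁₁ h11
  refine Runs.seq_le (runs_initArr (by decide) (by omega) le_rfl rfl (Q := (· = _))) (by omega) ?_
  rintro σ₁₂ h12
  refine Runs.seq_le (Runs.write (by decide) (by simp) (by simp) (by simp; omega) rfl
    (Q := (· = _))) (by simp; omega) ?_
  rintro σ₁₃ h13
  have a13 : Agree [aCA, aCB, aCC, aD] σ₉ σ₁₃ := by
    rw [h13]; refine Agree.trans ?_ (agree_set _ _ (by simp))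
    rw [h12]; refine Agree.trans ?_ (agree_set _ _ (by simp))
    rw [h11]; refine Agree.trans ?_ (agree_set _ _ (by simp))
    rw [h10]; exact agree_set _ _ (by simp)
  have hD13 : σ₁₃ aD 0 = 1 := by rw [h13]; simp
  have hca : ∀ i < I.r * (I.N * I.N), σ₁₃ aCA i = I.ca i := fun i hi => by
    rw [h13, State.set_of_ne _ _ (by decide), h12, State.set_of_ne _ _ (by decide), h11,
      State.set_of_ne _ _ (by decide), h10, State.set_self,
      setOn_pos (P := (· < I.r * (I.N * I.N))) hi, dca]
  have hcb : ∀ i < I.r * (I.N * I.N), σ₁₃ aCB i = I.cb i := fun i hi => by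
    rw [h13, State.set_of_ne _ _ (by decide), h12, State.set_of_ne _ _ (by decide), h11,
      State.set_self, setOn_pos (P := (· < I.r * (I.N * I.N))) hi, dcb]
  have hcc : ∀ i < I.N * I.N * I.r, σ₁₃ aCC i = I.cc i := fun i hi => by
    rw [h13, State.set_of_ne _ _ (by decide), h12, State.set_self,
      setOn_pos (P := (· < I.N * I.N * I.r)) hi, dcc]
  clear h10 h11 h12 h13
  have hHas : I.Has σ₁₃ := by
    have e : ∀ A, A ∉ [aCA, aCB, aCC, aD, aSpr] → σ₁₃ A = σ₈ A := fun A hA => by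
      rw [a13 A (fun h => hA (by simp at h ⊢; tauto)), a9 A (fun h => hA (by simp at h ⊢; tauto))]
    have e' : ∀ A, A ∉ [aCA, aCB, aCC, aD, aSpr, aAdj, aDeg, aIdxH, aLstL, aCnt, aPow, aExp] →
        σ₁₃ A = σ₃ A := fun A hA => by
      rw [e A (fun h => hA (by simp at h ⊢; tauto)), a38 A (fun h => hA (by simp at h ⊢; tauto))]
    refine ⟨?_, ?_, ?_, ?_, ?_, ?_, ?_, hca, hcb, hcc⟩
    · rw [e' _ (by simp)]; exact hsrc3
    · rw [e' _ (by simp)]; exact hdst3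
    · rw [e _ (by simp), a8 _ (by simp), a7 _ (by simp), a6 _ (by simp), hdeg5]; simp
    · rw [e _ (by simp), a8 _ (by simp), a7 _ (by simp), a6 _ (by simp), hadj5]; simp
    · rw [e' _ (by simp), a3 _ (by simp)]; exact hrnd2
    · intro i hi
      rw [dh] at hi
      obtain ⟨x, hx, hh, rfl⟩ := exists_of_lt_count hi
      rw [e _ (by simp), a8 _ (by simp), a7 _ (by simp), hl6 x hx hh, dhv, Nat.nth_count hh]
    · rw [a13 _ (by simp)]; exact hs9
  have hF13 : σ₁₃ aFlag = fun _ => 0 := by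
    rw [a13 _ (by simp), a9 _ (by simp), a08 _ (by simp)]
  -- `aD` holds the lower end of the current range of degrees, and each level doubles it.
  refine (Runs.loop (t := C) (fun j τ => I.Has τ ∧ τ aD 0 = 2 ^ j ∧ τ aFlag =
    setOn (fun p => p = 0 ∧ ∃ lev < j, I.Found (2 ^ lev)) (fun _ => 1) (fun _ => 0)) (by simp)
    (by simp) (by simp; omega) ⟨hHas, by simpa using hD13, by simpa [setOn_false] using hF13⟩ ?_).mono
    (by simp; omega) ?_
  · simp only [Expr.eval_add, Expr.eval_var, Inst.env_vL, Option.getD_some, Expr.eval_const]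
    rintro j hj τ ⟨g1, g2, g3⟩
    refine runs_level hI hE g1 (Nat.two_pow_pos j) (hpow j hj) g2 (hC j hj) fun τ' g4 g5 g6 =>
      ⟨g1.congr g4 (by decide), by rw [g5, pow_succ'], ?_⟩
    rw [g6, g3]
    exact setOn_exists_succ (fun l => I.Found (2 ^ l)) j _ _
  · simp only [Expr.eval_add, Expr.eval_var, Inst.env_vL, Option.getD_some, Expr.eval_const]
    rintro τ ⟨-, -, g3⟩
    rw [g3]
    by_cases h : ∃ lev < I.L + 1, I.Found (2 ^ lev)
    · rw [setOn_pos (P := fun p => p = 0 ∧ _) ⟨rfl, h⟩, setOn_pos (P := fun _ => _) h]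
    · rw [setOn_neg (P := fun p => p = 0 ∧ _) (fun h' => h h'.2), setOn_neg (P := fun _ => _) h]

/-- With fewer than two vertices there is no set of size `2`, and the flag stays at its initial
value `0`. -/
theorem runs_main_small {N r c : ℕ} {ca cb cc : ℕ → ℤ} (hbase : 2 ≤ M.base) (hlim : 1 < M.lim)
    (hn : M.inp 0 < 2) : Runs M (main N r c ca cb cc) Env.empty (fun _ _ => 0) 20
      (fun σ' => σ' aFlag 0 = 0) := by
  have := M.lt_two_pow hlim
  refine Runs.bind_le (k := M.inp 0) rfl (by simp; omega) rfl (by simp) ?_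
  refine Runs.bind_le (k := M.inp 1) rfl (by simp; omega) rfl (by simp) ?_
  refine (Runs.ifLt (t := 0) (Q := fun σ' => σ' aFlag 0 = 0) (by simp) (by simp) (by rw [Expr.eval_const]; omega) (by simp; omega)
    (fun h => ?_) (fun _ => rfl)).mono (by simp) (fun _ h => h)
  simp at h
  omega

end

end WordRAM

namespace WordRAM

open Function

/-! ## The graph -/

section

variable {n : ℕ} {G : SimpleGraph (Fin n)} {L : List (Fin n × Fin n)}

/-- The entries of the input. -/
def inputFun (L : List (Fin n × Fin n)) (i : ℕ) : ℕ := (graphInput L).getD i 0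

theorem length_ends (L : List (Fin n × Fin n)) :
    (L.flatMap fun e => [e.1.val, e.2.val]).length = 2 * L.length := by
  induction L with
  | nil => rfl
  | cons a l ih => rw [List.flatMap_cons, List.length_append, ih]; simp; ring

theorem length_graphInput (L : List (Fin n × Fin n)) :
    (graphInput L).length = 2 + 2 * L.length := by
  rw [graphInput, List.length_cons, List.length_cons, length_ends]
  ring

theorem getD_ends (L : List (Fin n × Fin n)) : ∀ i (h : i < L.length),
    (L.flatMap fun e => [e.1.val, e.2.val]).getD (2 * i) 0 = L[i].1 ∧
      (L.flatMap fun e => [e.1.val, e.2.val]).getD (2 * i + 1) 0 = L[i].2 := by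
  induction L with
  | nil => intro i h; simp at h
  | cons a l ih =>
    intro i h
    rcases i with _ | i
    · simp
    · have := ih i (by simpa using h)
      rw [show 2 * (i + 1) = 2 * i + 1 + 1 by ring]
      simpa using this

theorem inputFun_ends (L : List (Fin n × Fin n)) (i : ℕ) (h : i < L.length) :
    inputFun L (2 + 2 * i) = L[i].1 ∧ inputFun L (2 + (2 * i + 1)) = L[i].2 := by
  have := getD_ends L i h
  rw [inputFun, inputFun, graphInput, show 2 + 2 * i = 2 * i + 1 + 1 by ring,
    show 2 + (2 * i + 1) = 2 * i + 1 + 1 + 1 by ring]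
  simpa using this

/-- The arcs `2 i` and `2 i + 1` are the two orientations of the edge `i`: the index in `arcDst`
exchanges `e` with its partner. -/
theorem arc_of_lt {e : ℕ} (he : e < 2 * L.length) : ∃ h : e / 2 < L.length,
    (e % 2 = 0 ∧ arcSrc (inputFun L) L.length e = L[e / 2].1 ∧
      arcDst (inputFun L) L.length e = L[e / 2].2) ∨
    (e % 2 = 1 ∧ arcSrc (inputFun L) L.length e = L[e / 2].2 ∧
      arcDst (inputFun L) L.length e = L[e / 2].1) := by
  refine ⟨by omega, ?_⟩
  obtain ⟨h1, h2⟩ := inputFun_ends L (e / 2) (by omega)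
  rw [arcSrc, arcDst, if_pos he, if_pos he, ← h1, ← h2]
  rcases Nat.mod_two_eq_zero_or_one e with h | h
  · exact Or.inl ⟨h, by congr 1; omega, by congr 1; omega⟩
  · exact Or.inr ⟨h, by congr 1; omega, by congr 1; omega⟩

theorem arc_of_le {e : ℕ} (he : 2 * L.length ≤ e) :
    arcSrc (inputFun L) L.length e = e - 2 * L.length ∧
      arcDst (inputFun L) L.length e = e - 2 * L.length := by
  rw [arcSrc, arcDst, if_neg (by omega), if_neg (by omega)]
  exact ⟨rfl, rfl⟩

theorem arcSrc_lt {e : ℕ} (he : e < 2 * L.length + n) : arcSrc (inputFun L) L.length e < n := by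
  by_cases h : e < 2 * L.length
  · obtain ⟨_, ⟨_, h1, _⟩ | ⟨_, h1, _⟩⟩ := arc_of_lt h <;> rw [h1] <;> exact Fin.is_lt _
  · rw [(arc_of_le (by omega)).1]; omega

theorem arcDst_lt {e : ℕ} (he : e < 2 * L.length + n) : arcDst (inputFun L) L.length e < n := by
  by_cases h : e < 2 * L.length
  · obtain ⟨_, ⟨_, _, h1⟩ | ⟨_, _, h1⟩⟩ := arc_of_lt h <;> rw [h1] <;> exact Fin.is_lt _
  · rw [(arc_of_le (by omega)).2]; omega

theorem adj_of_mem (hL : IsEdgeList G L) {i : ℕ} (h : i < L.length) : G.Adj L[i].1 L[i].2 :=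
  (hL.2 _ _).1 (List.mem_map.2 ⟨L[i], List.getElem_mem h, rfl⟩)

/-- The loops account for `u = v`, so arcs describe closed rather than open neighbourhoods. -/
theorem exists_arc_iff (hL : IsEdgeList G L) (u v : Fin n) :
    (∃ e < 2 * L.length + n, arcSrc (inputFun L) L.length e = u ∧
      arcDst (inputFun L) L.length e = v) ↔ u = v ∨ G.Adj u v := by
  constructor
  · rintro ⟨e, he, h1, h2⟩
    by_cases h : e < 2 * L.length
    · right
      obtain ⟨h', ⟨_, h3, h4⟩ | ⟨_, h3, h4⟩⟩ := arc_of_lt h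
      · have := adj_of_mem hL h'
        rwa [Fin.ext (h3.symm.trans h1), Fin.ext (h4.symm.trans h2)] at this
      · have := adj_of_mem hL h'
        rw [Fin.ext (h3.symm.trans h1), Fin.ext (h4.symm.trans h2)] at this
        exact this.symm
    · left
      obtain ⟨h3, h4⟩ := arc_of_le (L := L) (e := e) (by omega)
      exact Fin.ext (by rw [← h1, ← h2, h3, h4])
  · rintro (rfl | h)
    · obtain ⟨h3, h4⟩ := arc_of_le (L := L) (e := 2 * L.length + u) (by omega)
      exact ⟨2 * L.length + u, by omega, by rw [h3]; omega, by rw [h4]; omega⟩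
    · obtain ⟨p, hp, hpe⟩ := List.mem_map.1 ((hL.2 u v).2 h)
      obtain ⟨i, hi, rfl⟩ := List.mem_iff_getElem.1 hp
      rcases Sym2.eq_iff.1 hpe with ⟨h1, h2⟩ | ⟨h1, h2⟩
      · refine ⟨2 * i, by omega, ?_⟩
        obtain ⟨h', ⟨_, h3, h4⟩ | ⟨h5, _, _⟩⟩ := arc_of_lt (L := L) (e := 2 * i) (by omega)
        · have : 2 * i / 2 = i := by omega
          rw [h3, h4]
          simp only [this, h1, h2, and_self]
        · omega
      · refine ⟨2 * i + 1, by omega, ?_⟩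
        obtain ⟨h', ⟨h5, _, _⟩ | ⟨_, h3, h4⟩⟩ := arc_of_lt (L := L) (e := 2 * i + 1) (by omega)
        · omega
        · have : (2 * i + 1) / 2 = i := by omega
          rw [h3, h4]
          simp only [this, h1, h2, and_self]

/-- Edges are listed once, and an edge has two different ends; so its two orientations differ from
each other, from those of other edges and from the loops. Without this, out-degrees would not count
neighbours. -/
theorem arc_inj (hL : IsEdgeList G L) {e e' : ℕ}
    (h1 : arcSrc (inputFun L) L.length e = arcSrc (inputFun L) L.length e')
    (h2 : arcDst (inputFun L) L.length e = arcDst (inputFun L) L.length e') : e = e' := by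
  have ne : ∀ {e : ℕ}, e < 2 * L.length →
      arcSrc (inputFun L) L.length e ≠ arcDst (inputFun L) L.length e := by
    intro e he h
    obtain ⟨h', ⟨_, h3, h4⟩ | ⟨_, h3, h4⟩⟩ := arc_of_lt he
    · exact (adj_of_mem hL h').ne (Fin.ext (by rw [← h3, ← h4, h]))
    · exact (adj_of_mem hL h').ne (Fin.ext (by rw [← h3, ← h4, h]))
  have key : ∀ {i j : ℕ} (hi : i < L.length) (hj : j < L.length),
      s(L[i].1, L[i].2) = s(L[j].1, L[j].2) → i = j := by
    intro i j hi hj h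
    refine (List.Nodup.getElem_inj_iff hL.1 (i := i) (j := j) (hi := by simpa) (hj := by simpa)).1 ?_
    simpa using h
  by_cases he : e < 2 * L.length
  · by_cases he' : e' < 2 * L.length
    · obtain ⟨k, ⟨p, h3, h4⟩ | ⟨p, h3, h4⟩⟩ := arc_of_lt he <;>
      obtain ⟨k', ⟨p', h5, h6⟩ | ⟨p', h5, h6⟩⟩ := arc_of_lt he'
      · have e1 : L[e / 2].1 = L[e' / 2].1 := Fin.ext (by rw [← h3, ← h5, h1])
        have e2 : L[e / 2].2 = L[e' / 2].2 := Fin.ext (by rw [← h4, ← h6, h2])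
        have := key k k' (by rw [e1, e2])
        omega
      · have e1 : L[e / 2].1 = L[e' / 2].2 := Fin.ext (by rw [← h3, ← h5, h1])
        have e2 : L[e / 2].2 = L[e' / 2].1 := Fin.ext (by rw [← h4, ← h6, h2])
        have h7 := key k k' (by rw [e1, e2, Sym2.eq_swap])
        simp only [h7] at e1
        exact absurd e1 (adj_of_mem hL k').ne
      · have e1 : L[e / 2].2 = L[e' / 2].1 := Fin.ext (by rw [← h3, ← h5, h1])
        have e2 : L[e / 2].1 = L[e' / 2].2 := Fin.ext (by rw [← h4, ← h6, h2])
        have h7 := key k k' (by rw [e1, e2, Sym2.eq_swap])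
        simp only [h7] at e1
        exact absurd e1.symm (adj_of_mem hL k').ne
      · have e1 : L[e / 2].2 = L[e' / 2].2 := Fin.ext (by rw [← h3, ← h5, h1])
        have e2 : L[e / 2].1 = L[e' / 2].1 := Fin.ext (by rw [← h4, ← h6, h2])
        have := key k k' (by rw [e1, e2])
        omega
    · obtain ⟨h3, h4⟩ := arc_of_le (L := L) (e := e') (by omega)
      exact absurd (by rw [h1, h2, h3, h4]) (ne he)
  · obtain ⟨h3, h4⟩ := arc_of_le (L := L) (e := e) (by omega)
    by_cases he' : e' < 2 * L.length
    · exact absurd (by rw [← h1, ← h2, h3, h4]) (ne he')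
    · obtain ⟨h5, h6⟩ := arc_of_le (L := L) (e := e') (by omega)
      omega

/-- The closed neighbourhood of `u`. -/
def closedNbhd (G : SimpleGraph (Fin n)) (u : Fin n) : Set (Fin n) := {v | u = v ∨ G.Adj u v}

/-- The target maps the arcs leaving `u` bijectively to the closed neighbourhood, by `arc_inj` and
`exists_arc_iff`. -/
theorem ncard_closedNbhd (hL : IsEdgeList G L) (u : Fin n) :
    (closedNbhd G u).ncard = arcDeg (inputFun L) n L.length u := by
  classical
  rw [arcDeg, Nat.count_eq_card_filter_range, Set.ncard_eq_toFinset_card']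
  symm
  refine Finset.card_bij (fun e he => ⟨arcDst (inputFun L) L.length e,
    arcDst_lt (Finset.mem_range.1 (Finset.mem_filter.1 he).1)⟩) ?_ ?_ ?_
  · intro e he
    rw [Finset.mem_filter, Finset.mem_range] at he
    rw [Set.mem_toFinset]
    exact (exists_arc_iff hL _ _).1 ⟨e, he.1, he.2, rfl⟩
  · intro e he e' he' h
    rw [Finset.mem_filter] at he he'
    exact arc_inj hL (he.2.trans he'.2.symm) (Fin.mk.inj_iff.1 h)
  · intro v hv
    obtain ⟨e, he, h1, h2⟩ := (exists_arc_iff hL u v).2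
      (show v ∈ closedNbhd G u from Set.mem_toFinset.1 hv)
    exact ⟨e, Finset.mem_filter.2 ⟨Finset.mem_range.2 he, h1⟩, Fin.ext h2⟩

theorem arcDeg_le (hL : IsEdgeList G L) {u : ℕ} (hu : u < n) :
    arcDeg (inputFun L) n L.length u ≤ n := by
  rw [show u = ((⟨u, hu⟩ : Fin n) : ℕ) from rfl, ← ncard_closedNbhd hL]
  exact (Set.ncard_le_card _).trans (by simp)

/-- Every arc is counted once, at its source. -/
theorem sum_arcDeg : ∑ u ∈ Finset.range n, arcDeg (inputFun L) n L.length u =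
    2 * L.length + n := by
  simp only [arcDeg, Nat.count_eq_card_filter_range]
  rw [← Finset.card_eq_sum_card_fiberwise (f := arcSrc (inputFun L) L.length), Finset.card_range]
  intro e he
  simp only [Finset.coe_range, Set.mem_Iio] at he ⊢
  exact arcSrc_lt he

/-- Markov's inequality for degrees. It bounds the number of heavy vertices, with `a` about `n / 2`,
and the number of vertices of a level, with `a = D`. -/
theorem count_mul_le {p : ℕ → Prop} [DecidablePred p] {a : ℕ}
    (h : ∀ x, p x → a ≤ arcDeg (inputFun L) n L.length x) :
    Nat.count p n * a ≤ 2 * L.length + n := by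
  rw [← sum_arcDeg (L := L), Nat.count_eq_card_filter_range, ← smul_eq_mul]
  refine (Finset.card_nsmul_le_sum _ _ _ fun x hx => h x (Finset.mem_filter.1 hx).2).trans ?_
  exact Finset.sum_le_sum_of_subset (Finset.filter_subset _ _)

end

end WordRAM

/-! ### Dominating pairs and hash collisions -/

namespace WordRAM

open Function

section

variable {n : ℕ} {G : SimpleGraph (Fin n)} {L : List (Fin n × Fin n)} {w N r c : ℕ}
  {rnd : ℕ → ℕ} {ca cb cc : ℕ → ℤ}

theorem length_le_ncard (hL : IsEdgeList G L) : L.length ≤ G.edgeSet.ncard := by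
  classical
  rw [← List.length_map (as := L) (fun e => s(e.1, e.2)), ← List.toFinset_card_of_nodup hL.1,
    ← Set.ncard_coe_finset]
  refine Set.ncard_le_ncard (fun e he => ?_) (Set.toFinite _)
  rw [Finset.mem_coe, List.mem_toFinset] at he
  induction e with
  | _ u v => exact (hL.2 u v).1 he

/-- This bound holds without any assumption on the density, so the word size can be fixed before the
constant `C`. -/
theorem two_mul_length_le (hL : IsEdgeList G L) : 2 * L.length + n ≤ n * n := by
  rw [← sum_arcDeg (L := L)]
  refine (Finset.sum_le_card_nsmul _ _ n fun x hx => arcDeg_le hL (Finset.mem_range.1 hx)).trans ?_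
  simp

theorem hasDominatingSet_two_iff : HasDominatingSet G 2 ↔
    ∃ u v : Fin n, u ≠ v ∧ ∀ x, x ∈ closedNbhd G u ∨ x ∈ closedNbhd G v := by
  simp only [closedNbhd, Set.mem_ofPred_eq]
  constructor
  · rintro ⟨S, hS, h⟩
    obtain ⟨u, v, huv, rfl⟩ := Finset.card_eq_two.1 hS
    refine ⟨u, v, huv, fun x => ?_⟩
    rcases h x with hx | ⟨y, hy, hyx⟩
    · simp only [Finset.mem_insert, Finset.mem_singleton] at hx
      rcases hx with rfl | rfl <;> simp
    · simp only [Finset.mem_insert, Finset.mem_singleton] at hy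
      rcases hy with rfl | rfl <;> simp [hyx]
  · rintro ⟨u, v, huv, h⟩
    refine ⟨{u, v}, Finset.card_pair huv, fun x => ?_⟩
    rcases h x with (rfl | hx) | (rfl | hx)
    · simp
    · exact Or.inr ⟨u, by simp, hx⟩
    · simp
    · exact Or.inr ⟨v, by simp, hx⟩

theorem graphInst_adj (hL : IsEdgeList G L) (u x : Fin n) :
    (graphInst w N r c n L.length (inputFun L) rnd ca cb cc).adj (u * n + x) = 0 ↔
      x ∉ closedNbhd G u := by
  rw [closedNbhd, Set.mem_ofPred_eq, ← exists_arc_iff hL]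
  have : (∃ e < 2 * L.length + n, (u * n + x : ℕ) = arcSrc (inputFun L) L.length e * n +
      arcDst (inputFun L) L.length e) ↔ ∃ e < 2 * L.length + n,
      arcSrc (inputFun L) L.length e = u ∧ arcDst (inputFun L) L.length e = x := by
    refine exists_congr fun e => and_congr_right fun he => ⟨fun h => ?_, fun h => ?_⟩
    · have h1 := congrArg (· / n) h
      have h2 := congrArg (· % n) h
      simp only [mul_add_div_of_lt x.2, mul_add_mod_of_lt x.2, mul_add_div_of_lt (arcDst_lt he),
        mul_add_mod_of_lt (arcDst_lt he)] at h1 h2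
      exact ⟨h1.symm, h2.symm⟩
    · rw [h.1, h.2]
  rw [← this]
  change setOn (fun i => ∃ e < 2 * L.length + n, i = arcSrc (inputFun L) L.length e * n +
    arcDst (inputFun L) L.length e) (fun _ => 1) (fun _ => 0) (u * n + x) = 0 ↔ _
  rw [setOn]
  split_ifs with h <;> simp [h]

theorem arcDeg_pos (u : Fin n) : 0 < arcDeg (inputFun L) n L.length u := by
  obtain ⟨h3, -⟩ := arc_of_le (L := L) (e := 2 * L.length + u) (by omega)
  rw [arcDeg, Nat.count_eq_card_filter_range, Finset.card_pos]
  exact ⟨2 * L.length + u, by simp; omega⟩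

theorem le_sum_arcDeg (hL : IsEdgeList G L) {u v : Fin n}
    (h : ∀ x, x ∈ closedNbhd G u ∨ x ∈ closedNbhd G v) :
    n ≤ arcDeg (inputFun L) n L.length u + arcDeg (inputFun L) n L.length v := by
  rw [← ncard_closedNbhd hL, ← ncard_closedNbhd hL]
  have h1 : closedNbhd G u ∪ closedNbhd G v = Set.univ := Set.eq_univ_of_forall h
  have h2 := Set.ncard_union_le (closedNbhd G u) (closedNbhd G v)
  rwa [h1, Set.ncard_univ, Nat.card_eq_fintype_card, Fintype.card_fin] at h2

/-- If there is a dominating set with two vertices, a pair is found. -/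
theorem exists_found (hL : IsEdgeList G L) (hG : HasDominatingSet G 2) :
    ∃ lev < (graphInst w N r c n L.length (inputFun L) rnd ca cb cc).L + 1,
      (graphInst w N r c n L.length (inputFun L) rnd ca cb cc).Found (2 ^ lev) := by
  set I := graphInst w N r c n L.length (inputFun L) rnd ca cb cc with hI
  obtain ⟨u, v, -, h⟩ := hasDominatingSet_two_iff.1 hG
  -- The two closed neighbourhoods cover all vertices, so one of them has at least half of the size.
  wlog hu : n ≤ 2 * arcDeg (inputFun L) n L.length u generalizing u v
  · refine this v u (fun x => (h x).symm) ?_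
    have := le_sum_arcDeg hL h
    omega
  have hdu := arcDeg_le hL u.2
  have hdv := arcDeg_le hL v.2
  have hpv := arcDeg_pos (L := L) v
  have hheavy : IsHeavy (inputFun L) n L.length u := ⟨by omega, by omega⟩
  -- The level of `v` is the integer part of the logarithm of its degree.
  refine ⟨Nat.log 2 (arcDeg (inputFun L) n L.length v), ?_, v, v.2, ⟨?_, ?_⟩,
    Nat.count (IsHeavy (inputFun L) n L.length) u, Nat.count_strict_mono hheavy u.2, ?_⟩
  · exact Nat.lt_succ_of_le ((Nat.log_mono_right hdv).trans (Nat.log_le_clog 2 n))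
  · exact Nat.pow_log_le_self 2 hpv.ne'
  · rw [← pow_succ']
    exact Nat.lt_pow_succ_log_self (by omega) _
  · have e : I.hv (Nat.count (IsHeavy (inputFun L) n L.length) u) = u := Nat.nth_count hheavy
    rw [e]
    intro x hx hadj j _
    have hx' : x < n := hx
    have h1 := (graphInst_adj (w := w) (N := N) (r := r) (c := c) (rnd := rnd) (ca := ca)
      (cb := cb) (cc := cc) hL u ⟨x, hx'⟩).1 hadj
    -- A vertex outside `N[u]` is itself the target of an arc from `v`, so its buckets are hit
    -- whatever the random words are.
    obtain ⟨a, ha, h2, h3⟩ := (exists_arc_iff hL v ⟨x, hx'⟩).2 ((h _).resolve_left h1)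
    exact ⟨a, ha, h2, by rw [show I.dst a = x from h3]⟩

/-- The case `u = v` needs a second vertex: a single dominating vertex extends to a dominating pair.
-/
theorem exists_not_mem_closedNbhd (hn : 2 ≤ n) (hG : ¬ HasDominatingSet G 2) (u v : Fin n) :
    ∃ a, a ∉ closedNbhd G u ∧ a ∉ closedNbhd G v := by
  by_contra! hcon
  refine hG (hasDominatingSet_two_iff.2 ?_)
  by_cases huv : u = v
  · subst huv
    obtain ⟨v, hv⟩ : ∃ v, v ≠ u := by
      have : Nontrivial (Fin n) := Fin.nontrivial_iff_two_le.2 hn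
      exact exists_ne u
    refine ⟨u, v, hv.symm, fun x => Or.inl ?_⟩
    by_contra hx
    exact hx (hcon x hx)
  · refine ⟨u, v, huv, fun x => ?_⟩
    by_contra! hx
    exact hx.2 (hcon x hx.1)

/-- A pair that is not dominating can only be found because of collisions of hash values. -/
theorem collision_of_found (hL : IsEdgeList G L) {a : Fin n → Fin n → Fin n}
    (ha : ∀ u v, a u v ∉ closedNbhd G u) {lev : ℕ}
    (h : (graphInst w N r c n L.length (inputFun L) rnd ca cb cc).Found (2 ^ lev)) :
    ∃ u v : Fin n, ∀ j < 2 * Nat.clog 2 n + c, ∃ z : closedNbhd G v,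
      rnd (z.1 * (2 * Nat.clog 2 n + c) + j) %
        2 ^ (Nat.log 2 (arcDeg (inputFun L) n L.length v) + 2) =
      rnd (a u v * (2 * Nat.clog 2 n + c) + j) %
        2 ^ (Nat.log 2 (arcDeg (inputFun L) n L.length v) + 2) := by
  obtain ⟨v, hv, ⟨hl1, hl2⟩, i, hi, hp⟩ := h
  obtain ⟨u, hu, hh, rfl⟩ := exists_of_lt_count hi
  have e : (graphInst w N r c n L.length (inputFun L) rnd ca cb cc).hv
    (Nat.count (IsHeavy (inputFun L) n L.length) u) = u := Nat.nth_count hh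
  rw [e] at hp
  -- The level is determined by `v`. The later union bound therefore runs over pairs of vertices
  -- only, not over levels.
  have hlev : Nat.log 2 (arcDeg (inputFun L) n L.length v) = lev := by
    refine Nat.log_eq_of_pow_le_of_lt_pow hl1 ?_
    rw [pow_succ']
    exact hl2
  refine ⟨⟨u, hu⟩, ⟨v, hv⟩, fun j hj => ?_⟩
  obtain ⟨f, hf, h1, h2⟩ := hp (a ⟨u, hu⟩ ⟨v, hv⟩) (Fin.is_lt _)
    ((graphInst_adj hL ⟨u, hu⟩ _).2 (ha _ _)) j hj
  refine ⟨⟨⟨_, arcDst_lt hf⟩, (exists_arc_iff hL _ _).1 ⟨f, hf, h1, rfl⟩⟩, ?_⟩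
  simp only [hlev]
  -- The number `4 * D` of buckets is the power `2 ^ (lev + 2)`.
  rw [pow_add, mul_comm (2 ^ lev)]
  exact h2

end

end WordRAM

namespace WordRAM

open Function

/-! ## Probability -/

section

variable {ι W : Type*} [DecidableEq ι] [Fintype W] [DecidableEq W]

/-- Given the other coordinates, `f i` is uniform while the set `B f` is fixed and contains at most
half of all words; so at most half of `A` survives. -/
theorem two_mul_card_filter_le (A : Finset (ι → W)) (B : (ι → W) → Finset W) (i : ι)
    (hA : ∀ f ∈ A, ∀ y, update f i y ∈ A) (hB : ∀ f y, B (update f i y) = B f)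
    (hc : ∀ f, 2 * (B f).card ≤ Fintype.card W) :
    2 * (A.filter fun f => f i ∈ B f).card ≤ A.card := by
  rcases isEmpty_or_nonempty W with hW | hW
  · have : A.filter (fun f => f i ∈ B f) = ∅ := Finset.filter_eq_empty_iff.2 fun f _ => hW.elim (f i)
    simp [this]
  have h1 : (A.filter fun f => f i ∈ B f).card * Fintype.card W ≤ ∑ g ∈ A, (B g).card := by
    rw [← Finset.card_univ, ← Finset.card_product, ← Finset.card_sigma]
    -- Exchanging the coordinate `i` with an arbitrary word stays in `A` and does not change `B`;
    -- the old coordinate is kept, so the map is injective.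
    refine Finset.card_le_card_of_injOn (fun q => ⟨update q.1 i q.2, q.1 i⟩) ?_ ?_
    · rintro ⟨f, x⟩ hf
      simp only [Finset.coe_product, Finset.coe_filter, Set.mem_prod, Set.mem_ofPred_eq] at hf
      simp only [Finset.coe_sigma, Set.mem_sigma_iff, Finset.mem_coe]
      exact ⟨hA f hf.1.1 x, by rw [hB]; exact hf.1.2⟩
    · rintro ⟨f, x⟩ _ ⟨f', x'⟩ _ h
      simp only [Sigma.mk.injEq, heq_eq_eq] at h
      obtain ⟨h1, h2⟩ := h
      have h3 : x = x' := by simpa using congrFun h1 i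
      have h4 : f = f' := by
        have := congrArg (fun g => update g i (f i)) h1
        simp only [update_idem, update_eq_self] at this
        exact this.trans (by rw [h2, update_eq_self])
      rw [h3, h4]
  have h2 : 2 * ∑ g ∈ A, (B g).card ≤ A.card * Fintype.card W := by
    rw [Finset.mul_sum]
    exact (Finset.sum_le_card_nsmul _ _ _ fun f _ => hc f).trans (by simp)
  have h3 : 0 < Fintype.card W := Fintype.card_pos
  nlinarith

end

theorem card_bitVec (w : ℕ) : Fintype.card (BitVec w) = 2 ^ w := by
  rw [Fintype.card_congr (BitVec.equivFin (m := w)).toEquiv, Fintype.card_fin]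

/-- The modulus is a power of two that divides `2 ^ w`, so residues of uniform words are exactly
uniform: a residue and a quotient determine the word. -/
theorem card_toNat_mod_le (w q c : ℕ) (hq : q ≤ w) :
    (Finset.univ.filter fun x : BitVec w => x.toNat % 2 ^ q = c).card * 2 ^ q ≤ 2 ^ w := by
  have h : 2 ^ w = 2 ^ (w - q) * 2 ^ q := by rw [← pow_add]; congr 1; omega
  rw [h]
  refine Nat.mul_le_mul_right _ ?_
  rw [← Finset.card_range (2 ^ (w - q))]
  refine Finset.card_le_card_of_injOn (fun x => x.toNat / 2 ^ q) ?_ ?_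
  · intro x _
    simp only [Finset.coe_range, Set.mem_Iio]
    refine Nat.div_lt_of_lt_mul ?_
    rw [mul_comm, ← h]
    exact x.isLt
  · intro x hx y hy hxy
    simp only [Finset.coe_filter, Finset.mem_univ, true_and, Set.mem_ofPred_eq] at hx hy
    refine BitVec.eq_of_toNat_eq ?_
    rw [← Nat.div_add_mod x.toNat (2 ^ q), ← Nat.div_add_mod y.toNat (2 ^ q), hx, hy]
    simp only at hxy
    rw [hxy]

/-- The probability that all `K` hash values of an element collide with those of one of few other
elements. -/
theorem card_collision_le {ι Z : Type*} [DecidableEq ι] [Fintype ι] [Fintype Z] {w q K : ℕ}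
    (hq : q ≤ w) (hZ : 2 * Fintype.card Z ≤ 2 ^ q) (t : ℕ → ι) (s : Z → ℕ → ι)
    (ht : ∀ j < K, ∀ k < K, t j = t k → j = k) (hs : ∀ z, ∀ j < K, ∀ k < K, s z j ≠ t k) :
    (Finset.univ.filter fun f : ι → BitVec w => ∀ j < K, ∃ z,
      (f (s z j)).toNat % 2 ^ q = (f (t j)).toNat % 2 ^ q).card * 2 ^ K ≤
        (2 ^ w) ^ Fintype.card ι := by
  classical
  -- The hash functions are revealed one at a time, and each new collision at least halves the set
  -- of outcomes.
  have key : ∀ k ≤ K, (Finset.univ.filter fun f : ι → BitVec w => ∀ j < k, ∃ z,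
      (f (s z j)).toNat % 2 ^ q = (f (t j)).toNat % 2 ^ q).card * 2 ^ k ≤
        (2 ^ w) ^ Fintype.card ι := by
    intro k
    induction k with
    | zero =>
      intro _
      refine (Nat.mul_le_mul_right _ (Finset.card_le_univ _)).trans ?_
      simp [card_bitVec]
    | succ k ih =>
      intro hk
      refine le_trans ?_ (ih (by omega))
      set A := Finset.univ.filter fun f : ι → BitVec w => ∀ j < k, ∃ z,
        (f (s z j)).toNat % 2 ^ q = (f (t j)).toNat % 2 ^ q with hA
      -- The union of the residue classes of the elements of `Z` under the hash function `k`; it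
      -- depends on coordinates other than `t k`.
      set B : (ι → BitVec w) → Finset (BitVec w) := fun f => Finset.univ.biUnion fun z =>
        Finset.univ.filter fun x : BitVec w => x.toNat % 2 ^ q = (f (s z k)).toNat % 2 ^ q with hB
      have h := two_mul_card_filter_le A B (t k) ?_ ?_ ?_
      · have hsub : (Finset.univ.filter fun f : ι → BitVec w => ∀ j < k + 1, ∃ z,
            (f (s z j)).toNat % 2 ^ q = (f (t j)).toNat % 2 ^ q) ⊆
            A.filter fun f => f (t k) ∈ B f := by
          intro f hf
          simp only [Finset.mem_filter, Finset.mem_univ, true_and] at hf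
          refine Finset.mem_filter.2 ⟨Finset.mem_filter.2 ⟨Finset.mem_univ _, fun j hj =>
            hf j (by omega)⟩, ?_⟩
          obtain ⟨z, hz⟩ := hf k (by omega)
          exact Finset.mem_biUnion.2 ⟨z, Finset.mem_univ _, Finset.mem_filter.2
            ⟨Finset.mem_univ _, hz.symm⟩⟩
        calc _ ≤ (A.filter fun f => f (t k) ∈ B f).card * 2 ^ (k + 1) :=
              Nat.mul_le_mul_right _ (Finset.card_le_card hsub)
          _ = 2 * (A.filter fun f => f (t k) ∈ B f).card * 2 ^ k := by ring
          _ ≤ _ := Nat.mul_le_mul_right _ h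
      · intro f hf y
        simp only [hA, Finset.mem_filter, Finset.mem_univ, true_and] at hf ⊢
        intro j hj
        obtain ⟨z, hz⟩ := hf j hj
        refine ⟨z, ?_⟩
        rwa [update_of_ne (hs z j (by omega) k (by omega)),
          update_of_ne (fun h => by have := ht j (by omega) k (by omega) h; omega)]
      · intro f y
        simp only [hB, update_of_ne (hs _ k (by omega) k (by omega))]
      · intro f
        have h1 : (B f).card * 2 ^ q ≤ Fintype.card Z * 2 ^ w := by
          refine (Nat.mul_le_mul_right _ Finset.card_biUnion_le).trans ?_
          rw [Finset.sum_mul]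
          exact (Finset.sum_le_card_nsmul _ _ _ fun z _ => card_toNat_mod_le w q _ hq).trans
            (by simp)
        have h2 : 0 < 2 ^ q := Nat.two_pow_pos q
        rw [card_bitVec]
        have h4 := Nat.mul_le_mul_right (2 ^ w) hZ
        have : 2 * (B f).card * 2 ^ q ≤ 2 ^ w * 2 ^ q := by nlinarith
        exact Nat.le_of_mul_le_mul_right this h2
  exact key K le_rfl

section

variable {n : ℕ} {G : SimpleGraph (Fin n)} {L : List (Fin n × Fin n)} {w N r c T : ℕ}
  {ca cb cc : ℕ → ℤ}

/-- The sequence that begins with `ρ`. -/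
def extendZero (ρ : Fin T → BitVec w) (i : ℕ) : BitVec w := if h : i < T then ρ ⟨i, h⟩ else 0

-- Union bound over the `n * n` pairs: each is wrong with probability at most `2 ^ -K`, and `2 ^ K ≥
-- n * n * 2 ^ c` by the choice of `K`.
open Classical in
theorem card_found_le (hL : IsEdgeList G L) (hn : 2 ≤ n) (hG : ¬ HasDominatingSet G 2)
    (hT : n * (2 * Nat.clog 2 n + c) ≤ T) (hw : 4 * n ≤ 2 ^ w) :
    (Finset.univ.filter fun ρ : Fin T → BitVec w =>
      ∃ lev < (graphInst w N r c n L.length (inputFun L) (fun i => (extendZero ρ i).toNat)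
        ca cb cc).L + 1, (graphInst w N r c n L.length (inputFun L)
        (fun i => (extendZero ρ i).toNat) ca cb cc).Found (2 ^ lev)).card * 2 ^ c ≤
      (2 ^ w) ^ T := by
  set K := 2 * Nat.clog 2 n + c with hK
  choose a ha using exists_not_mem_closedNbhd hn hG
  have hK' : n * n * 2 ^ c ≤ 2 ^ K := by
    have h1 : n ≤ 2 ^ Nat.clog 2 n := Nat.le_pow_clog (by omega) n
    rw [hK, pow_add, two_mul, pow_add]
    exact Nat.mul_le_mul_right _ (Nat.mul_le_mul h1 h1)
  have hidx : ∀ (x : Fin n) {j : ℕ}, j < K → x * K + j < T := fun x j hj => by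
    have := Nat.mul_le_mul_right K (show (x : ℕ) + 1 ≤ n from x.2)
    linarith
  set F : Fin n × Fin n → Finset (Fin T → BitVec w) := fun q => Finset.univ.filter fun ρ =>
    ∀ j < K, ∃ z : closedNbhd G q.2,
      (extendZero ρ (z.1 * K + j)).toNat % 2 ^ (Nat.log 2 (arcDeg (inputFun L) n L.length q.2) + 2) =
      (extendZero ρ (a q.1 q.2 * K + j)).toNat %
        2 ^ (Nat.log 2 (arcDeg (inputFun L) n L.length q.2) + 2) with hF
  have hF' : ∀ q, (F q).card * 2 ^ K ≤ (2 ^ w) ^ T := by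
    rintro ⟨u, v⟩
    rcases Nat.eq_zero_or_pos K with hK0 | hK0
    · rw [hK0]
      refine (Nat.mul_le_mul_right _ (Finset.card_le_univ _)).trans ?_
      simp [card_bitVec]
    have hT0 : 0 < T := by have := hidx u hK0; omega
    set d := arcDeg (inputFun L) n L.length v with hd
    have hpos : 0 < d := arcDeg_pos v
    have h1 : 2 ^ Nat.log 2 d ≤ d := Nat.pow_log_le_self 2 hpos.ne'
    have h2 : d < 2 ^ (Nat.log 2 d + 1) := Nat.lt_pow_succ_log_self (by omega) _
    have h3 : Nat.log 2 d + 2 ≤ w := by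
      have h4 : d ≤ n := arcDeg_le hL v.2
      refine (Nat.pow_le_pow_iff_right (a := 2) (by omega)).1 ?_
      rw [pow_add]
      omega
    -- The default `0` is never met, because all indices in use are below `T`.
    let ix : ℕ → Fin T := fun i => if h : i < T then ⟨i, h⟩ else ⟨0, hT0⟩
    have hix : ∀ {i : ℕ}, i < T → (ix i : ℕ) = i := fun {i} hi => by simp [ix, hi]
    have hZ : Fintype.card (closedNbhd G v) = d := by
      rw [hd, ← ncard_closedNbhd hL, Set.ncard_eq_toFinset_card', Set.toFinset_card]
    have hne : ∀ (x y : Fin n) {j k : ℕ}, j < K → k < K → ix (x * K + j) = ix (y * K + k) →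
        x = y ∧ j = k := by
      intro x y j k hj hk h
      have h := congrArg Fin.val h
      rw [hix (hidx x hj), hix (hidx y hk)] at h
      have e1 := congrArg (· / K) h
      have e2 := congrArg (· % K) h
      simp only [mul_add_div_of_lt hj, mul_add_mod_of_lt hj, mul_add_div_of_lt hk,
        mul_add_mod_of_lt hk] at e1 e2
      exact ⟨Fin.ext e1, e2⟩
    -- With `d` the degree of `v`, the modulus `2 ^ (Nat.log 2 d + 2)` exceeds `2 * d`: this is the
    -- reason for the factor `4` in the number of buckets.
    have key := card_collision_le (w := w) (K := K) (Z := closedNbhd G v) h3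
      (by rw [hZ, pow_succ]; omega) (fun j => ix (a u v * K + j)) (fun z j => ix (z.1 * K + j))
      (fun j hj k hk h => (hne _ _ hj hk h).2)
      (fun z j hj k hk h => (ha u v).2 ((hne _ _ hj hk h).1 ▸ z.2))
    rw [Fintype.card_fin] at key
    refine le_trans (Nat.mul_le_mul_right _ (Finset.card_le_card fun ρ hρ => ?_)) key
    simp only [hF, Finset.mem_filter, Finset.mem_univ, true_and] at hρ ⊢
    intro j hj
    obtain ⟨z, hz⟩ := hρ j hj
    refine ⟨z, ?_⟩
    simpa [extendZero, ix, hidx _ hj] using hz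
  set X := Finset.univ.filter fun ρ : Fin T → BitVec w =>
      ∃ lev < (graphInst w N r c n L.length (inputFun L) (fun i => (extendZero ρ i).toNat)
        ca cb cc).L + 1, (graphInst w N r c n L.length (inputFun L)
        (fun i => (extendZero ρ i).toNat) ca cb cc).Found (2 ^ lev) with hX
  have hsub : X ⊆ Finset.univ.biUnion F := by
    intro ρ hρ
    obtain ⟨lev, -, h⟩ := (Finset.mem_filter.1 hρ).2
    obtain ⟨u, v, h⟩ := collision_of_found hL (fun u v => (ha u v).1) h
    exact Finset.mem_biUnion.2 ⟨(u, v), Finset.mem_univ _,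
      Finset.mem_filter.2 ⟨Finset.mem_univ _, h⟩⟩
  have h1 : (Finset.univ.biUnion F).card * 2 ^ K ≤ n * n * (2 ^ w) ^ T := by
    refine (Nat.mul_le_mul_right _ Finset.card_biUnion_le).trans ?_
    rw [Finset.sum_mul]
    exact (Finset.sum_le_card_nsmul _ _ _ fun q _ => hF' q).trans (by simp)
  have h2 := Nat.mul_le_mul_right (2 ^ K) (Finset.card_le_card hsub)
  have h3 := Nat.mul_le_mul_left X.card hK'
  have h4 : n * n * (X.card * 2 ^ c) ≤ n * n * (2 ^ w) ^ T := by linarith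
  exact Nat.le_of_mul_le_mul_left h4 (by positivity)

end

end WordRAM

namespace WordRAM

open Function

/-! ## The running time -/

namespace Inst

variable (I : Inst)

/-- A factor in the bound for the number of pairs of blocks. -/
def pairConst : ℕ := 4 + 2 * I.N * (10 + 2 * I.N)

/-- A factor in the bound for `yc`. -/
def yatesConst : ℕ := 124 + 2 * (1 + I.r * (I.N * I.N)) * (60 * I.r + 100)

/-- A factor in the bound for `levelCost`. -/
def levelConst : ℕ := 836 + 26 * I.pairConst + I.pairConst * (407 + 3 * I.yatesConst)

/-- A factor in the bound for `preCost`. -/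
def preConst : ℕ := 2120 + 300 * I.N + 70 * (I.r * (I.N * I.N))

end Inst

section

variable {w : ℕ} {M : Machine w} {I : Inst} {D c β : ℕ}

/-- The number of pairs of blocks times `b * b` is at most `(c + b) * (4 K D + 2 b)`. The main term
is paid by `c * D ≤ M`; the other terms come from rounding up to full blocks and are paid by `b * n
= O(M)`. -/
theorem Inst.Valid.pairs_le (hI : I.Valid M) (hD : D ≤ 2 * I.n) (hc : c ≤ I.n) (hcD : c * D ≤ I.M)
    (hbn : I.b * I.n ≤ 2 * I.N * I.M) (hb : I.b ≤ I.N * I.n) :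
    I.Vb c * (I.Yb D + 1) * (I.b * I.b) ≤ I.pairConst * (I.K * I.M) := by
  have hK := hI.one_le_K
  have h1 : I.Vb c * I.b ≤ c + I.b := by
    rw [Inst.Vb, Nat.succ_mul]
    exact Nat.add_le_add_right (Nat.div_mul_le_self _ _) _
  have h2 : (I.Yb D + 1) * I.b ≤ I.K * (4 * D) + 2 * I.b := by
    rw [Inst.Yb, add_assoc, Nat.add_mul]
    exact Nat.add_le_add_right (Nat.div_mul_le_self _ _) _
  calc I.Vb c * (I.Yb D + 1) * (I.b * I.b) = (I.Vb c * I.b) * ((I.Yb D + 1) * I.b) := by ring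
    _ ≤ (c + I.b) * (I.K * (4 * D) + 2 * I.b) := Nat.mul_le_mul h1 h2
    _ = 4 * I.K * (c * D) + 2 * (I.b * c) + 4 * I.K * (I.b * D) + 2 * (I.b * I.b) := by ring
    _ ≤ 4 * I.K * I.M + 2 * (I.b * I.n) + 4 * I.K * (I.b * (2 * I.n)) +
        2 * (I.b * (I.N * I.n)) := by gcongr
    _ = 4 * I.K * I.M + (2 + 8 * I.K + 2 * I.N) * (I.b * I.n) := by ring
    _ ≤ 4 * I.K * I.M + (2 + 8 * I.K + 2 * I.N) * (2 * I.N * I.M) := by gcongr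
    _ ≤ 4 * I.K * I.M + (2 * I.K + 8 * I.K + 2 * I.N * I.K) * (2 * I.N * I.M) := by
        have h3 : 2 * 1 ≤ 2 * I.K := Nat.mul_le_mul_left _ hK
        have h4 : 2 * I.N * 1 ≤ 2 * I.N * I.K := Nat.mul_le_mul_left _ hK
        exact Nat.add_le_add_left (Nat.mul_le_mul_right _ (by omega)) _
    _ = I.pairConst * (I.K * I.M) := by rw [Inst.pairConst]; ring

theorem Inst.Valid.yc_le (hI : I.Valid M) : I.yc ≤ (I.k + 1) * I.r ^ I.k * I.yatesConst := by
  have h1 : 1 ≤ I.r ^ I.k := Nat.pow_pos hI.r_pos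
  generalize hR : I.r ^ I.k = R at *
  rw [Inst.yc, Inst.yatesConst, Inst.yl, hR]
  generalize I.r * (I.N * I.N) = a
  calc 20 + I.k * (2 * (R + a) * (60 * I.r + 100) + 104)
      ≤ 20 * ((I.k + 1) * R) + (I.k + 1) * (2 * (R + a * R) * (60 * I.r + 100) + 104 * R) := by
        gcongr
        · nlinarith
        · omega
        · nlinarith
        · omega
    _ = _ := by ring

/-- There are two transforms for each of the `Yb` blocks and one inverse transform; the search for
zeros costs about `b * h ≤ b * b ≤ r ^ k`. -/
theorem Inst.Valid.blockCost_le (hI : I.Valid M) : I.blockCost D + 4 ≤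
    (I.Yb D + 1) * ((I.k + 1) * I.r ^ I.k * (407 + 3 * I.yatesConst)) := by
  have h1 : 1 ≤ I.r ^ I.k := Nat.pow_pos hI.r_pos
  have h2 := hI.yc_le
  have h3 := hI.bb_le_rk
  have h4 : I.b * (I.h * 60 + 60) ≤ 120 * I.r ^ I.k := by
    have h5 := hI.h_le_b
    have h6 := hI.b_pos
    nlinarith
  set R := I.r ^ I.k with hR
  have h5 : R ≤ (I.k + 1) * R := Nat.le_mul_of_pos_left _ (by omega)
  calc I.blockCost D + 4
      ≤ (I.Yb D + 1) * (150 * R + 2 * I.yc + 60 + (I.yc + 13 * R + 120 * R + 64)) := by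
        rw [Inst.blockCost, ← hR]
        have : 1 * (I.yc + 13 * R + 120 * R + 64) ≤
          (I.Yb D + 1) * (I.yc + 13 * R + 120 * R + 64) := Nat.mul_le_mul_right _ (by omega)
        nlinarith
    _ ≤ (I.Yb D + 1) * ((I.k + 1) * R * (407 + 3 * I.yatesConst)) := by
        refine Nat.mul_le_mul_left _ ?_
        nlinarith

/-- `β` stands for `b ^ ε`, the excess of `r ^ k` over `b * b`. With it, the block products cost
`pairs_le` times `(k + 1) * β`, and the remaining terms are linear in `K * M`. -/
theorem Inst.Valid.levelCost_le (hI : I.Valid M) (hD : D ≤ 2 * I.n) (hc : c ≤ I.n)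
    (hcD : c * D ≤ I.M) (hbn : I.b * I.n ≤ 2 * I.N * I.M) (hb : I.b ≤ I.N * I.n) (hnM : I.n ≤ I.M)
    (hhn : I.h * I.n ≤ 2 * I.M) (hβ : 1 ≤ β) (hr : I.r ^ I.k ≤ I.b * I.b * β) :
    I.levelCost D c ≤ I.levelConst * ((I.k + 1) * (I.K * I.M) * β) := by
  have hK := hI.one_le_K
  have hn := hI.two_le_n
  have hP := hI.pairs_le hD hc hcD hbn hb
  set P := I.K * I.M with hPdef
  have hMP : I.M ≤ P := Nat.le_mul_of_pos_left _ hK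
  set X := (I.k + 1) * P * β with hX
  have hPX : P ≤ X := by
    rw [hX, mul_assoc]
    exact (Nat.le_mul_of_pos_right _ hβ).trans (Nat.le_mul_of_pos_left _ (by omega))
  have h1 : I.Vb c * (I.Yb D * (I.b * I.b)) ≤ I.pairConst * P := by
    refine le_trans ?_ hP
    rw [← mul_assoc]
    exact Nat.mul_le_mul_right _ (Nat.mul_le_mul_left _ (by omega))
  have h2 : I.Yb D * (I.b * I.b) ≤ I.Vb c * (I.Yb D * (I.b * I.b)) :=
    Nat.le_mul_of_pos_left _ (Nat.succ_pos _)
  have h3 : I.h * (I.n * (I.K * 110 + 40) + 20) ≤ 340 * P := by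
    calc I.h * (I.n * (I.K * 110 + 40) + 20) ≤ I.h * (I.n * (I.K * 110 + 40 * I.K) +
          I.n * (20 * I.K)) := by gcongr <;> nlinarith
      _ = 170 * I.K * (I.h * I.n) := by ring
      _ ≤ 170 * I.K * (2 * I.M) := by gcongr
      _ = 340 * P := by rw [hPdef]; ring
  have h4 : I.M * (I.K * 120 + 80) ≤ 200 * P := by rw [hPdef]; nlinarith
  have h5 : I.Vb c * (I.blockCost D + 4) ≤ I.pairConst * (407 + 3 * I.yatesConst) * X := by
    calc I.Vb c * (I.blockCost D + 4) ≤ I.Vb c * ((I.Yb D + 1) *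
          ((I.k + 1) * (I.b * I.b * β) * (407 + 3 * I.yatesConst))) := by
          refine Nat.mul_le_mul_left _ (hI.blockCost_le.trans ?_)
          gcongr
      _ = I.Vb c * (I.Yb D + 1) * (I.b * I.b) * ((I.k + 1) * β * (407 + 3 * I.yatesConst)) := by
          ring
      _ ≤ I.pairConst * P * ((I.k + 1) * β * (407 + 3 * I.yatesConst)) := by gcongr
      _ = I.pairConst * (407 + 3 * I.yatesConst) * X := by rw [hX]; ring
  have h6 := Nat.mul_le_mul_left I.pairConst hPX
  rw [Inst.levelCost, Inst.levelConst]
  have h7 : (836 + 26 * I.pairConst + I.pairConst * (407 + 3 * I.yatesConst)) * X = 836 * X +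
    26 * (I.pairConst * X) + I.pairConst * (407 + 3 * I.yatesConst) * X := by ring
  rw [h7]
  omega

theorem Inst.Valid.preCost_le (hI : I.Valid M) (hbn : I.b * I.n ≤ 2 * I.N * I.M)
    (hnM : I.n ≤ I.M) : I.preCost ≤ I.preConst * (I.K * I.M) := by
  have hK := hI.one_le_K
  have hn := hI.two_le_n
  have hh := hI.h_le_n
  have hk : I.k ≤ I.b := (Nat.lt_pow_self hI.two_le_N).le
  have h1 : I.b * 1 ≤ I.b * I.n := Nat.mul_le_mul_left _ (by omega)
  have h2 : I.n * I.K ≤ I.K * I.M := by rw [mul_comm]; exact Nat.mul_le_mul_left _ hnM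
  have hMP : I.M ≤ I.K * I.M := Nat.le_mul_of_pos_left _ hK
  have h3 : 2 * I.N * I.M ≤ 2 * I.N * (I.K * I.M) := Nat.mul_le_mul_left _ hMP
  have h4 : I.r * (I.N * I.N) * 1 ≤ I.r * (I.N * I.N) * (I.K * I.M) :=
    Nat.mul_le_mul_left _ (by omega)
  rw [Inst.preCost, Inst.preConst]
  generalize I.K * I.M = P at *
  have h5 : (2120 + 300 * I.N + 70 * (I.r * (I.N * I.N))) * P = 2120 * P + 150 * (2 * I.N * P) +
    70 * (I.r * (I.N * I.N) * P) := by ring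
  rw [h5]
  omega

end

end WordRAM

/-! ### The total running time -/

namespace WordRAM

open Function

section

variable {n : ℕ} {G : SimpleGraph (Fin n)} {L : List (Fin n × Fin n)} {w N r c : ℕ}
  {rnd : ℕ → ℕ} {ca cb cc : ℕ → ℤ}

/-- Rounding up to a power of `N` loses at most a factor `N`; `1 ≤ m` covers `h ≤ 1`, where the
power is `1`. -/
theorem pow_clog_le (hN : 2 ≤ N) {h m : ℕ} (hh : h ≤ m) (hm : 1 ≤ m) :
    N ^ Nat.clog N h ≤ N * m := by
  rcases Nat.lt_or_ge 1 h with h1 | h1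
  · have h2 := Nat.pow_pred_clog_lt_self (show 1 < N by omega) h1
    have h3 : 0 < Nat.clog N h := Nat.clog_pos (by omega) h1
    rw [show Nat.clog N h = (Nat.clog N h).pred + 1 by rw [Nat.pred_eq_sub_one]; omega, pow_succ,
      mul_comm]
    exact Nat.mul_le_mul_left _ (h2.le.trans hh)
  · rw [Nat.clog_of_right_le_one h1, pow_zero]
    nlinarith

theorem heavy_mul_le : Nat.count (IsHeavy (inputFun L) n L.length) n * n ≤
    2 * (2 * L.length + n) := by
  have h1 := count_mul_le (L := L) (p := IsHeavy (inputFun L) n L.length) (a := (n + 1) / 2)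
    fun x hx => hx.1
  have h2 : n ≤ 2 * ((n + 1) / 2) := by omega
  calc _ ≤ Nat.count (IsHeavy (inputFun L) n L.length) n * (2 * ((n + 1) / 2)) :=
        Nat.mul_le_mul_left _ h2
    _ = 2 * (Nat.count (IsHeavy (inputFun L) n L.length) n * ((n + 1) / 2)) := by ring
    _ ≤ _ := Nat.mul_le_mul_left _ h1

/-- Follows from `heavy_mul_le` up to the factor `N`; the maximum with `1` is needed because the
block size is `1` even without heavy vertices. -/
theorem block_mul_le (hN : 2 ≤ N) : N ^ Nat.clog N (Nat.count (IsHeavy (inputFun L) n L.length) n)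
    * n ≤ 2 * N * (2 * L.length + n) := by
  have h1 := heavy_mul_le (n := n) (L := L)
  generalize Nat.count (IsHeavy (inputFun L) n L.length) n = h at *
  have h2 := pow_clog_le hN (le_max_left h 1) (le_max_right h 1)
  refine (Nat.mul_le_mul_right _ h2).trans ?_
  have h3 : max h 1 * n ≤ 2 * (2 * L.length + n) := by
    rcases Nat.lt_or_ge h 1 with h4 | h4
    · rw [max_eq_right (by omega)]; omega
    · rwa [max_eq_left h4]
  nlinarith

theorem graphInst_valid {M : Machine w} (hL : IsEdgeList G L) (hN : 2 ≤ N) (hr : N * N ≤ r)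
    (hn : 2 ≤ n) (hrnd : ∀ i, rnd i < 2 ^ w)
    (hfit : ∀ I, I = graphInst w N r c n L.length (inputFun L) rnd ca cb cc →
      (I.n + I.b) * (8 * I.n * I.K + I.b) + (I.r ^ I.k + I.r * (I.N * I.N)) + I.M + I.k + I.L <
        M.lim) :
    (graphInst w N r c n L.length (inputFun L) rnd ca cb cc).Valid M where
  two_le_N := hN
  N_le_r := hr
  one_le_K := by
    have : 0 < Nat.clog 2 n := Nat.clog_pos (by omega) hn
    change 1 ≤ 2 * Nat.clog 2 n + c
    omega
  two_le_n := hn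
  h_le_b := Nat.le_pow_clog (show 1 < N by omega) _
  h_le_n := Nat.count_le _
  src_lt e he := arcSrc_lt he
  dst_lt e he := arcDst_lt he
  hv_lt i hi := Nat.nth_lt_of_lt_count hi
  dg_le x hx := arcDeg_le hL hx
  adj_le i := by
    simp only [graphInst, setOn]
    split_ifs <;> omega
  rnd_lt := hrnd
  fits := hfit _ rfl

/-- A constant factor in the running time. -/
def timeConst (N r : ℕ) : ℕ := 2120 + 300 * N + 70 * (r * (N * N)) + (836 +
  26 * (4 + 2 * N * (10 + 2 * N)) + (4 + 2 * N * (10 + 2 * N)) * (407 + 3 * (124 +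
    2 * (1 + r * (N * N)) * (60 * r + 100)))) + 4

/-- Of the three logarithms one comes from the number `K` of hash functions, one from the `k` steps
of Yates's algorithm and one from the number of levels. -/
theorem exists_cost {M : Machine w} {β : ℕ} {I : Inst}
    (hIdef : I = graphInst w N r c n L.length (inputFun L) rnd ca cb cc) (hI : I.Valid M)
    (hβ : 1 ≤ β) (hr : I.r ^ I.k ≤ I.b * I.b * β) :
    ∃ C, (∀ lev < I.L + 1, I.levelCost (2 ^ lev) (Nat.count (I.InLevel (2 ^ lev)) n) ≤ C) ∧
      I.preCost + (I.L + 1) * (C + 4) ≤ timeConst N r * ((c + 2) * ((Nat.clog 2 n + 1) ^ 3 *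
        ((2 * L.length + n) * β))) := by
  have hN := hI.two_le_N
  have hn := hI.two_le_n
  have hK := hI.one_le_K
  have hhn : I.h * I.n ≤ 2 * I.M := by subst hIdef; exact heavy_mul_le
  have hbn : I.b * I.n ≤ 2 * I.N * I.M := by subst hIdef; exact block_mul_le hN
  have hb : I.b ≤ I.N * I.n := by
    subst hIdef; exact pow_clog_le hN (Nat.count_le _) (le_trans (by omega) hn)
  have hnM : I.n ≤ I.M := by subst hIdef; exact Nat.le_add_left _ _
  have hpre := hI.preCost_le hbn hnM
  refine ⟨I.levelConst * ((I.k + 1) * (I.K * I.M) * β), fun lev hlev => ?_, ?_⟩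
  · have hn' : I.n = n := by subst hIdef; rfl
    refine hI.levelCost_le ?_ (hn' ▸ (Nat.count_le _)) ?_ hbn hb hnM hhn hβ hr
    · rw [hn']
      have hLc : I.L = Nat.clog 2 n := by subst hIdef; rfl
      have h1 := Nat.pow_pred_clog_lt_self (b := 2) (by omega) (show 1 < n by omega)
      have h2 : 2 ^ lev ≤ 2 ^ ((Nat.clog 2 n).pred + 1) :=
        Nat.pow_le_pow_right (by omega) (by rw [Nat.pred_eq_sub_one]; omega)
      rw [pow_succ] at h2
      omega
    · subst hIdef
      exact count_mul_le fun x hx => hx.1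
  · have hconst : I.preConst + I.levelConst + 4 = timeConst N r := by subst hIdef; rfl
    have hkL : I.k ≤ I.L := by
      subst hIdef
      exact (Nat.clog_anti_left (by omega) hN).trans (Nat.clog_mono_right 2 (Nat.count_le _))
    have hKL : I.K ≤ (c + 2) * (I.L + 1) := by
      subst hIdef
      change 2 * Nat.clog 2 n + c ≤ (c + 2) * (Nat.clog 2 n + 1)
      nlinarith
    have hM0 : 1 ≤ I.K * I.M := Nat.mul_pos hK (by omega)
    have hL' : I.L = Nat.clog 2 n := by subst hIdef; rfl
    have hM' : I.M = 2 * L.length + n := by subst hIdef; rfl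
    rw [← hconst, ← hL', ← hM']
    set X := (I.k + 1) * (I.K * I.M) * β with hX
    have hPX : I.K * I.M ≤ X := by
      rw [hX, mul_assoc]
      exact (Nat.le_mul_of_pos_right _ hβ).trans (Nat.le_mul_of_pos_left _ (by omega))
    have hXX : X ≤ (I.L + 1) * X := Nat.le_mul_of_pos_left _ (by omega)
    have hXle : (I.L + 1) * X ≤ (c + 2) * ((I.L + 1) ^ 3 * (I.M * β)) := by
      calc (I.L + 1) * X ≤ (I.L + 1) * ((I.L + 1) * ((c + 2) * (I.L + 1) * I.M) * β) := by
            rw [hX]; gcongr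
        _ = _ := by ring
    calc I.preCost + (I.L + 1) * (I.levelConst * X + 4)
        ≤ I.preConst * ((I.L + 1) * X) + (I.L + 1) * (I.levelConst * X + 4 * X) := by
          gcongr
          · exact hpre.trans (Nat.mul_le_mul_left _ (hPX.trans hXX))
          · omega
      _ = (I.preConst + I.levelConst + 4) * ((I.L + 1) * X) := by ring
      _ ≤ _ := Nat.mul_le_mul_left _ hXle

/-- The rank of the power of an algorithm of exponent `2 + ε`. -/
theorem pow_le_of_le_rpow {ε : ℝ} {k : ℕ} (hr : (r : ℝ) ≤ (N : ℝ) ^ (2 + ε)) (hN : 1 ≤ N) :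
    r ^ k ≤ N ^ k * N ^ k * ⌈((N ^ k : ℕ) : ℝ) ^ ε⌉₊ := by
  have hN0 : (0 : ℝ) < N := by exact_mod_cast hN
  have h : (r : ℝ) ^ k ≤ (N : ℝ) ^ k * (N : ℝ) ^ k * ((N ^ k : ℕ) : ℝ) ^ ε := by
    calc (r : ℝ) ^ k ≤ ((N : ℝ) ^ (2 + ε)) ^ k := pow_le_pow_left₀ (by positivity) hr _
      _ = (((N : ℝ) ^ k) ^ (2 + ε)) := by
          rw [← Real.rpow_natCast, ← Real.rpow_natCast, ← Real.rpow_mul hN0.le,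
            ← Real.rpow_mul hN0.le, mul_comm]
      _ = _ := by
          rw [Real.rpow_add (by positivity), Nat.cast_pow, Real.rpow_two, sq]
  have h2 := h.trans (mul_le_mul_of_nonneg_left (Nat.le_ceil _) (by positivity))
  exact_mod_cast h2

end

/-- The ceiling and the additive constant are absorbed because both `log n` and `n ^ e` are at least
`1` for `n ≥ 3`. -/
theorem isSoftO_time {A : ℝ} (hA : 0 ≤ A) (e : ℝ) (he : 0 ≤ e) : IsSoftO
    (fun n => ((⌈A * ((Nat.clog 2 n + 1 : ℕ) : ℝ) ^ 3 * (n : ℝ) ^ e⌉₊ + 40 : ℕ) : ℝ))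
    (fun n => (n : ℝ) ^ e) := by
  -- The `5` is from `Nat.clog 2 n + 1 ≤ 5 * log n`; the `41` is the additive `40` and `1` for the
  -- ceiling.
  refine ⟨3, Asymptotics.IsBigO.of_bound (A * 5 ^ 3 + 41) ?_⟩
  filter_upwards [Filter.eventually_ge_atTop 3] with n hn
  have hn' : (3 : ℝ) ≤ n := by exact_mod_cast hn
  have hlog : 1 ≤ Real.log n := by
    rw [Real.le_log_iff_exp_le (by linarith)]
    exact (Real.exp_one_lt_d9.le.trans (by norm_num)).trans hn'
  have hclog : ((Nat.clog 2 n + 1 : ℕ) : ℝ) ≤ 5 * Real.log n := by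
    have h1 := Nat.pow_pred_clog_lt_self (b := 2) (by omega) (show 1 < n by omega)
    have h2 : (((2 : ℕ) ^ (Nat.clog 2 n).pred : ℕ) : ℝ) ≤ n := by exact_mod_cast h1.le
    have h3 := Real.log_le_log (by positivity) h2
    rw [Nat.cast_pow, Real.log_pow, Nat.cast_ofNat] at h3
    have h4 : 0 < Nat.clog 2 n := Nat.clog_pos (by omega) (by omega)
    have h5 : ((Nat.clog 2 n + 1 : ℕ) : ℝ) = ((Nat.clog 2 n).pred : ℝ) + 2 := by
      rw [show Nat.clog 2 n + 1 = (Nat.clog 2 n).pred + 2 by rw [Nat.pred_eq_sub_one]; omega]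
      push_cast; ring
    have h6 := Real.log_two_gt_d9
    rw [h5]
    have h7 : (0 : ℝ) ≤ ((Nat.clog 2 n).pred : ℝ) := by positivity
    nlinarith
  have h1 : (1 : ℝ) ≤ (n : ℝ) ^ e := Real.one_le_rpow (by linarith) he
  have h2 : (1 : ℝ) ≤ (n : ℝ) ^ e * Real.log n ^ 3 := one_le_mul_of_one_le_of_one_le h1
    (one_le_pow₀ hlog)
  rw [Real.norm_of_nonneg (by positivity), Real.norm_of_nonneg (by linarith)]
  push_cast
  have h3 := (Nat.ceil_lt_add_one (show 0 ≤ A * ((Nat.clog 2 n + 1 : ℕ) : ℝ) ^ 3 * (n : ℝ) ^ e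
    by positivity)).le
  have h4 : A * ((Nat.clog 2 n + 1 : ℕ) : ℝ) ^ 3 * (n : ℝ) ^ e ≤
      A * (5 * Real.log n) ^ 3 * (n : ℝ) ^ e := by gcongr
  push_cast at h3 h4
  nlinarith

end WordRAM

namespace WordRAM

open Function

/-! ## The parameters -/

/-- Some `τ < ω + ε` admits the bound `C * n ^ τ`. For a large `N` the constant `C` is at most `N ^
(ω + ε - τ)` and disappears; one such `N` is fixed. The maximum with `N * N` provides the
monotonicity needed for Yates's algorithm. -/
theorem exists_bilinear_of_matMulExponent {K : Type*} [Field K] {ω ε : ℝ}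
    (hω : matMulExponent K = ω) (hω0 : 2 ≤ ω) (hε : 0 < ε) : ∃ N r r' : ℕ, 2 ≤ N ∧ N * N ≤ r' ∧
      (r' : ℝ) ≤ (N : ℝ) ^ (ω + ε) ∧ r ≤ r' ∧ HasBilinearMatMul K N r := by
  rw [matMulExponent] at hω
  have hne : {τ : ℝ | ∃ C : ℝ, ∀ n : ℕ, 1 ≤ n → ∃ r : ℕ, (r : ℝ) ≤ C * (n : ℝ) ^ τ ∧
      HasBilinearMatMul K n r}.Nonempty := by
    -- The infimum of the empty set is `0` by convention, which `2 ≤ ω` excludes.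
    by_contra h
    rw [Set.not_nonempty_iff_eq_empty.1 h, Real.sInf_empty] at hω
    linarith
  obtain ⟨τ, ⟨C, hC⟩, hτ⟩ := exists_lt_of_csInf_lt hne (show sInf _ < ω + ε by rw [hω]; linarith)
  have h1 := ((tendsto_rpow_atTop (show 0 < ω + ε - τ by linarith)).comp
    tendsto_natCast_atTop_atTop).eventually_ge_atTop C
  obtain ⟨N, hN, hN2⟩ := (h1.and (Filter.eventually_ge_atTop 2)).exists
  obtain ⟨r, hr, hB⟩ := hC N (by omega)
  have hN0 : (0 : ℝ) < N := by exact_mod_cast (show 0 < N by omega)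
  have hN1 : (1 : ℝ) ≤ N := by exact_mod_cast (show 1 ≤ N by omega)
  refine ⟨N, r, max r (N * N), hN2, le_max_right _ _, ?_, le_max_left _ _, hB⟩
  rw [Nat.cast_max, max_le_iff]
  constructor
  · refine hr.trans ?_
    rw [show ω + ε = (ω + ε - τ) + τ by ring, Real.rpow_add hN0]
    exact mul_le_mul_of_nonneg_right hN (by positivity)
  · rw [Nat.cast_mul, ← sq, ← Real.rpow_two]
    exact Real.rpow_le_rpow_of_exponent_le hN1 (by linarith)

/-- All array sizes and values are polynomial in `n`, with an exponent that depends on the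
parameters of the program only. The point is that powers with exponent `k = Nat.clog N h` are
polynomial. -/
theorem exists_exponent (N r c D₀ : ℕ) (hN : 2 ≤ N) : ∃ e, ∀ n h M : ℕ, 2 ≤ n → h ≤ n →
    M ≤ n * n → (n + N ^ Nat.clog N h) * (8 * n * (2 * Nat.clog 2 n + c) + N ^ Nat.clog N h) +
      (r ^ Nat.clog N h + r * (N * N)) + M + Nat.clog N h + Nat.clog 2 n < (n + 2) ^ e ∧
    D₀ ^ Nat.clog N h * (8 * n * (2 * Nat.clog 2 n + c) + N ^ Nat.clog N h) < (n + 2) ^ e := by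
  set A := (1 + N) * (16 + 8 * c + N) + N ^ r + r * (N * N) + 3 with hA
  set B := N ^ D₀ * (16 + 8 * c + N) with hB
  -- `r + D₀ + 3` is the degree of the polynomials, and `A + B` absorbs their coefficients by `a < x
  -- ^ a`.
  refine ⟨A + B + (r + D₀ + 3), fun n h M hn hh hM => ?_⟩
  have hL : Nat.clog 2 n ≤ n + 2 :=
    (Nat.clog_le_of_le_pow (Nat.lt_two_pow_self).le).trans (by omega)
  have hk : Nat.clog N h ≤ n + 2 :=
    ((Nat.clog_anti_left (by omega) hN).trans (Nat.clog_mono_right 2 hh)).trans hL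
  have hb := pow_clog_le hN hh (by omega)
  -- Since `a ≤ N ^ a`, the power `a ^ k` is at most `(N ^ k) ^ a`, and `N ^ k = O(n)`.
  have hpow : ∀ a : ℕ, a ^ Nat.clog N h ≤ N ^ a * (n + 2) ^ a := fun a => by
    calc a ^ Nat.clog N h ≤ (N ^ a) ^ Nat.clog N h :=
          Nat.pow_le_pow_left (Nat.lt_pow_self hN).le _
      _ = (N ^ Nat.clog N h) ^ a := by rw [← pow_mul, ← pow_mul, mul_comm]
      _ ≤ (N * (n + 2)) ^ a := Nat.pow_le_pow_left (hb.trans (Nat.mul_le_mul_left _ (by omega))) _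
      _ = _ := mul_pow _ _ _
  have h1 := hpow r
  have h2 := hpow D₀
  generalize N ^ Nat.clog N h = b at *
  generalize Nat.clog N h = k at *
  generalize Nat.clog 2 n = l at *
  obtain ⟨x, hx⟩ : ∃ x, x = n + 2 := ⟨_, rfl⟩
  rw [← hx] at hL hk hpow h1 h2 ⊢
  have hnx : n ≤ x := by omega
  have hbx : b ≤ N * x := hb.trans (Nat.mul_le_mul_left _ hnx)
  have hx1 : 1 ≤ x := by omega
  have h3 : 8 * n * (2 * l + c) + b ≤ (16 + 8 * c + N) * x ^ 2 := by
    calc 8 * n * (2 * l + c) + b ≤ 8 * x * (2 * x + c * x) + N * x * x := by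
          gcongr
          · exact Nat.le_mul_of_pos_right _ hx1
          · exact hbx.trans (Nat.le_mul_of_pos_right _ hx1)
      _ = _ := by ring
  have hup : ∀ i j : ℕ, i ≤ j → x ^ i ≤ x ^ j := fun i j hij => Nat.pow_le_pow_right hx1 hij
  have hlt : ∀ a : ℕ, a < x ^ a := fun a => Nat.lt_pow_self (by omega)
  have hfin : ∀ a, a ≤ A + B → a * x ^ (r + D₀ + 3) < x ^ (A + B + (r + D₀ + 3)) := fun a ha => by
    rw [pow_add x (A + B)]
    exact Nat.mul_lt_mul_of_pos_right ((hlt a).trans_le (hup _ _ ha)) (Nat.pow_pos hx1)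
  constructor
  · refine lt_of_le_of_lt ?_ (hfin A (by omega))
    have e1 : (n + b) * (8 * n * (2 * l + c) + b) ≤
        (1 + N) * (16 + 8 * c + N) * x ^ (r + D₀ + 3) := by
      calc _ ≤ (x + N * x) * ((16 + 8 * c + N) * x ^ 2) := by gcongr
        _ = (1 + N) * (16 + 8 * c + N) * x ^ 3 := by ring
        _ ≤ _ := Nat.mul_le_mul_left _ (hup _ _ (by omega))
    have e2 : r ^ k ≤ N ^ r * x ^ (r + D₀ + 3) :=
      h1.trans (Nat.mul_le_mul_left _ (hup _ _ (by omega)))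
    have e3 : r * (N * N) ≤ r * (N * N) * x ^ (r + D₀ + 3) :=
      Nat.le_mul_of_pos_right _ (Nat.pow_pos hx1)
    have e4 : M ≤ x ^ (r + D₀ + 3) := by
      refine hM.trans (le_trans ?_ (hup 2 _ (by omega)))
      rw [sq]
      exact Nat.mul_le_mul hnx hnx
    have e5 : x ≤ x ^ (r + D₀ + 3) := by simpa using hup 1 (r + D₀ + 3) (by omega)
    have e6 : A * x ^ (r + D₀ + 3) = (1 + N) * (16 + 8 * c + N) * x ^ (r + D₀ + 3) +
        N ^ r * x ^ (r + D₀ + 3) + r * (N * N) * x ^ (r + D₀ + 3) + 3 * x ^ (r + D₀ + 3) := by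
      rw [hA]; ring
    omega
  · refine lt_of_le_of_lt ?_ (hfin B (by omega))
    calc _ ≤ N ^ D₀ * x ^ D₀ * ((16 + 8 * c + N) * x ^ 2) := Nat.mul_le_mul h2 h3
      _ = B * x ^ (D₀ + 2) := by rw [hB]; ring
      _ ≤ _ := Nat.mul_le_mul_left _ (hup _ _ (by omega))

theorem pow_le_two_pow_wordSize (κ n : ℕ) : (n + 2) ^ κ ≤ 2 ^ wordSize κ n := by
  rw [wordSize, mul_comm, pow_mul]
  exact Nat.pow_le_pow_left (Nat.le_pow_clog (by omega) _) _

/-! ## The behaviour of the program -/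

section

variable {n : ℕ} {G : SimpleGraph (Fin n)} {L : List (Fin n × Fin n)} {N r c D₀ e β T : ℕ}
  {ca cb cc : ℕ → ℤ}

/-- The `6` in the exponent: a factor `(n + 2) ^ 5` covers the `32` arrays and one more `n + 2`
leaves room for the input. -/
theorem exists_machine (hL : IsEdgeList G L) (he : 1 ≤ e) {w : ℕ} (hw : (n + 2) ^ (e + 6) ≤ 2 ^ w)
    (ρ : ℕ → BitVec w) : ∃ M : Machine w, M.base = 2 + 2 * L.length ∧ M.lim = (n + 2) ^ e ∧
      M.inp = inputFun L ∧ M.ρ = ρ := by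
  refine ⟨⟨2 + 2 * L.length, (n + 2) ^ e, inputFun L, ρ, le_trans ?_ hw⟩, rfl, rfl, rfl, rfl⟩
  have h1 := two_mul_length_le hL
  have h2 : 1 ≤ (n + 2) ^ e := Nat.pow_pos (by omega)
  have h3 : n + 2 ≤ (n + 2) ^ e := Nat.le_self_pow (by omega) _
  rw [pow_add, show numArrays = 2 ^ 5 from rfl]
  have h4 : (2 ^ 5) * (n + 2) ≤ (n + 2) ^ 6 := by
    rw [pow_succ (n + 2) 5]
    exact Nat.mul_le_mul_right _ (Nat.pow_le_pow_left (by omega) _)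
  have h5 : (n + 2) ^ e * (2 ^ 5 * (n + 2)) ≤ (n + 2) ^ e * (n + 2) ^ 6 := Nat.mul_le_mul_left _ h4
  refine le_trans ?_ h5
  nlinarith

theorem run_small (hL : IsEdgeList G L) (hn : n < 2) (he : 1 ≤ e) {w : ℕ}
    (hw : (n + 2) ^ (e + 6) ≤ 2 ^ w) (ρ : ℕ → BitVec w) (hT : 35 ≤ T) :
    run (program (main N r c ca cb cc) aFlag) ρ T (init w (graphInput L)) = some false := by
  obtain ⟨M, hb, hl, hi, rfl⟩ := exists_machine hL he hw ρ
  have hlim : 1 < M.lim := hl ▸ Nat.one_lt_pow (by omega) (by omega)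
  obtain ⟨σ', h1, h2⟩ := run_program (l := graphInput L) (flag := aFlag)
    (length_graphInput L) (hb.trans (length_graphInput L).symm) (fun i => by rw [hi]; rfl)
    (by omega) (by decide) (runs_main_small (N := N) (r := r) (c := c) (ca := ca) (cb := cb)
      (cc := cc) (by omega) hlim (by rw [hi]; exact hn))
  rw [h1] at h2
  obtain ⟨s, rfl⟩ := Nat.exists_eq_add_of_le hT
  exact run_add_of_eq_some _ _ _ _ _ _ (by simpa using h2)

-- For fixed random words the program is deterministic and its answer has a combinatorial
-- description. The same statement serves the time bound, the absence of false negatives and the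
-- probability of error.
open Classical in
theorem run_eq (hL : IsEdgeList G L) (hn : 2 ≤ n) (hN : 2 ≤ N) (hr : N * N ≤ r) (hD : 0 < D₀)
    (hz : ∀ p < N * N, ∀ q < N * N, ∀ q' < N * N, ∑ t ∈ Finset.range r,
      cc (p * r + t) * ca (t * (N * N) + q) * cb (t * (N * N) + q') = D₀ * mmDelta N p q q')
    (he : 1 ≤ e) (hfit : ∀ n h M : ℕ, 2 ≤ n → h ≤ n → M ≤ n * n →
      (n + N ^ Nat.clog N h) * (8 * n * (2 * Nat.clog 2 n + c) + N ^ Nat.clog N h) +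
      (r ^ Nat.clog N h + r * (N * N)) + M + Nat.clog N h + Nat.clog 2 n < (n + 2) ^ e ∧
      D₀ ^ Nat.clog N h * (8 * n * (2 * Nat.clog 2 n + c) + N ^ Nat.clog N h) < (n + 2) ^ e)
    {w : ℕ} (hw : (n + 2) ^ (e + 6) ≤ 2 ^ w) (ρ : ℕ → BitVec w) (hβ : 1 ≤ β)
    (hrβ : ∀ k, N ^ k ≤ N * n → r ^ k ≤ N ^ k * N ^ k * β)
    (hT : timeConst N r * ((c + 2) * ((Nat.clog 2 n + 1) ^ 3 * ((2 * L.length + n) * β))) + 15 ≤ T) :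
    n * (2 * Nat.clog 2 n + c) ≤ T ∧
    run (program (main N r c ca cb cc) aFlag) ρ T (init w (graphInput L)) = some (decide
      (∃ lev < (graphInst w N r c n L.length (inputFun L) (fun i => (ρ i).toNat) ca cb cc).L + 1,
        (graphInst w N r c n L.length (inputFun L) (fun i => (ρ i).toNat) ca cb cc).Found
          (2 ^ lev))) := by
  obtain ⟨M, hb, hl, hi, rfl⟩ := exists_machine hL he hw ρ
  have hI : ∃ I, I = graphInst w N r c n L.length (inputFun L) (fun i => (M.ρ i).toNat) ca cb cc :=
    ⟨_, rfl⟩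
  obtain ⟨I, hI⟩ := hI
  have hV : I.Valid M := by
    rw [hI]
    refine graphInst_valid hL hN hr hn (fun i => BitVec.isLt _) ?_
    rintro _ rfl
    rw [hl]
    exact (hfit n _ _ hn (Nat.count_le _) (two_mul_length_le hL)).1
  have hE : I.Exact w D₀ := by
    subst hI
    refine ⟨hD, fun p hp q hq q' hq' => ?_, ?_⟩
    · have := congrArg (fun z : ℤ => (z : ZMod (2 ^ w))) (hz p hp q hq q' hq')
      simpa [graphInst, cast_intEnc] using this
    · exact (hfit n _ _ hn (Nat.count_le _) (two_mul_length_le hL)).2.trans_le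
        ((Nat.pow_le_pow_right (by omega) (by omega)).trans hw)
  have hr' : I.r ^ I.k ≤ I.b * I.b * β := by
    subst hI
    exact hrβ _ (pow_clog_le hN (Nat.count_le _) (by omega))
  obtain ⟨C, hC, hcost⟩ := exists_cost hI hV hβ hr'
  have hlim : 0 < M.lim := hl ▸ Nat.pow_pos (by omega)
  obtain ⟨σ', h1, h2⟩ := run_program (l := graphInput L) (flag := aFlag)
    (length_graphInput L) (hb.trans (length_graphInput L).symm) (fun i => by rw [hi]; rfl)
    hlim (by decide) (runs_main (hI.trans (by rw [hi])) hV hE hb (by rw [hi]; rfl)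
      (by rw [hi]; rfl) hC)
  constructor
  -- Drawing the words is a part of the first phase, so `T` exceeds their number and sequences of
  -- length `T` contain all hash values.
  · have h3 : I.n * I.K * 20 ≤ I.preCost := by rw [Inst.preCost]; omega
    have h4 : I.n * I.K = n * (2 * Nat.clog 2 n + c) := by subst hI; rfl
    rw [← h4]
    generalize I.n * I.K = a at *
    omega
  · obtain ⟨s, rfl⟩ := Nat.exists_eq_add_of_le ((Nat.add_le_add_right hcost 15).trans hT)
    refine run_add_of_eq_some _ _ _ _ _ _ (h2.trans (congrArg some ?_))
    rw [h1, ← hI]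
    have hw2 : 2 ≤ 2 ^ w := by
      refine le_trans ?_ hw
      calc 2 ≤ n + 2 := by omega
        _ ≤ _ := Nat.le_self_pow (by omega) _
    by_cases hF : ∃ lev < I.L + 1, I.Found (2 ^ lev)
    · rw [setOn_pos hF]
      have : ¬ 2 ^ w ∣ 1 := fun h => by have := Nat.le_of_dvd one_pos h; omega
      exact (decide_eq_true this).trans (decide_eq_true hF).symm
    · rw [setOn_neg hF]
      exact (decide_eq_false (not_not_intro (dvd_zero _))).trans (decide_eq_false hF).symm

end

end WordRAM

/-! ### The bound in terms of `n`, and the probability of error -/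

namespace WordRAM

open Function

section

variable {n : ℕ} {G : SimpleGraph (Fin n)} {L : List (Fin n × Fin n)} {N : ℕ}

/-- The bound for the number of steps: `A` is a constant. -/
noncomputable def timeBound (A e : ℝ) (n : ℕ) : ℕ :=
  ⌈A * ((Nat.clog 2 n + 1 : ℕ) : ℝ) ^ 3 * (n : ℝ) ^ e⌉₊ + 40

/-- The number of arcs is at most `(2 C + 1) * n ^ α` and the excess `β` at most `2 N * n ^ (1 - α /
2)`; the exponents add up to `1 + α / 2`. -/
theorem le_timeBound {B N : ℕ} {C α : ℝ} (hN : 1 ≤ N) (hL : IsEdgeList G L) (hn : 1 ≤ n)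
    (hα1 : 1 ≤ α) (hα2 : α < 2) (hC : (G.edgeSet.ncard : ℝ) ≤ C * (n : ℝ) ^ α) :
    B * ((Nat.clog 2 n + 1) ^ 3 * ((2 * L.length + n) * ⌈((N * n : ℕ) : ℝ) ^ (1 - α / 2)⌉₊)) + 15 ≤
      timeBound (B * ((2 * C + 1) * (2 * N))) (1 + α / 2) n := by
  have hn0 : (1 : ℝ) ≤ n := by exact_mod_cast hn
  have hN0 : (1 : ℝ) ≤ N := by exact_mod_cast hN
  have hM : ((2 * L.length + n : ℕ) : ℝ) ≤ (2 * C + 1) * (n : ℝ) ^ α := by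
    have h1 : (L.length : ℝ) ≤ G.edgeSet.ncard := by exact_mod_cast length_le_ncard hL
    have h2 : (n : ℝ) ≤ (n : ℝ) ^ α := Real.self_le_rpow_of_one_le hn0 hα1
    push_cast
    linarith
  -- The factor `2` pays for the ceiling; `N ^ (1 - α / 2) ≤ N` since the exponent is at most `1`.
  have hβ : (⌈((N * n : ℕ) : ℝ) ^ (1 - α / 2)⌉₊ : ℝ) ≤ 2 * N * (n : ℝ) ^ (1 - α / 2) := by
    have h1 : (N : ℝ) ^ (1 - α / 2) ≤ N := Real.rpow_le_self_of_one_le hN0 (by linarith)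
    have h2 : (1 : ℝ) ≤ (n : ℝ) ^ (1 - α / 2) := Real.one_le_rpow hn0 (by linarith)
    have h3 := (Nat.ceil_lt_add_one (a := ((N * n : ℕ) : ℝ) ^ (1 - α / 2)) (by positivity)).le
    rw [Nat.cast_mul, Real.mul_rpow (by positivity) (by positivity)] at h3 ⊢
    have h4 := mul_le_mul_of_nonneg_right h1 (show 0 ≤ (n : ℝ) ^ (1 - α / 2) by positivity)
    nlinarith
  have hprod : (B : ℝ) * (((Nat.clog 2 n + 1 : ℕ) : ℝ) ^ 3 * (((2 * L.length + n : ℕ) : ℝ) *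
      (⌈((N * n : ℕ) : ℝ) ^ (1 - α / 2)⌉₊ : ℝ))) ≤ B * ((2 * C + 1) * (2 * N)) *
        ((Nat.clog 2 n + 1 : ℕ) : ℝ) ^ 3 * (n : ℝ) ^ (1 + α / 2) := by
    have h1 := mul_le_mul hM hβ (by positivity) ((Nat.cast_nonneg _).trans hM)
    have h2 : (n : ℝ) ^ (1 + α / 2) = (n : ℝ) ^ α * (n : ℝ) ^ (1 - α / 2) := by
      rw [← Real.rpow_add (by linarith)]; congr 1; ring
    rw [h2]
    calc _ ≤ (B : ℝ) * (((Nat.clog 2 n + 1 : ℕ) : ℝ) ^ 3 * ((2 * C + 1) * (n : ℝ) ^ α *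
          (2 * N * (n : ℝ) ^ (1 - α / 2)))) := by gcongr
      _ = _ := by ring
  have h := hprod.trans (Nat.le_ceil _)
  rw [timeBound]
  have h' : B * ((Nat.clog 2 n + 1) ^ 3 * ((2 * L.length + n) *
      ⌈((N * n : ℕ) : ℝ) ^ (1 - α / 2)⌉₊)) ≤ ⌈B * ((2 * C + 1) * (2 * N)) *
        ((Nat.clog 2 n + 1 : ℕ) : ℝ) ^ 3 * (n : ℝ) ^ (1 + α / 2)⌉₊ := by exact_mod_cast h
  omega

/-- The probability of an answer from the number of outcomes with the other answer. -/
theorem le_prob {P : Program} {w T c : ℕ} {p : ℝ} {l : List ℕ} {F : (Fin T → BitVec w) → Prop}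
    [DecidablePred F]     (hp : (1 / 2 : ℝ) ^ c ≤ 1 - p)
    (hrun : ∀ ρ : Fin T → BitVec w, run P (extendZero ρ) T (init w l) = some (decide (F ρ)))
    (hF : (Finset.univ.filter F).card * 2 ^ c ≤ (2 ^ w) ^ T) : p ≤ prob P w l T false := by
  have h1 : {ρ : Fin T → BitVec w | run P (fun i => if h : i < T then ρ ⟨i, h⟩ else 0) T
      (init w l) = some false} = (Finset.univ.filter fun ρ => ¬ F ρ : Finset _) := by
    ext ρ
    have h2 : run P (fun i => if h : i < T then ρ ⟨i, h⟩ else 0) T (init w l) =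
      some (decide (F ρ)) := hrun ρ
    rw [Set.mem_ofPred_eq, h2, Finset.mem_coe, Finset.mem_filter]
    simp
  rw [prob, h1, Set.ncard_coe_finset]
  have h2 := Finset.card_filter_add_card_filter_not (s := Finset.univ) F
  rw [Finset.card_univ, Fintype.card_fun, card_bitVec, Fintype.card_fin] at h2
  have h3 : ((Finset.univ.filter F).card : ℝ) + ((Finset.univ.filter fun ρ => ¬ F ρ).card : ℝ) =
      ((2 : ℝ) ^ w) ^ T := by exact_mod_cast h2
  have h4 : ((Finset.univ.filter F).card : ℝ) * 2 ^ c ≤ ((2 : ℝ) ^ w) ^ T := by exact_mod_cast hF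
  have hW : (0 : ℝ) < ((2 : ℝ) ^ w) ^ T := by positivity
  rw [le_div_iff₀ hW]
  have h5 : ((Finset.univ.filter F).card : ℝ) ≤ ((2 : ℝ) ^ w) ^ T * (1 / 2) ^ c := by
    rw [div_pow, one_pow, mul_one_div, le_div_iff₀ (by positivity)]
    exact h4
  have h6 := mul_le_mul_of_nonneg_left hp hW.le
  linarith

end

theorem not_hasDominatingSet_two {n : ℕ} {G : SimpleGraph (Fin n)} (hn : n < 2) :
    ¬ HasDominatingSet G 2 := by
  rintro ⟨S, hS, -⟩
  have := Finset.card_le_univ S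
  rw [hS, Fintype.card_fin] at this
  omega

end WordRAM

theorem mainTheorem4 (hω : matMulExponent ℚ = 2)
    (α : ℝ) (hα1 : 1 ≤ α) (hα2 : α < 2) (p : ℝ) (hp0 : 0 < p) (hp1 : p < 1) :
    ∃ (P : WordRAM.Program) (κ : ℕ), ∀ C : ℝ, ∃ T : ℕ → ℕ,
      IsSoftO (fun n => (T n : ℝ)) (fun n => (n : ℝ) ^ (1 + α / 2)) ∧
      ∀ (n : ℕ) (G : SimpleGraph (Fin n)) (L : List (Fin n × Fin n)),
        IsEdgeList G L → (G.edgeSet.ncard : ℝ) ≤ C * (n : ℝ) ^ α →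
        -- the running time is at most `T n`, whatever the random words are
        (∀ ρ : ℕ → BitVec (wordSize κ n), ∃ b : Bool,
          WordRAM.run P ρ (T n) (WordRAM.init (wordSize κ n) (graphInput L)) = some b) ∧
        -- no false negatives
        (HasDominatingSet G 2 → ∀ ρ : ℕ → BitVec (wordSize κ n),
          WordRAM.run P ρ (T n) (WordRAM.init (wordSize κ n) (graphInput L)) = some true) ∧
        -- a false positive has probability at most `1 - p`
        (¬ HasDominatingSet G 2 →
          p ≤ WordRAM.prob P (wordSize κ n) (graphInput L) (T n) false) := by
  classical
  -- Here `ε = 1 - α / 2`, positive because `α < 2`: the full strength of `ω = 2` is only used up to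
  -- `ε`.
  obtain ⟨N, r', r, hN, hNr, hr, hrr, hB⟩ := WordRAM.exists_bilinear_of_matMulExponent hω le_rfl
    (show (0 : ℝ) < 1 - α / 2 by linarith)
  obtain ⟨ca, cb, cc, D₀, hD, hz⟩ := WordRAM.exists_int_bilinear hB hrr
  -- `c` additional hash functions reduce the error below `1 - p`.
  obtain ⟨c, hc⟩ := exists_pow_lt_of_lt_one (show 0 < 1 - p by linarith)
    (show (1 / 2 : ℝ) < 1 by norm_num)
  obtain ⟨e, he⟩ := WordRAM.exists_exponent N r c D₀ hN
  have he1 : 1 ≤ e := by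
    by_contra h
    have := (he 2 0 0 le_rfl (by omega) (by omega)).1
    have h2 : 0 < Nat.clog 2 2 := Nat.clog_pos one_lt_two one_lt_two
    rw [show e = 0 by omega, pow_zero] at this
    omega
  refine ⟨WordRAM.program (WordRAM.main N r c ca cb cc) aFlag, e + 6, fun C => ?_⟩
  -- The program and the word size are already fixed and do not depend on `C`. The absolute value
  -- keeps the time bound non-negative when `C` is negative.
  refine ⟨WordRAM.timeBound ((WordRAM.timeConst N r * (c + 2) : ℕ) *
    ((2 * |C| + 1) * (2 * N))) (1 + α / 2),
    WordRAM.isSoftO_time (by positivity) _ (by linarith), fun n G L hL hG => ?_⟩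
  have hw := WordRAM.pow_le_two_pow_wordSize (e + 6) n
  replace hG : (G.edgeSet.ncard : ℝ) ≤ |C| * (n : ℝ) ^ α :=
    hG.trans (mul_le_mul_of_nonneg_right (le_abs_self C) (by positivity))
  rcases Nat.lt_or_ge n 2 with hn | hn
  · have hrun := fun ρ => WordRAM.run_small (N := N) (r := r) (c := c) (ca := ca) (cb := cb)
      (cc := cc) hL hn he1 hw ρ (T := WordRAM.timeBound ((WordRAM.timeConst N r * (c + 2) : ℕ) *
        ((2 * |C| + 1) * (2 * N))) (1 + α / 2) n) (by rw [WordRAM.timeBound]; omega)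
    refine ⟨fun ρ => ⟨_, hrun ρ⟩, fun h => (WordRAM.not_hasDominatingSet_two hn h).elim, fun _ => ?_⟩
    refine WordRAM.le_prob (F := fun _ => False) hc.le (fun ρ => ?_) (by simp)
    rw [hrun]
    simp
  · have hT := WordRAM.le_timeBound (B := WordRAM.timeConst N r * (c + 2)) (N := N) (by omega) hL
      (by omega) hα1 hα2 hG
    rw [mul_assoc (WordRAM.timeConst N r)] at hT
    generalize WordRAM.timeBound _ _ n = T at hT ⊢
    have hβ : 1 ≤ ⌈((N * n : ℕ) : ℝ) ^ (1 - α / 2)⌉₊ := by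
      have : 0 < N * n := Nat.mul_pos (by omega) (by omega)
      exact Nat.ceil_pos.2 (Real.rpow_pos_of_pos (by exact_mod_cast this) _)
    -- The block size is at most `N * n`, so the excess `b ^ ε` is bounded uniformly in the graph.
    have hrβ : ∀ k, N ^ k ≤ N * n →
        r ^ k ≤ N ^ k * N ^ k * ⌈((N * n : ℕ) : ℝ) ^ (1 - α / 2)⌉₊ := fun k hk => by
      refine (WordRAM.pow_le_of_le_rpow hr (by omega)).trans (Nat.mul_le_mul_left _ ?_)
      exact Nat.ceil_mono (Real.rpow_le_rpow (by positivity) (by exact_mod_cast hk) (by linarith))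
    have hrun := fun ρ => WordRAM.run_eq hL hn hN hNr hD hz he1 he hw ρ hβ hrβ hT
    refine ⟨fun ρ => ⟨_, (hrun ρ).2⟩, fun h ρ => ?_, fun h => ?_⟩
    · rw [(hrun ρ).2, decide_eq_true (WordRAM.exists_found hL h)]
    · refine WordRAM.le_prob hc.le (fun ρ => (hrun (WordRAM.extendZero ρ)).2) ?_
      -- The number of buckets is at most `4 * n`, so `4 * n ≤ 2 ^ w` makes it a divisor of `2 ^ w`.
      refine WordRAM.card_found_le hL hn h (hrun fun _ => 0).1 (le_trans ?_ hw)
      calc 4 * n ≤ (n + 2) * (n + 2) := by nlinarith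
        _ = (n + 2) ^ 2 := (sq _).symm
        _ ≤ _ := Nat.pow_le_pow_right (by omega) (by omega)
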